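/- For $j=1,2$ let $\varepsilon_j,\mu_j:\mathbf R\to(0,\infty)$ be piecewise continuous, $1$-periodic and inversion symmetric, $\varepsilon_j(-x)=\varepsilon_j(x)$, $\mu_j(-x)=\mu_j(x)$, and let $$\mathcal L_j\psi=-\frac1{\varepsilon_j}\Big(\frac1{\mu_j}\psi'\Big)' .$$ Solutions of $\mathcal L\psi=E\psi$ are understood with $\psi$ and the flux $\frac1\mu\psi'$ continuous. For such an operator $\mathcal L$ (index dropped) use the following notions. *Bands.* $E_1(k)\le E_2(k)\le\cdots$ are the eigenvalues, with multiplicity, of $\mathcal L\psi=E\psi$, $\psi(x+1)=e^{ik}\psi(x)$; $E_m^-=\min_{[-\pi,\pi]}E_m(k)$ and $E_m^+=\max_{[-\pi,\pi]}E_m(k)$. A point $(k^*,E^*)$ is a Dirac point if for some $m\ge1$ and $\alpha>0$ one has $E_m(k)=E^*-\alpha|k-k^*|+O((k-k^*)^2)$ and $E_{m+1}(k)=E^*+\alpha|k-k^*|+O((k-k^*)^2)$ near $k^*$ (with equality $E_m(k^*)=E_{m+1}(k^*)=E^*$), and the eigenspace at $(k^*,E^*)$ is two-dimensional. *Bloch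 modes.* Let $(u,w)_X=\int_0^1\varepsilon u\bar w\,dx$. Let $\psi_{E,1},\psi_{E,2}$ be the solutions of $\mathcal L\psi=E\psi$ with $(\psi,\frac1\mu\psi')(0)=(1,0)$ and $(0,1)$ respectively. For $0<k<\pi$ and $E=E_m(k)$ put $\phi_{m,k}=\psi_{E,2}(1)\psi_{E,1}+(e^{ik}-\psi_{E,1}(1))\psi_{E,2}$ and $\varphi_{m,k}=\phi_{m,k}/\|\phi_{m,k}\|_X$; for $-\pi<k<0$ put $\varphi_{m,k}(x)=\varphi_{m,-k}(-x)$. Let $u_{m,k}(x)=e^{-ikx}\varphi_{m,k}(x)$, and let $\varphi_{m,0^\pm}$, $\varphi_{m,\pi^-}$, $\varphi_{m,(-\pi)^+}$ be the one-sided limits in $k$. *Zak phase and bulk index.* The Zak phase of the $m$-th band is, modulo $2\pi$, $$\theta_m=i\int_{-\pi}^0(\partial_ku_{m,k},u_{m,k})_X\,dk+i\int_0^\pi(\partial_ku_{m,k},u_{m,k})_X\,dk-\operatorname{Im}\ln(\varphi_{m,0^+},\varphi_{m,0^-})_X-\operatorname{Im}\ln(\varphi_{m,(-\pi)^+},\varphi_{m,\pi^-})_X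 ,$$ where a term $\operatorname{Im}\ln$ is read as $0$ if the inner product vanishes (as it does at a Dirac point). If $E_m^+<E_{m+1}^-$, the bulk index is $$\gamma_m=(-1)^{m+\ell-1}e^{i\sum_{n=1}^m\theta_n},$$ where $\ell$ is the number of Dirac points $(k^*,E^*)$ with $k^*\in[0,\pi]$ and $E^*\le E_m^-$. *Theorem.* Write superscripts $(1),(2)$ for the quantities of $\mathcal L_1,\mathcal L_2$. Suppose that for some integers $m_1,m_2\ge1$ the two operators have the same nonempty band gap $$I=\big(E^{(1),+}_{m_1},E^{(1),-}_{m_1+1}\big)=\big(E^{(2),+}_{m_2},E^{(2),-}_{m_2+1}\big)\neq\emptyset$$ and different bulk indices, $\gamma^{(1)}_{m_1}\ne\gamma^{(2)}_{m_2}$. Let $\varepsilon_0\ge1$, $\mu_0\ge1$ and $d_1\le d_2$ be real, and let $\varepsilon(x)=\varepsilon_1(x-d_1)$, $\mu(x)=\mu_1(x-d_1)$ for $x<d_1$; $\varepsilon=\varepsilon_0$, $\mu=\mu_0$ on $(d_1,d_2)$; $\varepsilon(x)=\varepsilon_2(x-d_2)$, $\mu(x)=\mu_2(x-d_2)$ for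 $x>d_2$. Then $\mathcal A_d\psi=-\frac1\varepsilon(\frac1\mu\psi')'$ has a localized interface state in the gap, for every layer thickness $d=d_2-d_1\ge0$: there are $E\in I$ and a nonzero $\psi\in L^2(\mathbf R)$ with $\mathcal A_d\psi=E\psi$. -/

import Mathlib

open Filter Topology Asymptotics MeasureTheory

noncomputable section

namespace Photonic

/-- `f` is piecewise continuous: finitely many discontinuities in every bounded interval, and
finite one-sided limits everywhere. -/
def PiecewiseContinuous (f : ℝ → ℝ) : Prop :=
  (∀ a b : ℝ, {x | x ∈ Set.Icc a b ∧ ¬ ContinuousAt f x}.Finite) ∧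
  ∀ x : ℝ, (∃ l : ℝ, Tendsto f (𝓝[<] x) (𝓝 l)) ∧ (∃ r : ℝ, Tendsto f (𝓝[>] x) (𝓝 r))

/-- The permittivity `ε` and the permeability `μ` are positive, piecewise continuous and
1-periodic. -/
structure IsPeriodicMedium (ε μ : ℝ → ℝ) : Prop where
  eps_pos : ∀ x, 0 < ε x
  mu_pos : ∀ x, 0 < μ x
  eps_pwc : PiecewiseContinuous ε
  mu_pwc : PiecewiseContinuous μ
  eps_per : ∀ x, ε (x + 1) = ε x
  mu_per : ∀ x, μ (x + 1) = μ x

/-- Inversion symmetry `ε(-x) = ε(x)`, `μ(-x) = μ(x)`. -/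
def IsInversionSymmetric (ε μ : ℝ → ℝ) : Prop :=
  (∀ x, ε (-x) = ε x) ∧ ∀ x, μ (-x) = μ x

/-- `ψ`, with flux `v = μ⁻¹ ψ'`, solves `-ε⁻¹ (μ⁻¹ ψ')' = E ψ` on the whole line. For piecewise
continuous coefficients this means that `ψ` and the flux are continuous and satisfy `ψ' = μ v`,
`v' = -E ε ψ` in integrated form. -/
structure IsSolution (ε μ : ℝ → ℝ) (E : ℝ) (ψ v : ℝ → ℂ) : Prop where
  cont : Continuous ψ
  cont_flux : Continuous v
  deriv_eq : ∀ x, ψ x = ψ 0 + ∫ t in (0 : ℝ)..x, (μ t : ℂ) * v t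
  flux_eq : ∀ x, v x = v 0 - ∫ t in (0 : ℝ)..x, ((E * ε t : ℝ) : ℂ) * ψ t

/-- The unique solution `ψ` of `ℒ ψ = E ψ` with `ψ(0) = a` and `(μ⁻¹ ψ')(0) = b`. -/
def solutionWith (ε μ : ℝ → ℝ) (E : ℝ) (a b : ℂ) : ℝ → ℂ :=
  Classical.epsilon fun ψ => ∃ v, IsSolution ε μ E ψ v ∧ ψ 0 = a ∧ v 0 = b

/-- The fundamental solution `ψ_{E,1}`. -/
def psi1 (ε μ : ℝ → ℝ) (E : ℝ) : ℝ → ℂ := solutionWith ε μ E 1 0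

/-- The fundamental solution `ψ_{E,2}`. -/
def psi2 (ε μ : ℝ → ℝ) (E : ℝ) : ℝ → ℂ := solutionWith ε μ E 0 1

/-- `ψ` is a Bloch mode of energy `E` and wavenumber `k`: a nonzero solution of `ℒ ψ = E ψ`
with `ψ(x + 1) = e^{ik} ψ(x)`. -/
def IsBlochMode (ε μ : ℝ → ℝ) (k E : ℝ) (ψ : ℝ → ℂ) : Prop :=
  ψ ≠ 0 ∧ (∃ v, IsSolution ε μ E ψ v) ∧ ∀ x, ψ (x + 1) = Complex.exp (Complex.I * k) * ψ x

/-- The dispersion relation `E_j(k)`, `j ≥ 1`: the `j`-th smallest eigenvalue, counted with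
multiplicity, of the Floquet-Bloch eigenvalue problem at wavenumber `k`, that is the least `E`
such that there are `j` linearly independent Bloch modes with energies at most `E`. -/
def bandE (ε μ : ℝ → ℝ) (j : ℕ) (k : ℝ) : ℝ :=
  sInf {E : ℝ | ∃ f : Fin j → ℝ → ℂ, LinearIndependent ℂ f ∧
    ∀ i, ∃ E' ≤ E, IsBlochMode ε μ k E' (f i)}

/-- The lower band edge `E_j^-`. -/
def bandMin (ε μ : ℝ → ℝ) (j : ℕ) : ℝ :=
  sInf (bandE ε μ j '' Set.Icc (-Real.pi) Real.pi)

/-- The upper band edge `E_j^+`. -/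
def bandMax (ε μ : ℝ → ℝ) (j : ℕ) : ℝ :=
  sSup (bandE ε μ j '' Set.Icc (-Real.pi) Real.pi)

/-- `(k, E)` is a Dirac point: two consecutive bands touch there linearly, and the space of Bloch
modes is two-dimensional. -/
def IsDiracPoint (ε μ : ℝ → ℝ) (k E : ℝ) : Prop :=
  (∃ j : ℕ, 1 ≤ j ∧ bandE ε μ j k = E ∧ bandE ε μ (j + 1) k = E ∧
    ∃ α : ℝ, 0 < α ∧
      (fun κ => bandE ε μ j κ - (E - α * |κ - k|)) =O[𝓝 k] (fun κ => (κ - k) ^ 2) ∧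
      (fun κ => bandE ε μ (j + 1) κ - (E + α * |κ - k|)) =O[𝓝 k] (fun κ => (κ - k) ^ 2)) ∧
  Module.finrank ℂ (Submodule.span ℂ {ψ : ℝ → ℂ | IsBlochMode ε μ k E ψ}) = 2

/-- The number `ℓ` of Dirac points (in the reduced Brillouin zone `[0, π]`) below the `j`-th
band. -/
def diracCount (ε μ : ℝ → ℝ) (j : ℕ) : ℕ :=
  {p : ℝ × ℝ | p.1 ∈ Set.Icc 0 Real.pi ∧ IsDiracPoint ε μ p.1 p.2 ∧
    p.2 ≤ bandMin ε μ j}.ncard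

/-- The inner product `(u, w)_X = ∫₀¹ ε u w̄`. -/
def innerX (ε : ℝ → ℝ) (u w : ℝ → ℂ) : ℂ :=
  ∫ x in (0 : ℝ)..1, (ε x : ℂ) * u x * (starRingEnd ℂ) (w x)

/-- The norm `‖u‖_X`. -/
def normX (ε : ℝ → ℝ) (u : ℝ → ℂ) : ℝ :=
  Real.sqrt (∫ x in (0 : ℝ)..1, ε x * ‖u x‖ ^ 2)

/-- The Bloch mode `φ_{j,k} = ψ_{E,2}(1) ψ_{E,1} + (e^{ik} - ψ_{E,1}(1)) ψ_{E,2}` with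
`E = E_j(k)`. -/
def phi (ε μ : ℝ → ℝ) (j : ℕ) (k x : ℝ) : ℂ :=
  psi2 ε μ (bandE ε μ j k) 1 * psi1 ε μ (bandE ε μ j k) x +
    (Complex.exp (Complex.I * k) - psi1 ε μ (bandE ε μ j k) 1) * psi2 ε μ (bandE ε μ j k) x

/-- The normalized Bloch mode of an inversion-symmetric medium: `φ_{j,k} / ‖φ_{j,k}‖_X` for
`0 < k < π`, reflected, `φ_{j,-k}(-x) / ‖φ_{j,-k}‖_X`, for `-π < k < 0`. At `k = 0, ±π`, where
`φ_{j,k}` may vanish identically, only the one-sided limits in `k` are used. -/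
def blochMode (ε μ : ℝ → ℝ) (j : ℕ) (k x : ℝ) : ℂ :=
  if 0 < k then phi ε μ j k x / normX ε (phi ε μ j k)
  else phi ε μ j (-k) (-x) / normX ε (phi ε μ j (-k))

/-- The one-sided limit in the wavenumber `k` of the normalized Bloch modes along the filter
`l`. -/
def blochModeLim (ε μ : ℝ → ℝ) (j : ℕ) (l : Filter ℝ) (x : ℝ) : ℂ :=
  limUnder l (fun k => blochMode ε μ j k x)

/-- The periodic part `u_{j,k}(x) = e^{-ikx} φ_{j,k}(x)`. -/
def periodicPart (ε μ : ℝ → ℝ) (j : ℕ) (k x : ℝ) : ℂ :=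
  blochMode ε μ j k x * Complex.exp (-(Complex.I * k * x))

/-- The Berry connection `(∂_k u_{j,k}, u_{j,k})_X`. -/
def berry (ε μ : ℝ → ℝ) (j : ℕ) (k : ℝ) : ℂ :=
  innerX ε (fun x => deriv (fun κ => periodicPart ε μ j κ x) k) (periodicPart ε μ j k)

/-- The Zak phase of the `j`-th band (a representative modulo `2π`): the two integrals of the
Berry connection, and the phase jumps at `k = 0` and between `k = π` and `k = -π`. The jumps are
overlaps of Bloch modes with the same Floquet multiplier (`1` and `-1` respectively). At a Dirac
point the modes on the two sides are orthogonal and the jump counts as `0`, in accordance with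
`Complex.log 0 = 0`; the jumps of the two touching bands cancel in the sum of their Zak phases. -/
def zakPhase (ε μ : ℝ → ℝ) (j : ℕ) : ℂ :=
  Complex.I * (∫ k in (-Real.pi)..0, berry ε μ j k) +
    Complex.I * (∫ k in (0 : ℝ)..Real.pi, berry ε μ j k) -
    ((Complex.log (innerX ε (blochModeLim ε μ j (𝓝[>] 0))
      (blochModeLim ε μ j (𝓝[<] 0)))).im : ℂ) -
    ((Complex.log (innerX ε (blochModeLim ε μ j (𝓝[>] (-Real.pi)))
      (blochModeLim ε μ j (𝓝[<] Real.pi)))).im : ℂ)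

/-- The bulk index `γ_j = (-1)^{j + ℓ - 1} exp (i ∑_{m ≤ j} θ_m)`, `j ≥ 1`. -/
def bulkIndex (ε μ : ℝ → ℝ) (j : ℕ) : ℂ :=
  (-1) ^ (j + diracCount ε μ j - 1) *
    Complex.exp (Complex.I * ∑ m ∈ Finset.Icc 1 j, zakPhase ε μ m)

/-- The coefficient of the joint structure with a homogeneous defect layer: `c₁(x - d₁)` to the
left of `d₁`, the constant `c₀` between `d₁` and `d₂`, and `c₂(x - d₂)` to the right of `d₂`. -/
def withLayer (c₁ c₂ : ℝ → ℝ) (c₀ d₁ d₂ x : ℝ) : ℝ :=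
  if x < d₁ then c₁ (x - d₁) else if x ≤ d₂ then c₀ else c₂ (x - d₂)

/-- `ψ` is an interface mode with energy `E`: a nonzero square integrable solution of
`-ε⁻¹ (μ⁻¹ ψ')' = E ψ` on the line. -/
def IsInterfaceMode (ε μ : ℝ → ℝ) (E : ℝ) (ψ : ℝ → ℂ) : Prop :=
  ψ ≠ 0 ∧ MemLp ψ 2 volume ∧ ∃ v, IsSolution ε μ E ψ v

end Photonic

end

/-! In an inversion symmetric medium the transfer matrix over one period is `!![a, b; c, a]` with
`a² - b c = 1`, and its dependence on the energy decides everything. Green's identity (`Sol.green`)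
gives the derivatives of `a`, `b`, `c`. From these and `det`, `a` is strictly monotone between `1`
and `-1` on each band, and `a (E_j(k)) = cos k` (`bandE_spec`). At a band edge `b c = 0`: the mode
is even if only `c` vanishes, odd if only `b` vanishes, and both vanish exactly when two bands
touch. In an open gap `b c > 0`, and comparing signs with the adjacent bands shows that the modes at
its two edges have opposite parity (`gap_sign`).

The bulk index is the parity, `1` or `-1`, of the mode at the lower edge of the gap
(`bulkIndex_eq`). Reflection in `k` makes the two Berry integrals cancel, so a Zak phase only
records the product of the parities at the two edges of its band (`exp_zakPhase`). Grouped by gaps,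
these factors give `-1` for every open gap and `1` for every touching; the prefactor `(-1)^(m+ℓ-1)`,
with `ℓ` counting the touchings (`diracCount_eq`), cancels them all.

In a gap with edge sign `s`, the solution decaying at `+∞` has value and flux `(√|b|, s √|c|)` at
the origin (`exists_multiplier`). Reflecting the left medium changes the sign of the flux, so when
the indices differ the data on both sides of the layer have the same sign pattern. In polar form
each is an angle in `[0, π/2]`; across the gap one angle goes from `0` to `π/2` and the other from
`π/2` to `0`. The layer rotates the angle by `ω d`, with `ω` increasing in the energy. The mismatch
of angles therefore runs from `-π/2 + ω(L) d` to `π/2 + ω(U) d`, where `L` and `U` are the gap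
edges, and meets a multiple of `π` inside the gap (`exists_int_mul_pi_eq`). There the three pieces
glue to a square integrable solution (`exists_interfaceMode`). -/

noncomputable section

namespace Photonic

/-! ### Regularity of the coefficients, differential form of the equation, Green's identity -/

/-- Bounded functions with countably many discontinuities. -/
structure Tame (f : ℝ → ℝ) : Prop where
  countable : {x | ¬ ContinuousAt f x}.Countable
  bounded : ∃ K, ∀ x, |f x| ≤ K

theorem PiecewiseContinuous.countable {f : ℝ → ℝ} (h : PiecewiseContinuous f) :
    {x | ¬ ContinuousAt f x}.Countable := by
  have : {x | ¬ ContinuousAt f x} ⊆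
      ⋃ n : ℕ, {x | x ∈ Set.Icc (-(n : ℝ)) n ∧ ¬ ContinuousAt f x} := by
    intro x hx
    obtain ⟨n, hn⟩ := exists_nat_ge |x|
    exact Set.mem_iUnion.2 ⟨n, abs_le.1 hn, hx⟩
  exact (Set.countable_iUnion fun n => (h.1 _ _).countable).mono this

theorem PiecewiseContinuous.bounded_Icc {f : ℝ → ℝ} (h : PiecewiseContinuous f) (a b : ℝ) :
    ∃ K, ∀ x ∈ Set.Icc a b, |f x| ≤ K := by
  have loc : ∀ x, ∃ K, ∀ᶠ y in 𝓝 x, |f y| ≤ K := by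
    intro x
    obtain ⟨⟨l, hl⟩, r, hr⟩ := h.2 x
    have h1 := hl.abs.eventually (ge_mem_nhds (lt_add_one |l|))
    have h2 := hr.abs.eventually (ge_mem_nhds (lt_add_one |r|))
    refine ⟨max (max (|l| + 1) (|r| + 1)) |f x|, ?_⟩
    rw [← nhdsLT_sup_nhdsGE, eventually_sup, ← Set.Ioi_insert, nhdsWithin_insert, eventually_sup]
    refine ⟨h1.mono fun y hy => ?_, ?_, h2.mono fun y hy => ?_⟩
    · exact hy.trans ((le_max_left _ _).trans (le_max_left _ _))
    · simp
    · exact hy.trans ((le_max_right _ _).trans (le_max_left _ _))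
  choose K hK using loc
  obtain ⟨t, -, ht⟩ := (isCompact_Icc (a := a) (b := b)).elim_nhds_subcover
    (fun x => {y | |f y| ≤ K x}) (fun x _ => hK x)
  -- The sum of the finitely many local bounds dominates each of them, also when the cover is empty.
  refine ⟨∑ x ∈ t, |K x|, fun y hy => ?_⟩
  obtain ⟨x, hx, hxy⟩ := Set.mem_iUnion₂.1 (ht hy)
  exact (hxy.trans (le_abs_self _)).trans
    (Finset.single_le_sum (f := fun x => |K x|) (fun i _ => abs_nonneg _) hx)

theorem PiecewiseContinuous.tame {f : ℝ → ℝ} (h : PiecewiseContinuous f)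
    (hp : ∀ x, f (x + 1) = f x) : Tame f := by
  obtain ⟨K, hK⟩ := h.bounded_Icc 0 1
  refine ⟨h.countable, K, fun x => ?_⟩
  have hper : Function.Periodic f 1 := hp
  obtain ⟨y, hy, hxy⟩ := hper.exists_mem_Ico₀ one_pos x
  rw [hxy]
  exact hK y ⟨hy.1, hy.2.le⟩

theorem Tame.const_mul {f : ℝ → ℝ} (h : Tame f) (E : ℝ) : Tame fun x => E * f x := by
  obtain ⟨K, hK⟩ := h.bounded
  refine ⟨h.countable.mono fun x hx => ?_, |E| * K, fun x => ?_⟩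
  · exact fun hc : ContinuousAt f x => hx (hc.const_mul E)
  rw [abs_mul]
  exact mul_le_mul_of_nonneg_left (hK x) (abs_nonneg _)

theorem Tame.aestronglyMeasurable {f : ℝ → ℝ} (h : Tame f) : AEStronglyMeasurable f volume := by
  set s := {x | ¬ ContinuousAt f x} with hs
  have hm : MeasurableSet sᶜ := h.countable.measurableSet.compl
  have hc : ContinuousOn f sᶜ := fun x hx => by
    have : ContinuousAt f x := by simpa [hs] using hx
    exact this.continuousWithinAt
  have := hc.aestronglyMeasurable (μ := volume) hm
  rwa [Measure.restrict_eq_self_of_ae_mem] at this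
  rw [ae_iff]
  simpa using h.countable.measure_zero volume

variable {𝕜 : Type*} [RCLike 𝕜]

theorem Tame.intervalIntegrable_smul {f : ℝ → ℝ} (h : Tame f) {g : ℝ → 𝕜} (hg : Continuous g)
    (a b : ℝ) : IntervalIntegrable (fun x => f x • g x) volume a b := by
  obtain ⟨K, hK⟩ := h.bounded
  have h1 : IntervalIntegrable (fun x => K • g x) volume a b :=
    (hg.const_smul K).intervalIntegrable _ _
  refine h1.mono_fun (h.aestronglyMeasurable.smul hg.aestronglyMeasurable).restrict ?_
  refine Eventually.of_forall fun x => ?_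
  simp only [norm_smul, Real.norm_eq_abs]
  exact mul_le_mul_of_nonneg_right ((hK x).trans (le_abs_self K)) (norm_nonneg _)

/-- `ψ`, with flux `v`, solves `ψ' = μ v`, `v' = -E ε ψ` wherever the coefficients are
continuous. -/
structure Sol (ε μ : ℝ → ℝ) (E : ℝ) (ψ v : ℝ → 𝕜) : Prop where
  cont : Continuous ψ
  cont_flux : Continuous v
  deriv : ∀ x, ContinuousAt μ x → HasDerivAt ψ (μ x • v x) x
  deriv_flux : ∀ x, ContinuousAt ε x → HasDerivAt v (-((E * ε x) • ψ x)) x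

theorem eq_add_integral {f : ℝ → ℝ} (hf : Tame f) {g y : ℝ → 𝕜} (hg : Continuous g)
    (hy : Continuous y) (hd : ∀ x, ContinuousAt f x → HasDerivAt y (f x • g x) x) (a b : ℝ) :
    ∫ t in a..b, f t • g t = y b - y a :=
  integral_eq_of_hasDerivAt_off_countable y _ hf.countable hy.continuousOn
    (fun x hx => hd x (by simpa using hx.2)) (hf.intervalIntegrable_smul hg a b)

theorem hasDerivAt_of_eq_add_integral {f : ℝ → ℝ} (hf : Tame f) {g y : ℝ → 𝕜}
    (hg : Continuous g) (h : ∀ x, y x = y 0 + ∫ t in (0 : ℝ)..x, f t • g t) (x : ℝ)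
    (hx : ContinuousAt f x) : HasDerivAt y (f x • g x) x := by
  have h1 : HasDerivAt (fun u => ∫ t in (0 : ℝ)..u, f t • g t) (f x • g x) x :=
    intervalIntegral.integral_hasDerivAt_right (hf.intervalIntegrable_smul hg 0 x)
      ((hf.aestronglyMeasurable.smul hg.aestronglyMeasurable).stronglyMeasurableAtFilter)
      (hx.smul hg.continuousAt)
  have h2 := h1.const_add (y 0)
  rwa [show y = fun u => y 0 + ∫ t in (0 : ℝ)..u, f t • g t from funext h]

/-- The fundamental theorem of calculus tolerates a countable set of exceptional points, so the
integrated equation may be replaced by pointwise derivatives at continuity points. The algebra of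
solutions is done in this second form. -/
theorem isSolution_iff_sol {ε μ : ℝ → ℝ} (hε : Tame ε) (hμ : Tame μ) {E : ℝ} {ψ v : ℝ → ℂ} :
    IsSolution ε μ E ψ v ↔ Sol ε μ E ψ v := by
  constructor
  · intro h
    refine ⟨h.cont, h.cont_flux, hasDerivAt_of_eq_add_integral hμ h.cont_flux ?_, fun x hx => ?_⟩
    · simpa only [Complex.real_smul] using h.deriv_eq
    · have := hasDerivAt_of_eq_add_integral (y := fun x => - v x) (hε.const_mul E) h.cont
        (fun x => by rw [h.flux_eq x]; simp only [Complex.real_smul]; ring) x (hx.const_mul E)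
      simpa only [neg_neg] using this.fun_neg
  · intro h
    refine ⟨h.cont, h.cont_flux, fun x => ?_, fun x => ?_⟩
    · have := eq_add_integral hμ h.cont_flux h.cont h.deriv 0 x
      simp only [Complex.real_smul] at this
      rw [this]; ring
    · have hd : ∀ x, ContinuousAt (fun x => ε x) x →
          HasDerivAt v (ε x • (-E • ψ x)) x := fun x hx => by
        refine (h.deriv_flux x hx).congr_deriv ?_
        simp only [Complex.real_smul]; push_cast; ring
      have := eq_add_integral hε (g := fun t => -E • ψ t) (h.cont.const_smul (-E))
        h.cont_flux hd 0 x
      rw [sub_eq_add_neg, ← intervalIntegral.integral_neg, ← sub_eq_iff_eq_add', ← this]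
      refine intervalIntegral.integral_congr fun t _ => ?_
      simp only [Complex.real_smul]; push_cast; ring

/-- Green's identity. -/
theorem Sol.green {ε μ : ℝ → ℝ} (hε : Tame ε) (hμ : Tame μ) {E E' : ℝ} {ψ v φ w : ℝ → 𝕜}
    (h : Sol ε μ E ψ v) (h' : Sol ε μ E' φ w) (a b : ℝ) :
    (ψ b * w b - v b * φ b) - (ψ a * w a - v a * φ a) =
      (E - E') • ∫ x in a..b, ε x • (ψ x * φ x) := by
  have key : ∫ x in a..b, ε x • ((E - E') • (ψ x * φ x)) =
      (ψ b * w b - v b * φ b) - (ψ a * w a - v a * φ a) := by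
    refine integral_eq_of_hasDerivAt_off_countable (fun x => ψ x * w x - v x * φ x) _
      (hε.countable.union hμ.countable)
      ((h.cont.mul h'.cont_flux).sub (h.cont_flux.mul h'.cont)).continuousOn (fun x hx => ?_)
      (hε.intervalIntegrable_smul ((h.cont.mul h'.cont).const_smul _) a b)
    have hx2 := hx.2
    simp only [Set.mem_union, Set.mem_ofPred_eq, not_or, not_not] at hx2
    refine (((h.deriv x hx2.2).mul (h'.deriv_flux x hx2.1)).sub
      ((h.deriv_flux x hx2.1).mul (h'.deriv x hx2.2))).congr_deriv ?_
    simp only [Algebra.smul_def, map_mul, map_sub]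
    ring
  rw [← key, ← intervalIntegral.integral_smul]
  exact intervalIntegral.integral_congr fun t _ => smul_comm _ _ _

/-! ### Existence of solutions by the Picard series -/

theorem abs_integral_le_pow_div_factorial {h : ℝ → ℝ} {C : ℝ} {n : ℕ}
    (hh : ∀ t, |h t| ≤ C * (|t| ^ n / n.factorial)) (x : ℝ) :
    |∫ t in (0 : ℝ)..x, h t| ≤ C * (|x| ^ (n + 1) / (n + 1).factorial) := by
  -- The substitution `t ↦ -t` reduces negative `x` to positive `x`.
  wlog hx : 0 ≤ x generalizing h x
  · have := this (h := fun t => h (-t)) (fun t => by simpa using hh (-t)) (-x)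
      (neg_nonneg.2 (not_le.1 hx).le)
    rw [intervalIntegral.integral_comp_neg (fun t => h t), neg_neg, neg_zero,
      intervalIntegral.integral_symm, abs_neg, abs_neg] at this
    exact this
  have key := intervalIntegral.norm_integral_le_of_norm_le (μ := volume) (f := h)
    (g := fun t => C / n.factorial * t ^ n) hx
    (Eventually.of_forall fun t ht => by
      have := hh t
      rw [abs_of_pos ht.1] at this
      rw [Real.norm_eq_abs]
      exact this.trans_eq (by ring))
    ((continuous_const.mul (continuous_pow n)).intervalIntegrable _ _)
  rw [Real.norm_eq_abs, intervalIntegral.integral_const_mul, integral_pow] at key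
  refine key.trans_eq ?_
  rw [abs_of_nonneg hx, Nat.factorial_succ]
  push_cast
  have : (n.factorial : ℝ) ≠ 0 := by positivity
  field_simp
  simp

/-- One step of the Picard iteration for `u' = f w`, `w' = g u`. -/
def picardStep (f g : ℝ → ℝ) (p : (ℝ → ℝ) × (ℝ → ℝ)) : (ℝ → ℝ) × (ℝ → ℝ) :=
  (fun x => ∫ t in (0 : ℝ)..x, f t • p.2 t, fun x => ∫ t in (0 : ℝ)..x, g t • p.1 t)

/-- The terms of the Picard series. -/
def picardTerm (f g : ℝ → ℝ) (a b : ℝ) (n : ℕ) : (ℝ → ℝ) × (ℝ → ℝ) :=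
  (picardStep f g)^[n] (fun _ => a, fun _ => b)

theorem picardTerm_succ (f g : ℝ → ℝ) (a b : ℝ) (n : ℕ) :
    picardTerm f g a b (n + 1) = picardStep f g (picardTerm f g a b n) :=
  Function.iterate_succ_apply' _ _ _

theorem continuous_picardTerm {f g : ℝ → ℝ} (hf : Tame f) (hg : Tame g) (a b : ℝ) (n : ℕ) :
    Continuous (picardTerm f g a b n).1 ∧ Continuous (picardTerm f g a b n).2 := by
  induction n with
  | zero => exact ⟨continuous_const, continuous_const⟩
  | succ n ih =>
    rw [picardTerm_succ]
    exact ⟨intervalIntegral.continuous_primitive (hf.intervalIntegrable_smul ih.2) 0,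
      intervalIntegral.continuous_primitive (hg.intervalIntegrable_smul ih.1) 0⟩

theorem abs_picardTerm_le {f g : ℝ → ℝ} {L : ℝ} (hf : ∀ x, |f x| ≤ L) (hg : ∀ x, |g x| ≤ L)
    {a b : ℝ} (ha : |a| ≤ 1) (hb : |b| ≤ 1) (n : ℕ) (x : ℝ) :
    |(picardTerm f g a b n).1 x| ≤ (L * |x|) ^ n / n.factorial ∧
      |(picardTerm f g a b n).2 x| ≤ (L * |x|) ^ n / n.factorial := by
  have hL : 0 ≤ L := (abs_nonneg _).trans (hf 0)
  induction n generalizing x with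
  | zero => simpa [picardTerm] using ⟨ha, hb⟩
  | succ n ih =>
    rw [picardTerm_succ]
    have step : ∀ h y : ℝ → ℝ, (∀ x, |h x| ≤ L) →
        (∀ x, |y x| ≤ (L * |x|) ^ n / n.factorial) →
        |∫ t in (0 : ℝ)..x, h t • y t| ≤ (L * |x|) ^ (n + 1) / (n + 1).factorial := by
      intro h y hh hy
      refine (abs_integral_le_pow_div_factorial (C := L ^ (n + 1)) (n := n) (fun t => ?_)
        x).trans_eq ?_
      · rw [smul_eq_mul, abs_mul]
        refine (mul_le_mul (hh t) (hy t) (abs_nonneg _) hL).trans_eq ?_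
        rw [mul_pow]; ring
      · rw [mul_pow]; ring
    exact ⟨step _ _ hf fun x => (ih x).2, step _ _ hg fun x => (ih x).1⟩

/-- The Picard series is dominated by the exponential series, so it may be integrated term by term;
shifting the index by one then gives the integral equations. The exponential bound is recorded
because local uniformity in the energy rests on it. -/
theorem exists_linear_system {f g : ℝ → ℝ} (hf : Tame f) (hg : Tame g) {L : ℝ}
    (hfL : ∀ x, |f x| ≤ L) (hgL : ∀ x, |g x| ≤ L) {a b : ℝ} (ha : |a| ≤ 1) (hb : |b| ≤ 1) :
    ∃ u w : ℝ → ℝ, Continuous u ∧ Continuous w ∧ u 0 = a ∧ w 0 = b ∧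
      (∀ x, u x = u 0 + ∫ t in (0 : ℝ)..x, f t • w t) ∧
      (∀ x, w x = w 0 + ∫ t in (0 : ℝ)..x, g t • u t) ∧
      ∀ x, |u x| ≤ Real.exp (L * |x|) ∧ |w x| ≤ Real.exp (L * |x|) := by
  have hL : 0 ≤ L := (abs_nonneg _).trans (hfL 0)
  -- The same convergence statement serves both components of the system.
  have gen : ∀ F : ℕ → ℝ → ℝ, (∀ n, Continuous (F n)) →
      (∀ n x, |F n x| ≤ (L * |x|) ^ n / n.factorial) →
      (Continuous fun x => ∑' n, F n x) ∧ (∀ x, HasSum (fun n => F n x) (∑' n, F n x)) ∧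
      (∀ x, |∑' n, F n x| ≤ Real.exp (L * |x|)) ∧
      ∀ h : ℝ → ℝ, Tame h → ∀ x, HasSum (fun n => ∫ t in (0 : ℝ)..x, h t • F n t)
        (∫ t in (0 : ℝ)..x, h t • ∑' n, F n t) := by
    intro F hc hF
    have hs : ∀ x, HasSum (fun n => F n x) (∑' n, F n x) := fun x =>
      (Summable.of_norm_bounded (Real.summable_pow_div_factorial (L * |x|))
        (fun n => hF n x)).hasSum
    have hmono : ∀ {x y : ℝ}, |x| ≤ y → ∀ n : ℕ,
        (L * |x|) ^ n / (n.factorial : ℝ) ≤ (L * y) ^ n / n.factorial := fun {x y} hxy n => by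
      have h0 : 0 ≤ L * |x| := mul_nonneg hL (abs_nonneg _)
      gcongr
    refine ⟨?_, hs, fun x => ?_, fun h hh x => ?_⟩
    · rw [continuous_iff_continuousAt]
      intro x
      have : ContinuousOn (fun x => ∑' n, F n x) (Set.Icc (-(|x| + 1)) (|x| + 1)) :=
        continuousOn_tsum (fun n => (hc n).continuousOn)
          (Real.summable_pow_div_factorial (L * (|x| + 1)))
          (fun n y hy => (hF n y).trans (hmono (abs_le.2 hy) n))
      refine this.continuousAt (Icc_mem_nhds ?_ ?_)
      · linarith [neg_abs_le x]
      · linarith [le_abs_self x]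
    · have h1 : HasSum (fun n : ℕ => (L * |x|) ^ n / (n.factorial : ℝ)) (Real.exp (L * |x|)) := by
        rw [Real.exp_eq_exp_ℝ]; exact NormedSpace.expSeries_div_hasSum_exp (L * |x|)
      exact tsum_of_norm_bounded (f := fun n => F n x) h1 (fun n => hF n x)
    · obtain ⟨K, hK⟩ := hh.bounded
      refine intervalIntegral.hasSum_integral_of_dominated_convergence
        (fun n _ => K * ((L * |x|) ^ n / (n.factorial : ℝ)))
        (fun n => (hh.aestronglyMeasurable.smul (hc n).aestronglyMeasurable).restrict)
        (fun n => Eventually.of_forall fun t ht => ?_)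
        (Eventually.of_forall fun t _ => (Real.summable_pow_div_factorial _).mul_left _)
        intervalIntegrable_const
        (Eventually.of_forall fun t _ => (hs t).const_smul _)
      have htx : |t| ≤ |x| := by
        rw [Set.mem_uIoc] at ht
        rcases ht with ⟨h1, h2⟩ | ⟨h1, h2⟩
        · rw [abs_of_pos h1]; exact h2.trans (le_abs_self x)
        · rw [abs_of_nonpos h2]; linarith [neg_le_abs x]
      rw [norm_smul]
      exact mul_le_mul (hK t) ((hF n t).trans (hmono htx n)) (norm_nonneg _)
        ((abs_nonneg _).trans (hK t))
  obtain ⟨u_cont, u_sum, u_le, u_int⟩ := gen (fun n => (picardTerm f g a b n).1)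
    (fun n => (continuous_picardTerm hf hg a b n).1)
    (fun n x => (abs_picardTerm_le hfL hgL ha hb n x).1)
  obtain ⟨w_cont, w_sum, w_le, w_int⟩ := gen (fun n => (picardTerm f g a b n).2)
    (fun n => (continuous_picardTerm hf hg a b n).2)
    (fun n x => (abs_picardTerm_le hfL hgL ha hb n x).2)
  have hu : ∀ x, ∑' n, (picardTerm f g a b n).1 x =
      a + ∫ t in (0 : ℝ)..x, f t • ∑' n, (picardTerm f g a b n).2 t := by
    intro x
    rw [(u_sum x).summable.tsum_eq_zero_add, ← (w_int f hf x).tsum_eq]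
    simp only [picardTerm_succ]
    rfl
  have hw : ∀ x, ∑' n, (picardTerm f g a b n).2 x =
      b + ∫ t in (0 : ℝ)..x, g t • ∑' n, (picardTerm f g a b n).1 t := by
    intro x
    rw [(w_sum x).summable.tsum_eq_zero_add, ← (u_int g hg x).tsum_eq]
    simp only [picardTerm_succ]
    rfl
  have hu0 : ∑' n, (picardTerm f g a b n).1 0 = a := by simpa using hu 0
  have hw0 : ∑' n, (picardTerm f g a b n).2 0 = b := by simpa using hw 0
  refine ⟨_, _, u_cont, w_cont, hu0, hw0, fun x => ?_, fun x => ?_, fun x => ⟨u_le x, w_le x⟩⟩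
  · simp only [hu0]; exact hu x
  · simp only [hw0]; exact hw x

theorem exists_sol {ε μ : ℝ → ℝ} (hε : Tame ε) (hμ : Tame μ) :
    ∃ K : ℝ, ∀ (E : ℝ) {a b : ℝ}, |a| ≤ 1 → |b| ≤ 1 → ∃ ψ v : ℝ → ℝ, Sol ε μ E ψ v ∧
      ψ 0 = a ∧ v 0 = b ∧ ∀ x, |ψ x| ≤ Real.exp (K * (1 + |E|) * |x|) ∧
        |v x| ≤ Real.exp (K * (1 + |E|) * |x|) := by
  obtain ⟨K₁, h₁⟩ := hε.bounded
  obtain ⟨K₂, h₂⟩ := hμ.bounded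
  have hK₁ : 0 ≤ K₁ := (abs_nonneg _).trans (h₁ 0)
  have hK₂ : 0 ≤ K₂ := (abs_nonneg _).trans (h₂ 0)
  refine ⟨K₁ + K₂, fun E a b ha hb => ?_⟩
  have hE := abs_nonneg E
  have hε' := hε.const_mul (-E)
  obtain ⟨u, w, hu, hw, hu0, hw0, eu, ew, hbd⟩ := exists_linear_system hμ hε'
    -- The growth rate depends on the energy only through the factor `1 + |E|`, hence stays bounded
    -- for `E` near any given energy.
    (L := (K₁ + K₂) * (1 + |E|)) (fun x => (h₂ x).trans (by nlinarith))
    (fun x => by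
      rw [abs_mul, abs_neg]
      nlinarith [mul_le_mul_of_nonneg_left (h₁ x) hE, mul_nonneg hK₂ hE])
    ha hb
  refine ⟨u, w, ⟨hu, hw, fun x hx => hasDerivAt_of_eq_add_integral hμ hw eu x hx,
    fun x hx => ?_⟩, hu0, hw0, hbd⟩
  refine (hasDerivAt_of_eq_add_integral hε' hu ew x (hx.const_mul (-E))).congr_deriv ?_
  simp

/-! ### Symmetries of the equation and the fundamental system -/

section

variable {𝕜 : Type*} [RCLike 𝕜]

theorem Sol.ofReal {ε μ : ℝ → ℝ} {E : ℝ} {ψ v : ℝ → ℝ} (h : Sol ε μ E ψ v) :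
    Sol ε μ E (fun x => (ψ x : 𝕜)) fun x => (v x : 𝕜) where
  cont := RCLike.continuous_ofReal.comp h.cont
  cont_flux := RCLike.continuous_ofReal.comp h.cont_flux
  deriv x hx := by
    refine ((RCLike.ofRealCLM (K := 𝕜)).hasFDerivAt.comp_hasDerivAt x (h.deriv x hx)).congr_deriv ?_
    simp [Algebra.smul_def]
  deriv_flux x hx := by
    refine ((RCLike.ofRealCLM (K := 𝕜)).hasFDerivAt.comp_hasDerivAt x
      (h.deriv_flux x hx)).congr_deriv ?_
    simp [Algebra.smul_def]

theorem Sol.conj {ε μ : ℝ → ℝ} {E : ℝ} {ψ v : ℝ → 𝕜} (h : Sol ε μ E ψ v) :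
    Sol ε μ E (fun x => starRingEnd 𝕜 (ψ x)) fun x => starRingEnd 𝕜 (v x) where
  cont := RCLike.continuous_conj.comp h.cont
  cont_flux := RCLike.continuous_conj.comp h.cont_flux
  deriv x hx := by
    refine ((RCLike.conjCLE (K := 𝕜)).hasFDerivAt.comp_hasDerivAt x (h.deriv x hx)).congr_deriv ?_
    simp [Algebra.smul_def]
  deriv_flux x hx := by
    refine ((RCLike.conjCLE (K := 𝕜)).hasFDerivAt.comp_hasDerivAt x
      (h.deriv_flux x hx)).congr_deriv ?_
    simp [Algebra.smul_def]

theorem Sol.add {ε μ : ℝ → ℝ} {E : ℝ} {ψ v φ w : ℝ → 𝕜} (h : Sol ε μ E ψ v)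
    (h' : Sol ε μ E φ w) : Sol ε μ E (fun x => ψ x + φ x) fun x => v x + w x where
  cont := h.cont.add h'.cont
  cont_flux := h.cont_flux.add h'.cont_flux
  deriv x hx := ((h.deriv x hx).add (h'.deriv x hx)).congr_deriv (smul_add _ _ _).symm
  deriv_flux x hx := ((h.deriv_flux x hx).add (h'.deriv_flux x hx)).congr_deriv
    (by rw [smul_add, neg_add])

theorem Sol.const_mul {ε μ : ℝ → ℝ} {E : ℝ} {ψ v : ℝ → 𝕜} (h : Sol ε μ E ψ v) (z : 𝕜) :
    Sol ε μ E (fun x => z * ψ x) fun x => z * v x where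
  cont := h.cont.const_mul z
  cont_flux := h.cont_flux.const_mul z
  deriv x hx := ((h.deriv x hx).const_mul z).congr_deriv (mul_smul_comm _ _ _)
  deriv_flux x hx := ((h.deriv_flux x hx).const_mul z).congr_deriv
    (by rw [mul_neg, mul_smul_comm])

theorem Sol.shift {ε μ : ℝ → ℝ} (hε : ∀ x, ε (x + 1) = ε x) (hμ : ∀ x, μ (x + 1) = μ x)
    {E : ℝ} {ψ v : ℝ → 𝕜} (h : Sol ε μ E ψ v) :
    Sol ε μ E (fun x => ψ (x + 1)) fun x => v (x + 1) := by
  have hc : ∀ f : ℝ → ℝ, (∀ x, f (x + 1) = f x) → ∀ x, ContinuousAt f x →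
      ContinuousAt f (x + 1) := fun f hf x hx => by
    have h1 : ContinuousAt f (x + 1 + (-1)) := by simpa using hx
    have h2 : ContinuousAt (fun y => f (y + (-1))) (x + 1) :=
      ContinuousAt.comp' (f := fun y : ℝ => y + (-1)) h1 (by fun_prop)
    refine h2.congr (Eventually.of_forall fun y => ?_)
    simpa using (hf (y + (-1))).symm
  refine ⟨h.cont.comp (by fun_prop), h.cont_flux.comp (by fun_prop), fun x hx => ?_,
    fun x hx => ?_⟩
  · refine ((h.deriv (x + 1) (hc μ hμ x hx)).comp_add_const x 1).congr_deriv ?_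
    rw [hμ]
  · refine ((h.deriv_flux (x + 1) (hc ε hε x hx)).comp_add_const x 1).congr_deriv ?_
    rw [hε]

theorem Sol.reflect {ε μ : ℝ → ℝ} (hε : ∀ x, ε (-x) = ε x) (hμ : ∀ x, μ (-x) = μ x)
    {E : ℝ} {ψ v : ℝ → 𝕜} (h : Sol ε μ E ψ v) :
    Sol ε μ E (fun x => ψ (-x)) fun x => -v (-x) := by
  have hc : ∀ f : ℝ → ℝ, (∀ x, f (-x) = f x) → ∀ x, ContinuousAt f x →
      ContinuousAt f (-x) := fun f hf x hx => by
    have h1 : ContinuousAt f (- -x) := by simpa using hx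
    have h2 : ContinuousAt (fun y => f (-y)) (-x) :=
      ContinuousAt.comp' (f := fun y : ℝ => -y) h1 (by fun_prop)
    exact h2.congr (Eventually.of_forall hf)
  refine ⟨h.cont.comp continuous_neg, (h.cont_flux.comp continuous_neg).neg, fun x hx => ?_,
    fun x hx => ?_⟩
  · refine ((h.deriv (-x) (hc μ hμ x hx)).scomp x (hasDerivAt_neg x)).congr_deriv ?_
    rw [hμ]; simp
  · refine (((h.deriv_flux (-x) (hc ε hε x hx)).scomp x (hasDerivAt_neg x)).fun_neg).congr_deriv ?_
    rw [hε]; simp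

/-- The solutions `ψ_{E,1}`, `ψ_{E,2}` with their fluxes, as real functions of `E` and `x`. -/
structure FundamentalSystem (ε μ : ℝ → ℝ) where
  ψ₁ : ℝ → ℝ → ℝ
  v₁ : ℝ → ℝ → ℝ
  ψ₂ : ℝ → ℝ → ℝ
  v₂ : ℝ → ℝ → ℝ
  sol₁ : ∀ E, Sol ε μ E (ψ₁ E) (v₁ E)
  sol₂ : ∀ E, Sol ε μ E (ψ₂ E) (v₂ E)
  ψ₁_zero : ∀ E, ψ₁ E 0 = 1
  v₁_zero : ∀ E, v₁ E 0 = 0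
  ψ₂_zero : ∀ E, ψ₂ E 0 = 0
  v₂_zero : ∀ E, v₂ E 0 = 1
  bound : ∃ K : ℝ, ∀ E x, |ψ₁ E x| ≤ Real.exp (K * (1 + |E|) * |x|) ∧
    |ψ₂ E x| ≤ Real.exp (K * (1 + |E|) * |x|)

theorem nonempty_fundamentalSystem {ε μ : ℝ → ℝ} (hε : Tame ε) (hμ : Tame μ) :
    Nonempty (FundamentalSystem ε μ) := by
  obtain ⟨K, hK⟩ := exists_sol hε hμ
  choose ψ₁ v₁ s₁ i₁ j₁ b₁ using fun E => hK E (a := 1) (b := 0) (by simp) (by simp)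
  choose ψ₂ v₂ s₂ i₂ j₂ b₂ using fun E => hK E (a := 0) (b := 1) (by simp) (by simp)
  exact ⟨⟨ψ₁, v₁, ψ₂, v₂, s₁, s₂, i₁, j₁, i₂, j₂, K, fun E x => ⟨(b₁ E x).1, (b₂ E x).1⟩⟩⟩

namespace FundamentalSystem

variable {ε μ : ℝ → ℝ} (F : FundamentalSystem ε μ)

theorem wronskian (hε : Tame ε) (hμ : Tame μ) (E x : ℝ) :
    F.ψ₁ E x * F.v₂ E x - F.v₁ E x * F.ψ₂ E x = 1 := by
  have := (F.sol₁ E).green hε hμ (F.sol₂ E) 0 x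
  rw [F.ψ₁_zero, F.v₁_zero, F.ψ₂_zero, F.v₂_zero, sub_self, zero_smul] at this
  linarith

/-- Green's identity at equal energies says that Wronskians are constant. Cramer's rule with the
unit Wronskian of the fundamental system then recovers any solution from its data at `0`. This is
the uniqueness theorem of the file. -/
theorem repr (hε : Tame ε) (hμ : Tame μ) {E : ℝ} {ψ v : ℝ → 𝕜} (h : Sol ε μ E ψ v) (x : ℝ) :
    ψ x = ψ 0 * F.ψ₁ E x + v 0 * F.ψ₂ E x ∧ v x = ψ 0 * F.v₁ E x + v 0 * F.v₂ E x := by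
  have h1 := h.green hε hμ (F.sol₁ E).ofReal 0 x
  have h2 := h.green hε hμ (F.sol₂ E).ofReal 0 x
  have hw : (F.ψ₁ E x : 𝕜) * F.v₂ E x - F.v₁ E x * F.ψ₂ E x = 1 := by
    exact_mod_cast congrArg (fun r : ℝ => (r : 𝕜)) (F.wronskian hε hμ E x)
  simp only [F.ψ₁_zero, F.v₁_zero, F.ψ₂_zero, F.v₂_zero, sub_self, zero_smul, RCLike.ofReal_zero,
    RCLike.ofReal_one] at h1 h2
  constructor
  · linear_combination (-ψ x) * hw + F.ψ₁ E x * h2 - F.ψ₂ E x * h1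
  · linear_combination (-v x) * hw + F.v₁ E x * h2 - F.v₂ E x * h1

/-- Existence makes the `Classical.epsilon` choice a genuine solution, and uniqueness identifies it.
-/
theorem solutionWith_eq (hε : Tame ε) (hμ : Tame μ) (E a b : ℝ) :
    solutionWith ε μ E a b = fun x => (a * F.ψ₁ E x + b * F.ψ₂ E x : ℂ) := by
  have hs : Sol ε μ E (fun x => (a * F.ψ₁ E x + b * F.ψ₂ E x : ℂ))
      (fun x => (a * F.v₁ E x + b * F.v₂ E x : ℂ)) :=
    ((F.sol₁ E).ofReal.const_mul (a : ℂ)).add ((F.sol₂ E).ofReal.const_mul (b : ℂ))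
  have ex : ∃ ψ : ℝ → ℂ, ∃ v, IsSolution ε μ E ψ v ∧ ψ 0 = a ∧ v 0 = b :=
    ⟨_, _, (isSolution_iff_sol hε hμ).2 hs, by simp [F.ψ₁_zero, F.ψ₂_zero],
      by simp [F.v₁_zero, F.v₂_zero]⟩
  obtain ⟨v, hv, h0, h1⟩ := Classical.epsilon_spec ex
  funext x
  have := (F.repr hε hμ ((isSolution_iff_sol hε hμ).1 hv) x).1
  rw [h0, h1] at this
  exact this

theorem psi1_eq (hε : Tame ε) (hμ : Tame μ) (E : ℝ) :
    psi1 ε μ E = fun x => (F.ψ₁ E x : ℂ) := by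
  simpa [psi1] using F.solutionWith_eq hε hμ E 1 0

theorem psi2_eq (hε : Tame ε) (hμ : Tame μ) (E : ℝ) :
    psi2 ε μ E = fun x => (F.ψ₂ E x : ℂ) := by
  simpa [psi2] using F.solutionWith_eq hε hμ E 0 1

end FundamentalSystem

end

/-! ### The monodromy matrix and its derivatives in the energy -/

section

variable {𝕜 : Type*} [RCLike 𝕜]

theorem IsPeriodicMedium.tame_eps {ε μ : ℝ → ℝ} (h : IsPeriodicMedium ε μ) : Tame ε :=
  h.eps_pwc.tame h.eps_per

theorem IsPeriodicMedium.tame_mu {ε μ : ℝ → ℝ} (h : IsPeriodicMedium ε μ) : Tame μ :=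
  h.mu_pwc.tame h.mu_per

theorem hasDerivAt_of_quadratic {f : ℝ → ℝ} {f' C x : ℝ}
    (h : ∀ y, |y - x| ≤ 1 → |f y - f x - (y - x) * f'| ≤ C * (y - x) ^ 2) :
    HasDerivAt f f' x := by
  rw [hasDerivAt_iff_isLittleO]
  have h1 : (fun y => f y - f x - (y - x) • f') =O[𝓝 x] fun y => (y - x) ^ 2 := by
    refine IsBigO.of_bound C ?_
    filter_upwards [Metric.closedBall_mem_nhds x one_pos] with y hy
    rw [Real.norm_eq_abs, Real.norm_eq_abs, abs_of_nonneg (sq_nonneg (y - x))]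
    exact h y hy
  exact h1.trans_isLittleO (by
    have : (fun y : ℝ => (y - x) ^ 2) =o[𝓝 x] fun y => (y - x) ^ 1 :=
      (isLittleO_pow_pow (𝕜 := ℝ) one_lt_two).comp_tendsto
        (by simpa using (tendsto_id (x := 𝓝 x)).sub_const x)
    simpa using this)

namespace FundamentalSystem

variable {ε μ : ℝ → ℝ} (F : FundamentalSystem ε μ)

/-- `ψ_{E,1}(1)`: half the discriminant of an inversion symmetric medium. -/
def a (E : ℝ) : ℝ := F.ψ₁ E 1
/-- `ψ_{E,2}(1)`. -/
def b (E : ℝ) : ℝ := F.ψ₂ E 1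
/-- The flux of `ψ_{E,1}` at `1`. -/
def c (E : ℝ) : ℝ := F.v₁ E 1
/-- `‖ψ_{E,1}‖_X²`. -/
def A (E : ℝ) : ℝ := ∫ x in (0 : ℝ)..1, ε x • (F.ψ₁ E x * F.ψ₁ E x)
/-- `‖ψ_{E,2}‖_X²`. -/
def B (E : ℝ) : ℝ := ∫ x in (0 : ℝ)..1, ε x • (F.ψ₂ E x * F.ψ₂ E x)
/-- `(ψ_{E,1}, ψ_{E,2})_X`. -/
def G (E : ℝ) : ℝ := ∫ x in (0 : ℝ)..1, ε x • (F.ψ₁ E x * F.ψ₂ E x)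

variable (hM : IsPeriodicMedium ε μ) (hS : IsInversionSymmetric ε μ)

include hM hS

/-- Reflection preserves the equation and changes the sign of the flux; here the data `(1, 0)` are
unchanged, so uniqueness applies. For `ψ₂` they become the negatives. -/
theorem reflect₁ (E x : ℝ) : F.ψ₁ E (-x) = F.ψ₁ E x ∧ F.v₁ E (-x) = -F.v₁ E x := by
  have := F.repr hM.tame_eps hM.tame_mu ((F.sol₁ E).reflect hS.1 hS.2) x
  simp only [neg_zero, F.ψ₁_zero, F.v₁_zero, one_mul, zero_mul, add_zero, RCLike.ofReal_real_eq_id,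
    id] at this
  exact ⟨this.1, by linarith [this.2]⟩

theorem reflect₂ (E x : ℝ) : F.ψ₂ E (-x) = -F.ψ₂ E x ∧ F.v₂ E (-x) = F.v₂ E x := by
  have := F.repr hM.tame_eps hM.tame_mu ((F.sol₂ E).reflect hS.1 hS.2) x
  simp only [neg_zero, F.ψ₂_zero, F.v₂_zero, one_mul, zero_mul, RCLike.ofReal_real_eq_id,
    id, zero_add, neg_mul] at this
  exact ⟨this.1, by linarith [this.2]⟩

omit hS in
theorem shift_aux {E : ℝ} {ψ v : ℝ → 𝕜} (h : Sol ε μ E ψ v) (x : ℝ) :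
    ψ (x + 1) = ψ 1 * F.ψ₁ E x + v 1 * F.ψ₂ E x ∧
      v (x + 1) = ψ 1 * F.v₁ E x + v 1 * F.v₂ E x := by
  have := F.repr hM.tame_eps hM.tame_mu (h.shift hM.eps_per hM.mu_per) x
  simpa only [zero_add] using this

/-- Transporting from `-1` to `0` and using parity gives `a² - b c = 1` and `v₂² - b c = 1`; the
Wronskian gives `a v₂ - b c = 1`. Together, `(v₂ - a)² = 0`. -/
theorem v₂_one (E : ℝ) : F.v₂ E 1 = F.a E := by
  have h1 := F.shift_aux hM (F.sol₁ E) (-1)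
  have h2 := F.shift_aux hM (F.sol₂ E) (-1)
  have r1 := F.reflect₁ hM hS E 1
  have r2 := F.reflect₂ hM hS E 1
  have hw := F.wronskian hM.tame_eps hM.tame_mu E 1
  simp only [neg_add_cancel, F.ψ₁_zero, F.v₁_zero, F.ψ₂_zero, F.v₂_zero, r1, r2,
    RCLike.ofReal_real_eq_id, id] at h1 h2
  have : (F.v₂ E 1 - F.ψ₁ E 1) ^ 2 = 0 := by nlinarith [h1.1, h2.2]
  have := pow_eq_zero_iff (two_ne_zero) |>.1 this
  unfold a; linarith

theorem det (E : ℝ) : F.a E ^ 2 - F.b E * F.c E = 1 := by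
  have hw := F.wronskian hM.tame_eps hM.tame_mu E 1
  rw [F.v₂_one hM hS] at hw
  unfold a b c at *; linarith

omit hS in
theorem shift₁ (E x : ℝ) : F.ψ₁ E (x + 1) = F.a E * F.ψ₁ E x + F.c E * F.ψ₂ E x :=
  (F.shift_aux hM (F.sol₁ E) x).1

theorem shift₂ (E x : ℝ) : F.ψ₂ E (x + 1) = F.b E * F.ψ₁ E x + F.a E * F.ψ₂ E x := by
  rw [← F.v₂_one hM hS]; exact (F.shift_aux hM (F.sol₂ E) x).1

omit hS in
theorem integral_sq_pos {ψ : ℝ → ℝ} (h : Continuous ψ) {x₀ : ℝ} (h0 : x₀ ∈ Set.Ioo (0 : ℝ) 1)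
    (hx₀ : ψ x₀ ≠ 0) : 0 < ∫ x in (0 : ℝ)..1, ε x • (ψ x * ψ x) := by
  have hi := hM.tame_eps.intervalIntegrable_smul (h.mul h) 0 1
  have hn : ∀ x, 0 ≤ ε x • (ψ x * ψ x) := fun x =>
    mul_nonneg (hM.eps_pos x).le (mul_self_nonneg _)
  rw [intervalIntegral.integral_pos_iff_support_of_nonneg_ae
    (Eventually.of_forall hn) hi]
  refine ⟨one_pos, ?_⟩
  have ho : IsOpen ({x | ψ x ≠ 0} ∩ Set.Ioo 0 1) := (isOpen_ne_fun h continuous_const).inter isOpen_Ioo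
  refine (ho.measure_pos volume ⟨x₀, hx₀, h0⟩).trans_le (measure_mono ?_)
  rintro x ⟨hx, h1⟩
  refine ⟨?_, h1.1, h1.2.le⟩
  simp only [Function.mem_support, smul_eq_mul, ne_eq, mul_eq_zero, or_self, not_or]
  exact ⟨(hM.eps_pos x).ne', hx⟩

omit hS in
theorem A_pos (E : ℝ) : 0 < F.A E := by
  have hc : ∀ᶠ x in 𝓝[>] (0 : ℝ), F.ψ₁ E x ≠ 0 :=
    ((F.sol₁ E).cont.continuousAt.eventually_ne (by simp [F.ψ₁_zero])).filter_mono
      nhdsWithin_le_nhds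
  obtain ⟨x, hx, h1⟩ := (hc.and (Ioo_mem_nhdsGT one_pos)).exists
  exact integral_sq_pos hM (F.sol₁ E).cont h1 hx

omit hS in
-- Since `ψ₂` starts at `0`, its flux must be used: it equals `1` at the origin, so `ψ₂ = ∫ μ v₂` is
-- strictly positive just to the right of it.
theorem B_pos (E : ℝ) : 0 < F.B E := by
  by_contra hn
  have h0 : ∀ x ∈ Set.Ioo (0 : ℝ) 1, F.ψ₂ E x = 0 := fun x hx => by
    by_contra hne
    exact hn (integral_sq_pos hM (F.sol₂ E).cont hx hne)
  have hcl : Set.Icc (0 : ℝ) 1 ⊆ {x | F.ψ₂ E x = 0} := by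
    rw [← closure_Ioo zero_ne_one]
    exact closure_minimal h0 (isClosed_eq (F.sol₂ E).cont continuous_const)
  have hpos : ∀ᶠ x in 𝓝[>] (0 : ℝ), 0 < F.v₂ E x :=
    ((F.sol₂ E).cont_flux.continuousAt.eventually_const_lt (by simp [F.v₂_zero])).filter_mono
      nhdsWithin_le_nhds
  obtain ⟨δ, hδ, hδ'⟩ := (mem_nhdsGT_iff_exists_Ioo_subset' (one_pos (α := ℝ))).1
    (hpos.and (Ioo_mem_nhdsGT one_pos))
  have hint := eq_add_integral hM.tame_mu (F.sol₂ E).cont_flux (F.sol₂ E).cont (F.sol₂ E).deriv 0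
    (min δ 1)
  have hm : (0 : ℝ) < min δ 1 := lt_min hδ one_pos
  rw [hcl ⟨hm.le, min_le_right _ _⟩, F.ψ₂_zero, sub_zero] at hint
  refine absurd hint (ne_of_gt ?_)
  refine intervalIntegral.intervalIntegral_pos_of_pos_on
    (hM.tame_mu.intervalIntegrable_smul (F.sol₂ E).cont_flux 0 _) (fun x hx => ?_) hm
  exact mul_pos (hM.mu_pos x) (hδ' ⟨hx.1, hx.2.trans_le (min_le_left _ _)⟩).1

omit hM hS in
/-- The solutions depend locally Lipschitz continuously on the energy. -/
theorem exists_lipschitz (hε : Tame ε) (hμ : Tame μ) (E₀ : ℝ) :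
    ∃ C : ℝ, 0 ≤ C ∧ ∀ E x, |E - E₀| ≤ 1 → x ∈ Set.Icc (0 : ℝ) 1 →
      |F.ψ₁ E x| ≤ C ∧ |F.ψ₂ E x| ≤ C ∧
      |F.ψ₁ E x - F.ψ₁ E₀ x| ≤ C * |E - E₀| ∧ |F.ψ₂ E x - F.ψ₂ E₀ x| ≤ C * |E - E₀| := by
  obtain ⟨K, hK⟩ := F.bound
  obtain ⟨L, hL⟩ := hε.bounded
  have hL0 : 0 ≤ L := (abs_nonneg _).trans (hL 0)
  set D := Real.exp (|K| * (2 + |E₀|)) with hD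
  have hD0 : 0 < D := Real.exp_pos _
  have hbd : ∀ E x, |E - E₀| ≤ 1 → x ∈ Set.Icc (0 : ℝ) 1 →
      |F.ψ₁ E x| ≤ D ∧ |F.ψ₂ E x| ≤ D := by
    intro E x hE hx
    have hE' : |E| ≤ 1 + |E₀| := by
      calc |E| = |(E - E₀) + E₀| := by ring_nf
        _ ≤ _ := (abs_add_le _ _).trans (by linarith)
    have : Real.exp (K * (1 + |E|) * |x|) ≤ D := by
      refine Real.exp_le_exp.2 ?_
      have h1 : K * (1 + |E|) * |x| ≤ |K| * (1 + |E|) * |x| := by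
        have := le_abs_self K
        have := abs_nonneg E
        gcongr
      have h2 : |x| ≤ 1 := by rw [abs_of_nonneg hx.1]; exact hx.2
      have h3 : |K| * (1 + |E|) * |x| ≤ |K| * (1 + |E|) * 1 := by gcongr
      nlinarith [abs_nonneg K]
    exact ⟨(hK E x).1.trans this, (hK E x).2.trans this⟩
  have hI : ∀ E x, |E - E₀| ≤ 1 → x ∈ Set.Icc (0 : ℝ) 1 → ∀ f g : ℝ → ℝ,
      (∀ y ∈ Set.Icc (0 : ℝ) 1, |f y| ≤ D) → (∀ y ∈ Set.Icc (0 : ℝ) 1, |g y| ≤ D) →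
      |∫ y in (0 : ℝ)..x, ε y • (f y * g y)| ≤ L * D ^ 2 := by
    intro E x hE hx f g hf hg
    have := intervalIntegral.norm_integral_le_of_norm_le_const (a := (0 : ℝ)) (b := x)
      (f := fun y => ε y • (f y * g y)) (C := L * D ^ 2) (fun y hy => by
        rw [Set.uIoc_of_le hx.1] at hy
        have hy' : y ∈ Set.Icc (0 : ℝ) 1 := ⟨hy.1.le, hy.2.trans hx.2⟩
        rw [smul_eq_mul, norm_mul, norm_mul, sq]
        exact mul_le_mul (hL y) (mul_le_mul (hf y hy') (hg y hy') (norm_nonneg _) hD0.le)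
          (by positivity) hL0)
    refine this.trans ?_
    rw [sub_zero, abs_of_nonneg hx.1]
    exact mul_le_of_le_one_right (by positivity) hx.2
  have hdiff : ∀ E x, |E - E₀| ≤ 1 → x ∈ Set.Icc (0 : ℝ) 1 → ∀ ψ v : ℝ → ℝ, Sol ε μ E ψ v →
      (∀ y ∈ Set.Icc (0 : ℝ) 1, |ψ y| ≤ D) →
      |ψ x - (ψ 0 * F.ψ₁ E₀ x + v 0 * F.ψ₂ E₀ x)| ≤ 2 * (L * D ^ 3) * |E - E₀| := by
    intro E x hE hx ψ v hψ hψD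
    have h0 : |E₀ - E₀| ≤ 1 := by simp
    have h1 := (F.sol₁ E₀).green hε hμ hψ 0 x
    have h2 := (F.sol₂ E₀).green hε hμ hψ 0 x
    have hw := F.wronskian hε hμ E₀ x
    have i1 := hI E x hE hx (F.ψ₁ E₀) ψ (fun y hy => (hbd E₀ y h0 hy).1) hψD
    have i2 := hI E x hE hx (F.ψ₂ E₀) ψ (fun y hy => (hbd E₀ y h0 hy).2) hψD
    obtain ⟨b1, b2⟩ := hbd E₀ x h0 hx
    simp only [F.ψ₁_zero, F.v₁_zero, F.ψ₂_zero, F.v₂_zero] at h1 h2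
    set I1 := ∫ y in (0 : ℝ)..x, ε y • (F.ψ₁ E₀ y * ψ y)
    set I2 := ∫ y in (0 : ℝ)..x, ε y • (F.ψ₂ E₀ y * ψ y)
    -- Variation of constants: Green's identity against both solutions at `E₀`, solved with their
    -- Wronskian.
    have e : ψ x - (ψ 0 * F.ψ₁ E₀ x + v 0 * F.ψ₂ E₀ x) =
        (E - E₀) * (F.ψ₁ E₀ x * I2 - F.ψ₂ E₀ x * I1) := by
      simp only [smul_eq_mul] at h1 h2
      linear_combination (-ψ x) * hw + F.ψ₂ E₀ x * h1 - F.ψ₁ E₀ x * h2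
    rw [e, abs_mul, mul_comm]
    refine mul_le_mul_of_nonneg_right ?_ (abs_nonneg _)
    refine (abs_sub _ _).trans ?_
    rw [abs_mul, abs_mul]
    have j1 := mul_le_mul b1 i2 (abs_nonneg _) hD0.le
    have j2 := mul_le_mul b2 i1 (abs_nonneg _) hD0.le
    linarith [j1, j2, show 2 * (L * D ^ 3) = D * (L * D ^ 2) + D * (L * D ^ 2) by ring]
  have hC : 0 ≤ 2 * (L * D ^ 3) := by positivity
  refine ⟨D + 2 * (L * D ^ 3), by positivity, fun E x hE hx => ?_⟩
  obtain ⟨b1, b2⟩ := hbd E x hE hx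
  have d1 := hdiff E x hE hx _ _ (F.sol₁ E) (fun y hy => (hbd E y hE hy).1)
  have d2 := hdiff E x hE hx _ _ (F.sol₂ E) (fun y hy => (hbd E y hE hy).2)
  simp only [F.ψ₁_zero, F.v₁_zero, F.ψ₂_zero, F.v₂_zero, one_mul, zero_mul, add_zero,
    zero_add] at d1 d2
  have := abs_nonneg (E - E₀)
  exact ⟨by linarith, by linarith, d1.trans (by nlinarith), d2.trans (by nlinarith)⟩

omit hM hS in
theorem abs_integral_sub_le (hε : Tame ε) {f g g' : ℝ → ℝ} (hf : Continuous f) (hg : Continuous g)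
    (hg' : Continuous g') {C D L : ℝ} (hC : ∀ x ∈ Set.Icc (0 : ℝ) 1, |f x| ≤ C)
    (hD : ∀ x ∈ Set.Icc (0 : ℝ) 1, |g x - g' x| ≤ D) (hL : ∀ x, |ε x| ≤ L) :
    |(∫ x in (0 : ℝ)..1, ε x • (f x * g x)) - ∫ x in (0 : ℝ)..1, ε x • (f x * g' x)| ≤
      L * C * D := by
  rw [← intervalIntegral.integral_sub (hε.intervalIntegrable_smul (g := fun x => f x * g x) (hf.mul hg) 0 1)
    (hε.intervalIntegrable_smul (g := fun x => f x * g' x) (hf.mul hg') 0 1)]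
  have := intervalIntegral.norm_integral_le_of_norm_le_const (a := (0 : ℝ)) (b := 1)
    (f := fun x => ε x • (f x * g x) - ε x • (f x * g' x)) (C := L * C * D) (fun x hx => by
      rw [Set.uIoc_of_le zero_le_one] at hx
      have hx' : x ∈ Set.Icc (0 : ℝ) 1 := ⟨hx.1.le, hx.2⟩
      rw [← smul_sub, ← mul_sub, smul_eq_mul, norm_mul, norm_mul, mul_assoc]
      have h1 := hC x hx'
      have h2 := hL x
      exact mul_le_mul h2 (mul_le_mul h1 (hD x hx') (norm_nonneg _)
        ((abs_nonneg _).trans h1)) (by positivity) ((abs_nonneg _).trans h2))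
  simpa using this

/-- Second order expansion of the monodromy matrix in the energy. -/
theorem exists_expansion (E₀ : ℝ) : ∃ C : ℝ, ∀ E, |E - E₀| ≤ 1 →
    |F.b E - F.b E₀ - (E - E₀) * (F.a E₀ * F.B E₀ - F.b E₀ * F.G E₀)| ≤ C * (E - E₀) ^ 2 ∧
    |F.c E - F.c E₀ - (E - E₀) * (F.c E₀ * F.G E₀ - F.a E₀ * F.A E₀)| ≤ C * (E - E₀) ^ 2 ∧
    |F.a E - F.a E₀ - (E - E₀) * (F.c E₀ * F.B E₀ - F.a E₀ * F.G E₀)| ≤ C * (E - E₀) ^ 2 ∧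
    |F.a E - F.a E₀ - (E - E₀) * (F.a E₀ * F.G E₀ - F.b E₀ * F.A E₀)| ≤ C * (E - E₀) ^ 2 := by
  have hε := hM.tame_eps
  have hμ := hM.tame_mu
  obtain ⟨C, hC0, hC⟩ := F.exists_lipschitz hε hμ E₀
  obtain ⟨L, hL⟩ := hε.bounded
  have hL0 : 0 ≤ L := (abs_nonneg _).trans (hL 0)
  have h0 : |E₀ - E₀| ≤ 1 := by simp
  have c1 := fun E => (F.sol₁ E).cont
  have c2 := fun E => (F.sol₂ E).cont
  set M := |F.a E₀| + |F.b E₀| + |F.c E₀| with hMdef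
  have ma : |F.a E₀| ≤ M := by rw [hMdef]; linarith [abs_nonneg (F.b E₀), abs_nonneg (F.c E₀)]
  have mb : |F.b E₀| ≤ M := by rw [hMdef]; linarith [abs_nonneg (F.a E₀), abs_nonneg (F.c E₀)]
  have mc : |F.c E₀| ≤ M := by rw [hMdef]; linarith [abs_nonneg (F.b E₀), abs_nonneg (F.a E₀)]
  refine ⟨2 * M * (L * C * C), fun E hE => ?_⟩
  have comb : ∀ p q i j : ℝ, |p| ≤ M → |q| ≤ M → |i| ≤ L * C * (C * |E - E₀|) →
      |j| ≤ L * C * (C * |E - E₀|) →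
      |(E - E₀) * (p * i - q * j)| ≤ 2 * M * (L * C * C) * (E - E₀) ^ 2 := by
    intro p q i j hp hq hi hj
    rw [abs_mul, ← sq_abs (E - E₀)]
    have := mul_le_mul hp hi (abs_nonneg _) ((abs_nonneg _).trans hp)
    have := mul_le_mul hq hj (abs_nonneg _) ((abs_nonneg _).trans hq)
    have h3 : |p * i - q * j| ≤ 2 * M * (L * C * C) * |E - E₀| := by
      refine (abs_sub _ _).trans ?_
      rw [abs_mul, abs_mul]; linarith
    nlinarith [mul_le_mul_of_nonneg_left h3 (abs_nonneg (E - E₀))]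
  -- The four Green identities between energies `E₀` and `E` over one period, solved with `det`,
  -- express the increments of `a`, `b`, `c` exactly through integrals of products of solutions at
  -- the two energies. Replacing `E` by `E₀` in those integrals costs another factor `|E - E₀|`.
  have w11 := (F.sol₁ E₀).green hε hμ (F.sol₁ E) 0 1
  have w12 := (F.sol₁ E₀).green hε hμ (F.sol₂ E) 0 1
  have w21 := (F.sol₂ E₀).green hε hμ (F.sol₁ E) 0 1
  have w22 := (F.sol₂ E₀).green hε hμ (F.sol₂ E) 0 1
  simp only [F.ψ₁_zero, F.v₁_zero, F.ψ₂_zero, F.v₂_zero, F.v₂_one hM hS, smul_eq_mul]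
    at w11 w12 w21 w22
  have hd := F.det hM hS E₀
  have b1 := fun x (hx : x ∈ Set.Icc (0 : ℝ) 1) => (hC E₀ x h0 hx).1
  have b2 := fun x (hx : x ∈ Set.Icc (0 : ℝ) 1) => (hC E₀ x h0 hx).2.1
  have l1 := fun x (hx : x ∈ Set.Icc (0 : ℝ) 1) => (hC E x hE hx).2.2.1
  have l2 := fun x (hx : x ∈ Set.Icc (0 : ℝ) 1) => (hC E x hE hx).2.2.2
  have d11 := abs_integral_sub_le hε (c1 E₀) (c1 E) (c1 E₀) b1 l1 hL
  have d12 := abs_integral_sub_le hε (c1 E₀) (c2 E) (c2 E₀) b1 l2 hL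
  have d21 := abs_integral_sub_le hε (c2 E₀) (c1 E) (c1 E₀) b2 l1 hL
  have d22 := abs_integral_sub_le hε (c2 E₀) (c2 E) (c2 E₀) b2 l2 hL
  have hG : ∫ x in (0 : ℝ)..1, ε x • (F.ψ₂ E₀ x * F.ψ₁ E₀ x) = F.G E₀ := by
    unfold G; simp only [mul_comm]
  rw [hG] at d21
  simp only [smul_eq_mul] at d11 d12 d21 d22
  set i11 := ∫ x in (0 : ℝ)..1, ε x * (F.ψ₁ E₀ x * F.ψ₁ E x)
  set i12 := ∫ x in (0 : ℝ)..1, ε x * (F.ψ₁ E₀ x * F.ψ₂ E x)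
  set i21 := ∫ x in (0 : ℝ)..1, ε x * (F.ψ₂ E₀ x * F.ψ₁ E x)
  set i22 := ∫ x in (0 : ℝ)..1, ε x * (F.ψ₂ E₀ x * F.ψ₂ E x)
  change |i11 - F.A E₀| ≤ _ at d11
  change |i12 - F.G E₀| ≤ _ at d12
  change |i22 - F.B E₀| ≤ _ at d22
  change F.a E₀ * F.c E - F.c E₀ * F.a E - _ = _ at w11
  change F.a E₀ * F.a E - F.c E₀ * F.b E - _ = _ at w12
  change F.b E₀ * F.c E - F.a E₀ * F.a E - _ = _ at w21
  change F.b E₀ * F.a E - F.a E₀ * F.b E - _ = _ at w22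
  refine ⟨?_, ?_, ?_, ?_⟩
  · refine le_of_eq_of_le (congrArg abs ?_) (comb _ _ _ _ ma mb d22 d12)
    linear_combination (-F.b E) * hd - F.a E₀ * w22 + F.b E₀ * w12
  · refine le_of_eq_of_le (congrArg abs ?_) (comb _ _ _ _ mc ma d21 d11)
    linear_combination (-F.c E) * hd + F.a E₀ * w11 - F.c E₀ * w21
  · refine le_of_eq_of_le (congrArg abs ?_) (comb _ _ _ _ mc ma d22 d12)
    linear_combination (-F.a E) * hd + F.a E₀ * w12 - F.c E₀ * w22
  · refine le_of_eq_of_le (congrArg abs ?_) (comb _ _ _ _ ma mb d21 d11)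
    linear_combination (-F.a E) * hd - F.a E₀ * w21 + F.b E₀ * w11

/-- The entry `a` occurs twice on the diagonal, so Green's identities produce its derivative in two
forms, `c B - a G` and `a G - b A`, which must agree. -/
theorem two_mul_a_mul_G (E : ℝ) : 2 * F.a E * F.G E = F.b E * F.A E + F.c E * F.B E := by
  obtain ⟨C, hC⟩ := F.exists_expansion hM hS E
  have h1 := hasDerivAt_of_quadratic fun y hy => (hC y hy).2.2.1
  have h2 := hasDerivAt_of_quadratic fun y hy => (hC y hy).2.2.2
  linarith [h1.unique h2]

theorem hasDerivAt_a (E : ℝ) :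
    HasDerivAt F.a ((F.c E * F.B E - F.b E * F.A E) / 2) E := by
  obtain ⟨C, hC⟩ := F.exists_expansion hM hS E
  refine (hasDerivAt_of_quadratic fun y hy => (hC y hy).2.2.1).congr_deriv ?_
  linarith [F.two_mul_a_mul_G hM hS E]

theorem hasDerivAt_b (E : ℝ) : HasDerivAt F.b (F.a E * F.B E - F.b E * F.G E) E := by
  obtain ⟨C, hC⟩ := F.exists_expansion hM hS E
  exact hasDerivAt_of_quadratic fun y hy => (hC y hy).1

theorem hasDerivAt_c (E : ℝ) : HasDerivAt F.c (F.c E * F.G E - F.a E * F.A E) E := by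
  obtain ⟨C, hC⟩ := F.exists_expansion hM hS E
  exact hasDerivAt_of_quadratic fun y hy => (hC y hy).2.1

omit hS in
-- At energy `0` the constants are solutions and `ψ₂ = ∫ μ`. Thus the lowest band starts at `0`,
-- with an even mode.
theorem at_zero : F.a 0 = 1 ∧ F.c 0 = 0 ∧ 0 < F.b 0 := by
  have hconst : Sol ε μ 0 (fun _ => (1 : ℝ)) (fun _ => 0) :=
    ⟨continuous_const, continuous_const, fun x _ => (hasDerivAt_const x _).congr_deriv (by simp),
      fun x _ => (hasDerivAt_const x _).congr_deriv (by simp)⟩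
  have h1 := F.repr hM.tame_eps hM.tame_mu hconst 1
  simp only [one_mul, zero_mul, add_zero, RCLike.ofReal_real_eq_id, id] at h1
  have h2 : ∀ x, F.v₂ 0 x = 1 := fun x => by
    have := eq_add_integral hM.tame_eps (g := fun _ => (0 : ℝ)) continuous_const
      (F.sol₂ 0).cont_flux (fun x hx => ((F.sol₂ 0).deriv_flux x hx).congr_deriv (by simp)) 0 x
    rw [F.v₂_zero] at this
    simp only [smul_zero, intervalIntegral.integral_zero] at this
    linarith
  have h3 := eq_add_integral hM.tame_mu (F.sol₂ 0).cont_flux (F.sol₂ 0).cont (F.sol₂ 0).deriv 0 1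
  rw [F.ψ₂_zero, sub_zero] at h3
  refine ⟨h1.1.symm, h1.2.symm, ?_⟩
  rw [b, ← h3]
  refine intervalIntegral.intervalIntegral_pos_of_pos_on
    (hM.tame_mu.intervalIntegrable_smul (F.sol₂ 0).cont_flux 0 _) (fun x hx => ?_) one_pos
  rw [h2, smul_eq_mul, mul_one]
  exact hM.mu_pos x

end FundamentalSystem

end

/-! ### Bands and gaps of half the discriminant -/

/-- The properties, as functions of the energy, of the monodromy matrix `!![a, b; c, a]` of an
inversion symmetric medium on which the band structure depends. -/
structure HillSystem (a b c A B G : ℝ → ℝ) : Prop where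
  det : ∀ E, a E ^ 2 - b E * c E = 1
  deriv_a : ∀ E, HasDerivAt a ((c E * B E - b E * A E) / 2) E
  deriv_b : ∀ E, HasDerivAt b (a E * B E - b E * G E) E
  deriv_c : ∀ E, HasDerivAt c (c E * G E - a E * A E) E
  A_pos : ∀ E, 0 < A E
  B_pos : ∀ E, 0 < B E

theorem FundamentalSystem.hillSystem {ε μ : ℝ → ℝ} (F : FundamentalSystem ε μ)
    (hM : IsPeriodicMedium ε μ) (hS : IsInversionSymmetric ε μ) :
    HillSystem F.a F.b F.c F.A F.B F.G :=
  ⟨F.det hM hS, F.hasDerivAt_a hM hS, F.hasDerivAt_b hM hS, F.hasDerivAt_c hM hS, F.A_pos hM,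
    F.B_pos hM⟩

theorem neg_one_pow_mul_self_eq (n : ℕ) : ((-1 : ℝ) ^ n) * (-1) ^ n = 1 := by
  rw [← mul_pow]; simp

theorem mul_pos_of_ne_zero_of_Ioo {f : ℝ → ℝ} (hf : Continuous f) {p q : ℝ}
    (h : ∀ x ∈ Set.Ioo p q, f x ≠ 0) {x y : ℝ} (hx : x ∈ Set.Ioo p q) (hy : y ∈ Set.Ioo p q) :
    0 < f x * f y := by
  by_contra hn
  have h0 : f x * f y < 0 := lt_of_le_of_ne (not_lt.1 hn) (mul_ne_zero (h x hx) (h y hy))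
  have hsub : Set.uIcc x y ⊆ Set.Ioo p q := Set.ordConnected_Ioo.uIcc_subset hx hy
  have hz : (0 : ℝ) ∈ Set.uIcc (f x) (f y) := by
    rw [Set.mem_uIcc]
    rcases mul_neg_iff.1 h0 with ⟨h1, h2⟩ | ⟨h1, h2⟩
    · exact Or.inr ⟨h2.le, h1.le⟩
    · exact Or.inl ⟨h1.le, h2.le⟩
  obtain ⟨z, hz, hz0⟩ := intermediate_value_uIcc hf.continuousOn hz
  exact h z (hsub hz) hz0

theorem nonneg_of_pos_Ioo {f : ℝ → ℝ} (hf : Continuous f) {p q : ℝ} (hpq : p < q)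
    (h : ∀ x ∈ Set.Ioo p q, 0 < f x) : ∀ x ∈ Set.Icc p q, 0 ≤ f x := by
  rw [← closure_Ioo hpq.ne]
  exact fun x hx => closure_minimal (s := Set.Ioo p q) (fun x hx => (h x hx).le)
    (isClosed_le continuous_const hf) hx

/-- The edges `p n`, `q n` of the first `N` bands (numbered from `0`), in terms of half the
discriminant `a`. -/
structure BandEdges (a : ℝ → ℝ) (N : ℕ) (p q : ℕ → ℝ) : Prop where
  zero : p 0 = 0
  a_p : ∀ n < N, a (p n) = (-1) ^ n
  a_q : ∀ n < N, a (q n) = (-1) ^ (n + 1)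
  lt : ∀ n < N, p n < q n
  band : ∀ n < N, ∀ x ∈ Set.Ioo (p n) (q n), |a x| < 1
  le : ∀ n, n + 1 < N → q n ≤ p (n + 1)
  gap : ∀ n, n + 1 < N → ∀ x ∈ Set.Ioo (q n) (p (n + 1)), 1 < (-1) ^ (n + 1) * a x

namespace HillSystem

variable {a b c A B G : ℝ → ℝ} (H : HillSystem a b c A B G)

include H

theorem continuous_a : Continuous a :=
  continuous_iff_continuousAt.2 fun E => (H.deriv_a E).continuousAt

theorem continuous_b : Continuous b :=
  continuous_iff_continuousAt.2 fun E => (H.deriv_b E).continuousAt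

theorem continuous_c : Continuous c :=
  continuous_iff_continuousAt.2 fun E => (H.deriv_c E).continuousAt

theorem mul_neg {E : ℝ} (h : |a E| < 1) : b E * c E < 0 := by
  have := H.det E
  have := (sq_lt_one_iff_abs_lt_one (a E)).2 h
  linarith

/-- A critical point of `a` has `c B = b A`, while `|a| ≤ 1` forces `b c ≤ 0`. Multiplying by `b` or
by `c` makes a nonnegative quantity nonpositive. -/
theorem eq_zero_of_deriv {E : ℝ} (h : |a E| ≤ 1) (h0 : (c E * B E - b E * A E) / 2 = 0) :
    b E = 0 ∧ c E = 0 := by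
  have h1 := H.det E
  have h2 := (sq_le_one_iff_abs_le_one (a E)).2 h
  have hbc : b E * c E ≤ 0 := by linarith
  have hA := H.A_pos E
  have hB := H.B_pos E
  have h3 : c E * B E = b E * A E := by linarith
  have hb : b E ^ 2 ≤ 0 := by
    have : b E ^ 2 * A E = b E * c E * B E := by linear_combination (-b E) * h3
    nlinarith
  have hc : c E ^ 2 ≤ 0 := by
    have : c E ^ 2 * B E = b E * c E * A E := by linear_combination (c E) * h3
    nlinarith
  exact ⟨pow_eq_zero_iff two_ne_zero |>.1 (le_antisymm hb (sq_nonneg _)),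
    pow_eq_zero_iff two_ne_zero |>.1 (le_antisymm hc (sq_nonneg _))⟩

/-- Here `a² = 1`, so to first order `b` and `c` are `a B` and `-a A` times the energy increment
`h`. Their product is about `-A B h² < 0`, and `a² = 1 + b c`. -/
theorem eventually_abs_lt {E : ℝ} (hb : b E = 0) (hc : c E = 0) :
    ∀ᶠ x in 𝓝[≠] E, |a x| < 1 := by
  have h1 := hasDerivAt_iff_tendsto_slope.1 (H.deriv_b E)
  have h2 := hasDerivAt_iff_tendsto_slope.1 (H.deriv_c E)
  have hdet := H.det E
  simp only [hb, hc] at h1 h2 hdet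
  have hl : (a E * B E - 0 * G E) * (0 * G E - a E * A E) < 0 := by
    have := mul_pos (H.A_pos E) (H.B_pos E)
    nlinarith
  filter_upwards [(h1.mul h2).eventually_lt_const hl, self_mem_nhdsWithin] with x hx hne
  have hne' : x - E ≠ 0 := sub_ne_zero.2 hne
  rw [slope_def_field, slope_def_field, hb, hc, sub_zero, sub_zero, div_mul_div_comm,
    div_neg_iff] at hx
  have hpos : 0 < (x - E) * (x - E) := mul_self_pos.2 hne'
  have hd := H.det x
  refine (sq_lt_one_iff_abs_lt_one (a x)).1 ?_
  rcases hx with ⟨-, h⟩ | ⟨h, -⟩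
  · linarith
  · linarith

/-- Such a minimum would be a critical point, hence a double eigenvalue with `σ a = 1`; but `|a| <
1` on both sides of it. This rules out extra turning points of `a` and gives the alternation of
bands and gaps. -/
theorem not_isLocalMin {σ y : ℝ} (hσ : σ * σ = 1) (h : |a y| ≤ 1) (h' : -1 < σ * a y) :
    ¬ IsLocalMin (fun x => σ * a x) y := by
  intro hmin
  have hd := hmin.hasDerivAt_eq_zero ((H.deriv_a y).const_mul σ)
  have hσ0 : σ ≠ 0 := by rintro rfl; simp at hσ
  obtain ⟨hb, hc⟩ := H.eq_zero_of_deriv h ((mul_eq_zero.1 hd).resolve_left hσ0)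
  have hdet := H.det y
  rw [hb, hc] at hdet
  have h1 : σ * a y = 1 := by
    have : (σ * a y - 1) * (σ * a y + 1) = 0 := by linear_combination a y ^ 2 * hσ + hdet
    rcases mul_eq_zero.1 this with h | h <;> linarith
  obtain ⟨x, hx, hx'⟩ := ((H.eventually_abs_lt hb hc).and
    (hmin.filter_mono nhdsWithin_le_nhds)).exists
  have h2 : |σ * a x| < 1 := by
    refine (sq_lt_one_iff_abs_lt_one _).1 ?_
    have := (sq_lt_one_iff_abs_lt_one _).2 hx
    calc (σ * a x) ^ 2 = (σ * σ) * a x ^ 2 := by ring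
      _ < 1 := by rw [hσ]; linarith
  have := (abs_lt.1 h2).2
  have hx'' : σ * a y ≤ σ * a x := hx'
  linarith

/-- Past a point where `a = σ = ±1`, and before one where `a = -σ`, there is a first gap (possibly
empty) followed by a band. -/
theorem exists_next_band {σ e E' : ℝ} (hσ : σ * σ = 1) (he : e < E') (hae : a e = σ)
    (haE : a E' = -σ) : ∃ p q, e ≤ p ∧ p < q ∧ q ≤ E' ∧ a p = σ ∧ a q = -σ ∧
      (∀ x ∈ Set.Ioo p q, |a x| < 1) ∧ ∀ x ∈ Set.Ioo e p, 1 < σ * a x := by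
  have hc : Continuous fun x => σ * a x := H.continuous_a.const_mul σ
  have back : ∀ {x s}, σ * a x = s → a x = σ * s := fun {x s} h => by
    rw [← h, ← mul_assoc, hσ, one_mul]
  -- `q` is the first point at which `σ a` has come down to `-1`.
  obtain ⟨q, ⟨⟨heq, hqE⟩, hq⟩, hqmin⟩ := (isCompact_Icc.inter_right
    (isClosed_le hc (continuous_const (y := (-1 : ℝ))))).exists_isLeast
    (s := Set.Icc e E' ∩ {x | σ * a x ≤ -1})
    ⟨E', ⟨he.le, le_rfl⟩, by simp [haE, hσ]⟩
  have hlt : ∀ x, e ≤ x → x < q → -1 < σ * a x := fun x hx hxq => by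
    by_contra hn
    exact absurd (hqmin ⟨⟨hx, hxq.le.trans hqE⟩, not_lt.1 hn⟩) (not_le.2 hxq)
  have heq' : e < q := lt_of_le_of_ne heq fun h => by
    rw [← h] at hq
    simp only [Set.mem_ofPred_eq, hae, hσ] at hq
    linarith
  have hq1 : σ * a q = -1 := by
    refine le_antisymm hq ?_
    refine nonneg_of_pos_Ioo (f := fun x => σ * a x + 1) (hc.add continuous_const) heq'
      (fun x hx => by linarith [hlt x hx.1.le hx.2]) q ⟨heq, le_rfl⟩ |> fun h => by linarith
  -- `p` is the last point before `q` at which `σ a` is still at least `1`.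
  obtain ⟨p, ⟨⟨hep, hpq⟩, hp⟩, hpmax⟩ := (isCompact_Icc.inter_right
    (isClosed_le (continuous_const (y := (1 : ℝ))) hc)).exists_isGreatest
    (s := Set.Icc e q ∩ {x | 1 ≤ σ * a x}) ⟨e, ⟨le_rfl, heq⟩, by simp [hae, hσ]⟩
  have hgt : ∀ x, p < x → x ≤ q → σ * a x < 1 := fun x hx hxq => by
    by_contra hn
    exact absurd (hpmax ⟨⟨hep.trans hx.le, hxq⟩, not_lt.1 hn⟩) (not_le.2 hx)
  have hpq' : p < q := lt_of_le_of_ne hpq fun h => by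
    rw [h] at hp
    simp only [Set.mem_ofPred_eq, hq1] at hp
    linarith
  have hp1 : σ * a p = 1 := by
    refine le_antisymm ?_ hp
    refine nonneg_of_pos_Ioo (f := fun x => 1 - σ * a x) (continuous_const.sub hc) hpq'
      (fun x hx => by linarith [hgt x hx.1 hx.2.le]) p ⟨le_rfl, hpq⟩ |> fun h => by linarith
  have habs : ∀ x, -1 ≤ σ * a x → σ * a x ≤ 1 → |a x| ≤ 1 := fun x h1 h2 => by
    refine (sq_le_one_iff_abs_le_one _).1 ?_
    have : a x ^ 2 = (σ * a x) ^ 2 := by linear_combination (-a x ^ 2) * hσ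
    rw [this]; exact (sq_le_one_iff_abs_le_one _).2 (abs_le.2 ⟨h1, h2⟩)
  have noMin : ∀ y ∈ Set.Ioo e p, σ * a y ≤ 1 → ¬ IsLocalMin (fun x => σ * a x) y := by
    intro y hy h1
    have := hlt y hy.1.le (hy.2.trans hpq')
    exact H.not_isLocalMin hσ (habs y this.le h1) this
  refine ⟨p, q, hep, hpq', hqE, by simpa using back hp1, by simpa using back hq1,
    fun x hx => ?_, fun x hx => ?_⟩
  · have h1 := hlt x (hep.trans hx.1.le) hx.2
    have h2 := hgt x hx.1 hx.2.le
    refine (sq_lt_one_iff_abs_lt_one _).1 ?_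
    have : a x ^ 2 = (σ * a x) ^ 2 := by linear_combination (-a x ^ 2) * hσ
    rw [this]; exact (sq_lt_one_iff_abs_lt_one _).2 (abs_lt.2 ⟨h1, h2⟩)
  · by_contra hn
    rw [not_lt] at hn
    obtain ⟨y, hy, hymin⟩ := isCompact_Icc.exists_isMinOn (s := Set.Icc e p)
      ⟨x, hx.1.le, hx.2.le⟩ hc.continuousOn
    have hyx : σ * a y ≤ σ * a x := hymin ⟨hx.1.le, hx.2.le⟩
    by_cases hin : y ∈ Set.Ioo e p
    · exact noMin y hin (hyx.trans hn) (hymin.isLocalMin (Icc_mem_nhds hin.1 hin.2))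
    -- If the minimum is attained at an end of `[e, p]`, its value is `1`, and then `x` is an
    -- interior minimizer too.
    · have hy1 : σ * a y = 1 := by
        rcases eq_or_lt_of_le hy.1 with h | h
        · rw [← h, hae, hσ]
        · rcases eq_or_lt_of_le hy.2 with h' | h'
          · rw [h', hp1]
          · exact absurd ⟨h, h'⟩ hin
      refine noMin x hx hn (IsMinOn.isLocalMin (s := Set.Icc e p) (fun z hz => ?_)
        (Icc_mem_nhds hx.1 hx.2))
      have : σ * a y ≤ σ * a z := hymin hz
      show σ * a x ≤ σ * a z
      linarith

variable {N : ℕ} {p q : ℕ → ℝ} (P : BandEdges a N p q)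

include P

/-- In a band `b c < 0`, so `b` never vanishes and keeps its sign. The wrong sign would make `(-1)^n
a` increase, whereas it goes from `1` down to `-1`. -/
theorem band_sign {n : ℕ} (hn : n < N) {x : ℝ} (hx : x ∈ Set.Ioo (p n) (q n)) :
    0 < (-1) ^ n * b x ∧ (-1) ^ n * c x < 0 := by
  set σ : ℝ := (-1) ^ n with hσdef
  have hσ : σ * σ = 1 := neg_one_pow_mul_self_eq n
  have hne : ∀ y ∈ Set.Ioo (p n) (q n), b y ≠ 0 := fun y hy h0 => by
    have := H.mul_neg (P.band n hn y hy)
    rw [h0, zero_mul] at this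
    exact lt_irrefl _ this
  have hbc : ∀ y ∈ Set.Ioo (p n) (q n), (σ * b y) * (σ * c y) < 0 := fun y hy => by
    have := H.mul_neg (P.band n hn y hy)
    calc (σ * b y) * (σ * c y) = (σ * σ) * (b y * c y) := by ring
      _ < 0 := by rw [hσ, one_mul]; exact this
  have hb : 0 < σ * b x := by
    by_contra hneg
    have hσ0 : σ ≠ 0 := by rintro h; rw [h] at hσ; simp at hσ
    have hlt : σ * b x < 0 := lt_of_le_of_ne (not_lt.1 hneg) (mul_ne_zero hσ0 (hne x hx))
    have hmono : StrictMonoOn (fun y => σ * a y) (Set.Icc (p n) (q n)) := by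
      refine strictMonoOn_of_deriv_pos (convex_Icc _ _) (H.continuous_a.const_mul σ).continuousOn
        fun y hy => ?_
      rw [interior_Icc] at hy
      rw [((H.deriv_a y).const_mul σ).deriv]
      have h1 := mul_pos_of_ne_zero_of_Ioo H.continuous_b hne hx hy
      have h2 : 0 < (σ * b x) * (σ * b y) := by
        calc 0 < (σ * σ) * (b x * b y) := by rw [hσ, one_mul]; exact h1
          _ = _ := by ring
      have h3 : σ * b y < 0 := neg_of_mul_pos_right h2 hlt.le
      have h4 : 0 < σ * c y := pos_of_mul_neg_right (hbc y hy) h3.le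
      have := mul_pos h4 (H.B_pos y)
      have := mul_pos_of_neg_of_neg h3 (neg_lt_zero.2 (H.A_pos y))
      linarith
    have := hmono ⟨le_rfl, (P.lt n hn).le⟩ ⟨(P.lt n hn).le, le_rfl⟩ (P.lt n hn)
    simp only [P.a_p n hn, P.a_q n hn, pow_succ, ← hσdef] at this
    linarith
  exact ⟨hb, neg_of_mul_neg_right (hbc x hx) hb.le⟩

theorem strictAntiOn {n : ℕ} (hn : n < N) :
    StrictAntiOn (fun y => (-1) ^ n * a y) (Set.Icc (p n) (q n)) := by
  refine strictAntiOn_of_deriv_neg (convex_Icc _ _) (H.continuous_a.const_mul _).continuousOn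
    fun y hy => ?_
  rw [interior_Icc] at hy
  rw [((H.deriv_a y).const_mul _).deriv]
  obtain ⟨h3, h4⟩ := H.band_sign P hn hy
  have := mul_pos h3 (H.A_pos y)
  have := mul_neg_of_neg_of_pos h4 (H.B_pos y)
  linarith

theorem injOn {n : ℕ} (hn : n < N) : Set.InjOn a (Set.Icc (p n) (q n)) := fun _ hx _ hy h =>
  (H.strictAntiOn P hn).injOn hx hy (congrArg ((-1) ^ n * ·) h)

theorem band_sign_closed {n : ℕ} (hn : n < N) {x : ℝ} (hx : x ∈ Set.Icc (p n) (q n)) :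
    0 ≤ (-1) ^ n * b x ∧ (-1) ^ n * c x ≤ 0 :=
  ⟨nonneg_of_pos_Ioo (H.continuous_b.const_mul _) (P.lt n hn)
      (fun _ hy => (H.band_sign P hn hy).1) x hx,
    neg_nonneg.1 (nonneg_of_pos_Ioo (f := fun x => -((-1) ^ n * c x))
      (H.continuous_c.const_mul _).neg (P.lt n hn)
      (fun _ hy => neg_pos.2 (H.band_sign P hn hy).2) x hx)⟩

/-- Consecutive bands touch exactly at the double eigenvalues. -/
theorem closed_iff {n : ℕ} (hn : n + 1 < N) : q n = p (n + 1) ↔ b (q n) = 0 ∧ c (q n) = 0 := by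
  have hn' : n < N := (Nat.lt_succ_self n).trans hn
  constructor
  · intro h
    obtain ⟨h1, h2⟩ := H.band_sign_closed P hn' ⟨(P.lt n hn').le, le_rfl⟩
    obtain ⟨h3, h4⟩ := H.band_sign_closed P hn ⟨le_rfl, (P.lt _ hn).le⟩
    rw [← h, pow_succ] at h3 h4
    -- The sign conditions from the two touching bands are opposite, which forces both entries to
    -- vanish.
    have e1 : (-1) ^ n * b (q n) = 0 := by linarith
    have e2 : (-1) ^ n * c (q n) = 0 := by linarith
    have h0 : ((-1 : ℝ)) ^ n ≠ 0 := by simp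
    exact ⟨(mul_eq_zero.1 e1).resolve_left h0, (mul_eq_zero.1 e2).resolve_left h0⟩
  · rintro ⟨hb, hc⟩
    by_contra hne
    have hlt : q n < p (n + 1) := lt_of_le_of_ne (P.le n hn) hne
    have h1 : ∀ᶠ x in 𝓝[>] (q n), |a x| < 1 :=
      (H.eventually_abs_lt hb hc).filter_mono (nhdsWithin_mono _ fun x hx => ne_of_gt hx)
    obtain ⟨x, hx, hx'⟩ := (h1.and (Ioo_mem_nhdsGT hlt)).exists
    have h2 := P.gap n hn x hx'
    have h3 : |(-1) ^ (n + 1) * a x| < 1 := by rwa [abs_mul, abs_pow, abs_neg, abs_one, one_pow,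
      one_mul]
    linarith [(abs_lt.1 h3).2]

/-- This is the parity switch across an open gap. Inside it `b c = a² - 1 > 0`, so `b` and `c` share
one constant sign. By continuity from the adjacent bands, `b` and `c` have weakly opposite signs at
each edge, and in opposite order at the two edges. Hence one of them vanishes at the lower edge and
the other at the upper edge. -/
theorem gap_sign {n : ℕ} (hn : n + 1 < N) (hlt : q n < p (n + 1)) :
    (c (q n) = 0 ∧ b (q n) ≠ 0 ∧ b (p (n + 1)) = 0 ∧ c (p (n + 1)) ≠ 0 ∧
      ∀ x ∈ Set.Ioo (q n) (p (n + 1)), (-1) ^ (n + 1) * b x < 0 ∧ (-1) ^ (n + 1) * c x < 0) ∨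
    (b (q n) = 0 ∧ c (q n) ≠ 0 ∧ c (p (n + 1)) = 0 ∧ b (p (n + 1)) ≠ 0 ∧
      ∀ x ∈ Set.Ioo (q n) (p (n + 1)), 0 < (-1) ^ (n + 1) * b x ∧ 0 < (-1) ^ (n + 1) * c x) := by
  have hn' : n < N := (Nat.lt_succ_self n).trans hn
  obtain ⟨h1, h2⟩ := H.band_sign_closed P hn' ⟨(P.lt n hn').le, le_rfl⟩
  obtain ⟨h3, h4⟩ := H.band_sign_closed P hn ⟨le_rfl, (P.lt _ hn).le⟩
  set σ : ℝ := (-1) ^ (n + 1) with hσdef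
  have hσ : σ * σ = 1 := neg_one_pow_mul_self_eq (n + 1)
  have hσn : (-1 : ℝ) ^ n = -σ := by rw [hσdef, pow_succ]; ring
  rw [hσn] at h1 h2
  have hσ0 : σ ≠ 0 := by rintro h; rw [h] at hσ; simp at hσ
  have hbc : ∀ x ∈ Set.Ioo (q n) (p (n + 1)), 0 < (σ * b x) * (σ * c x) := fun x hx => by
    have hg := P.gap n hn x hx
    have hd := H.det x
    have e : (σ * b x) * (σ * c x) = (σ * a x) ^ 2 - 1 := by
      linear_combination (b x * c x - a x ^ 2) * hσ - hd
    rw [e]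
    nlinarith
  have hb0 : ∀ x ∈ Set.Ioo (q n) (p (n + 1)), b x ≠ 0 := fun x hx h0 => by
    have := hbc x hx
    simp [h0] at this
  have dq := H.det (q n)
  have dp := H.det (p (n + 1))
  rw [P.a_q n hn', ← hσdef] at dq
  rw [P.a_p _ hn, ← hσdef] at dp
  have nq : ¬ (b (q n) = 0 ∧ c (q n) = 0) := fun h => hlt.ne ((H.closed_iff P hn).2 h)
  have np : ¬ (b (p (n + 1)) = 0 ∧ c (p (n + 1)) = 0) := fun h => by
    have h1 : ∀ᶠ x in 𝓝[<] (p (n + 1)), |a x| < 1 :=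
      (H.eventually_abs_lt h.1 h.2).filter_mono (nhdsWithin_mono _ fun x hx => ne_of_lt hx)
    obtain ⟨x, hx, hx'⟩ := (h1.and (Ioo_mem_nhdsLT hlt)).exists
    have h2 := P.gap n hn x hx'
    have h3 : |(-1) ^ (n + 1) * a x| < 1 := by rwa [abs_mul, abs_pow, abs_neg, abs_one, one_pow,
      one_mul]
    linarith [(abs_lt.1 h3).2]
  have zq : b (q n) = 0 ∨ c (q n) = 0 := mul_eq_zero.1 (by nlinarith)
  have zp : b (p (n + 1)) = 0 ∨ c (p (n + 1)) = 0 := mul_eq_zero.1 (by nlinarith)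
  obtain ⟨y, hy⟩ := Set.nonempty_Ioo.2 hlt
  have hsame : ∀ x ∈ Set.Ioo (q n) (p (n + 1)), 0 < (σ * b y) * (σ * b x) := fun x hx => by
    have := mul_pos_of_ne_zero_of_Ioo H.continuous_b hb0 hy hx
    calc 0 < (σ * σ) * (b y * b x) := by rw [hσ, one_mul]; exact this
      _ = _ := by ring
  rcases lt_or_gt_of_ne (mul_ne_zero hσ0 (hb0 y hy)) with hs | hs
  · left
    have hall : ∀ x ∈ Set.Ioo (q n) (p (n + 1)), σ * b x < 0 ∧ σ * c x < 0 := fun x hx => by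
      have := neg_of_mul_pos_right (hsame x hx) hs.le
      exact ⟨this, neg_of_mul_pos_right (hbc x hx) this.le⟩
    have hcq := nonneg_of_pos_Ioo (f := fun x => -(σ * c x)) (H.continuous_c.const_mul _).neg hlt
      (fun x hx => neg_pos.2 (hall x hx).2) (q n) ⟨le_rfl, hlt.le⟩
    have hbp := nonneg_of_pos_Ioo (f := fun x => -(σ * b x)) (H.continuous_b.const_mul _).neg hlt
      (fun x hx => neg_pos.2 (hall x hx).1) (p (n + 1)) ⟨hlt.le, le_rfl⟩
    have e1 : c (q n) = 0 :=
      (mul_eq_zero.1 (show σ * c (q n) = 0 by linarith)).resolve_left hσ0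
    have e2 : b (p (n + 1)) = 0 :=
      (mul_eq_zero.1 (show σ * b (p (n + 1)) = 0 by linarith)).resolve_left hσ0
    exact ⟨e1, fun h => nq ⟨h, e1⟩, e2, fun h => np ⟨e2, h⟩, hall⟩
  · right
    have hall : ∀ x ∈ Set.Ioo (q n) (p (n + 1)), 0 < σ * b x ∧ 0 < σ * c x := fun x hx => by
      have := pos_of_mul_pos_right (hsame x hx) hs.le
      exact ⟨this, pos_of_mul_pos_right (hbc x hx) this.le⟩
    have hbq := nonneg_of_pos_Ioo (H.continuous_b.const_mul _) hlt
      (fun x hx => (hall x hx).1) (q n) ⟨le_rfl, hlt.le⟩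
    have hcp := nonneg_of_pos_Ioo (H.continuous_c.const_mul _) hlt
      (fun x hx => (hall x hx).2) (p (n + 1)) ⟨hlt.le, le_rfl⟩
    have e1 : b (q n) = 0 :=
      (mul_eq_zero.1 (show σ * b (q n) = 0 by linarith)).resolve_left hσ0
    have e2 : c (p (n + 1)) = 0 :=
      (mul_eq_zero.1 (show σ * c (p (n + 1)) = 0 by linarith)).resolve_left hσ0
    exact ⟨e1, fun h => nq ⟨e1, h⟩, e2, fun h => np ⟨h, e2⟩, hall⟩

omit H

theorem _root_.Photonic.BandEdges.q_le_p {i j : ℕ} (hij : i < j) (hj : j < N) : q i ≤ p j := by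
  induction j, hij using Nat.le_induction with
  | base => exact P.le i hj
  | succ j hij ih =>
    have hj' : j < N := (Nat.lt_succ_self j).trans hj
    exact (ih hj').trans ((P.lt j hj').le.trans (P.le j hj))

theorem _root_.Photonic.BandEdges.p_lt_p {i j : ℕ} (hij : i < j) (hj : j < N) : p i < p j :=
  (P.lt i (hij.trans hj)).trans_le (P.q_le_p hij hj)

theorem _root_.Photonic.BandEdges.exists_band {n : ℕ} (hn : n < N) {E : ℝ} (h0 : 0 ≤ E)
    (hE : E ≤ q n) (ha : |a E| ≤ 1) : ∃ i ≤ n, E ∈ Set.Icc (p i) (q i) := by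
  induction n with
  | zero => exact ⟨0, le_rfl, by rw [P.zero]; exact h0, hE⟩
  | succ n ih =>
    by_cases h1 : p (n + 1) ≤ E
    · exact ⟨n + 1, le_rfl, h1, hE⟩
    · by_cases h2 : E ≤ q n
      · obtain ⟨i, hi, h⟩ := ih (by lia) h2
        exact ⟨i, by lia, h⟩
      · have h3 := P.gap n hn E ⟨not_le.1 h2, not_le.1 h1⟩
        have h4 : |(-1) ^ (n + 1) * a E| ≤ 1 := by rwa [abs_mul, abs_pow, abs_neg, abs_one,
          one_pow, one_mul]
        linarith [(abs_le.1 h4).2]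

end HillSystem

theorem BandEdges.congr {a : ℝ → ℝ} {N : ℕ} {p q p' q' : ℕ → ℝ} (P : BandEdges a N p q)
    (h0 : p' 0 = 0) (hp : ∀ n < N, p' n = p n) (hq : ∀ n < N, q' n = q n) :
    BandEdges a N p' q' where
  zero := h0
  a_p n hn := by rw [hp n hn]; exact P.a_p n hn
  a_q n hn := by rw [hq n hn]; exact P.a_q n hn
  lt n hn := by rw [hp n hn, hq n hn]; exact P.lt n hn
  band n hn := by rw [hp n hn, hq n hn]; exact P.band n hn
  le n hn := by rw [hp _ hn, hq n (by lia)]; exact P.le n hn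
  gap n hn := by rw [hp _ hn, hq n (by lia)]; exact P.gap n hn

theorem BandEdges.succ {a : ℝ → ℝ} {N : ℕ} {p q : ℕ → ℝ} (P : BandEdges a N p q)
    (hp : a (p N) = (-1) ^ N) (hq : a (q N) = (-1) ^ (N + 1)) (hlt : p N < q N)
    (hband : ∀ x ∈ Set.Ioo (p N) (q N), |a x| < 1) (hle : ∀ n, n + 1 = N → q n ≤ p N)
    (hgap : ∀ n, n + 1 = N → ∀ x ∈ Set.Ioo (q n) (p N), 1 < (-1) ^ N * a x) :
    BandEdges a (N + 1) p q := by
  have hs : ∀ n, n < N + 1 → n < N ∨ n = N := fun n hn => by lia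
  refine ⟨P.zero, fun n hn => ?_, fun n hn => ?_, fun n hn => ?_, fun n hn => ?_, fun n hn => ?_,
    fun n hn => ?_⟩
  · rcases hs n hn with h | rfl
    exacts [P.a_p n h, hp]
  · rcases hs n hn with h | rfl
    exacts [P.a_q n h, hq]
  · rcases hs n hn with h | rfl
    exacts [P.lt n h, hlt]
  · rcases hs n hn with h | rfl
    exacts [P.band n h, hband]
  · rcases hs _ hn with h | rfl
    exacts [P.le n h, hle n rfl]
  · rcases hs _ hn with h | rfl
    exacts [P.gap n h, hgap n rfl]

/-- A point beyond the first `N` bands where `a` takes the value at the far edge of the next band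
forces that band to exist. -/
theorem HillSystem.exists_bandEdges_succ {a b c A B G : ℝ → ℝ} (H : HillSystem a b c A B G)
    (ha0 : a 0 = 1) (hc0 : c 0 = 0) (hb0 : 0 < b 0) {N : ℕ} {p q : ℕ → ℝ}
    (P : BandEdges a N p q) {E' : ℝ} (hE0 : 0 ≤ E') (hE : ∀ n < N, q n < E')
    (haE : a E' = (-1) ^ (N + 1)) : ∃ p' q', BandEdges a (N + 1) p' q' := by
  have hσ := neg_one_pow_mul_self_eq N
  rcases Nat.eq_zero_or_pos N with rfl | hN
  · have hpos : 0 < E' := lt_of_le_of_ne hE0 fun h => by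
      rw [← h, ha0] at haE; norm_num at haE
    obtain ⟨p', q', h1, h2, h3, h4, h5, h6, h7⟩ :=
      H.exists_next_band (σ := 1) (by norm_num) hpos ha0 (by rw [haE]; norm_num)
    -- There is no gap above `0`: there `a' = -b A / 2 < 0`, so `a < 1` just to the right of `0`.
    have hp' : p' = 0 := by
      by_contra hne
      have hlt : 0 < p' := lt_of_le_of_ne h1 (Ne.symm hne)
      have hd := H.deriv_a 0
      rw [hc0, zero_mul, zero_sub] at hd
      have hneg : -(b 0 * A 0) / 2 < 0 := by have := mul_pos hb0 (H.A_pos 0); linarith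
      have hev := ((hasDerivAt_iff_tendsto_slope.1 hd).eventually_lt_const hneg).filter_mono
        (nhdsWithin_mono _ (fun x (hx : x ∈ Set.Ioi (0 : ℝ)) => ne_of_gt hx))
      obtain ⟨x, hx, hx'⟩ := (hev.and (Ioo_mem_nhdsGT hlt)).exists
      have h8 := h7 x hx'
      rw [slope_def_field, sub_zero, ha0, div_neg_iff] at hx
      rcases hx with ⟨-, h⟩ | ⟨h, -⟩
      · linarith [hx'.1]
      · linarith
    subst hp'
    have P' : BandEdges a 0 (fun _ => 0) (fun _ => q') :=
      P.congr rfl (fun n hn => absurd hn (Nat.not_lt_zero n))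
        (fun n hn => absurd hn (Nat.not_lt_zero n))
    exact ⟨_, _, P'.succ (by simpa using h4) (by simpa using h5) h2 h6
      (fun n hn => absurd hn (Nat.succ_ne_zero n)) (fun n hn => absurd hn (Nat.succ_ne_zero n))⟩
  · obtain ⟨M, rfl⟩ : ∃ M, N = M + 1 := ⟨N - 1, by lia⟩
    obtain ⟨p', q', h1, h2, h3, h4, h5, h6, h7⟩ :=
      H.exists_next_band hσ (hE M (by lia)) (P.a_q M (by lia)) (by rw [haE, pow_succ]; ring)
    -- Only indices below the number of bands matter, so the new edges can be written into the old
    -- sequences.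
    have P' : BandEdges a (M + 1) (Function.update p (M + 1) p') (Function.update q (M + 1) q') :=
      P.congr (by rw [Function.update_of_ne (by lia)]; exact P.zero)
        (fun n hn => Function.update_of_ne (by lia) _ _)
        (fun n hn => Function.update_of_ne (by lia) _ _)
    have hu : ∀ n, n + 1 = M + 1 → Function.update q (M + 1) q' n = q M := fun n hn => by
      rw [Function.update_of_ne (by lia), Nat.succ.inj hn]
    refine ⟨_, _, P'.succ ?_ ?_ ?_ ?_ (fun n hn => ?_) (fun n hn => ?_)⟩
    · simpa using h4
    · rw [Function.update_self, h5, pow_succ _ (M + 1)]; ring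
    · simpa using h2
    · simpa using h6
    · rw [hu n hn, Function.update_self]; exact h1
    · rw [hu n hn, Function.update_self]; exact h7

/-! ### Bloch modes and the dispersion relation -/

theorem Complex.cos_eq_of_exp_sq {k r : ℝ}
    (h : 1 - 2 * (r : ℂ) * Complex.exp (Complex.I * k) + Complex.exp (Complex.I * k) ^ 2 = 0) :
    r = Real.cos k := by
  have h1 : Complex.exp (Complex.I * k) * Complex.exp (-(Complex.I * k)) = 1 := by
    rw [← Complex.exp_add]; simp
  have h2 : (Complex.cos k : ℂ) = r := by
    rw [Complex.cos, mul_comm (k : ℂ), neg_mul, mul_comm (k : ℂ)]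
    linear_combination (Complex.exp (-(Complex.I * k)) / 2) * h +
      (r - Complex.exp (Complex.I * k) / 2) * h1
  exact_mod_cast h2.symm

theorem exp_I_mul_eq (k : ℝ) :
    Complex.exp (Complex.I * k) = (Real.cos k : ℂ) + Complex.I * (Real.sin k : ℂ) := by
  rw [mul_comm, Complex.exp_mul_I, mul_comm Complex.I]; push_cast; ring

/-- Bloch modes with different labels, as they arise in the variational count of eigenvalues. -/
def eigenvalueSet (ε μ : ℝ → ℝ) (j : ℕ) (k : ℝ) : Set ℝ :=
  {E : ℝ | ∃ f : Fin j → ℝ → ℂ, LinearIndependent ℂ f ∧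
    ∀ i, ∃ E' ≤ E, IsBlochMode ε μ k E' (f i)}

namespace FundamentalSystem

variable {ε μ : ℝ → ℝ} (F : FundamentalSystem ε μ)

/-- The solution with value `X` and flux `Y` at the origin. -/
def comb (E : ℝ) (X Y : ℂ) (x : ℝ) : ℂ := X * F.ψ₁ E x + Y * F.ψ₂ E x

theorem sol_comb (E : ℝ) (X Y : ℂ) :
    Sol ε μ E (F.comb E X Y) fun x => X * F.v₁ E x + Y * F.v₂ E x :=
  ((F.sol₁ E).ofReal.const_mul X).add ((F.sol₂ E).ofReal.const_mul Y)

theorem comb_zero (E : ℝ) (X Y : ℂ) : F.comb E X Y 0 = X := by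
  simp [comb, F.ψ₁_zero, F.ψ₂_zero]

variable (hM : IsPeriodicMedium ε μ) (hS : IsInversionSymmetric ε μ)
include hM

theorem exists_ψ₂_ne_zero (E : ℝ) : ∃ x ∈ Set.Ioo (0 : ℝ) 1, F.ψ₂ E x ≠ 0 := by
  by_contra! hn
  have hcl : Set.Icc (0 : ℝ) 1 ⊆ {x | F.ψ₂ E x = 0} := by
    rw [← closure_Ioo zero_ne_one]
    exact closure_minimal hn (isClosed_eq (F.sol₂ E).cont continuous_const)
  refine (F.B_pos hM E).ne' ?_
  have : ∫ x in (0 : ℝ)..1, ε x • (F.ψ₂ E x * F.ψ₂ E x) = ∫ x in (0 : ℝ)..1, (0 : ℝ) := by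
    refine intervalIntegral.integral_congr fun x hx => ?_
    rw [Set.uIcc_of_le zero_le_one] at hx
    have h0 : F.ψ₂ E x = 0 := hcl hx
    simp [h0]
  rw [B, this]; simp

theorem exists_comb_ne_zero {E : ℝ} {X Y : ℂ} (h : X ≠ 0 ∨ Y ≠ 0) :
    ∃ x ∈ Set.Ioo (0 : ℝ) 1, F.comb E X Y x ≠ 0 := by
  by_cases hX : X = 0
  · obtain ⟨x, hx, h1⟩ := F.exists_ψ₂_ne_zero hM E
    refine ⟨x, hx, ?_⟩
    have hY := h.resolve_left (not_not.2 hX)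
    simp [comb, hX, hY, h1]
  · have hc : ∀ᶠ x in 𝓝[>] (0 : ℝ), F.comb E X Y x ≠ 0 :=
      ((F.sol_comb E X Y).cont.continuousAt.eventually_ne
        (by rwa [F.comb_zero])).filter_mono nhdsWithin_le_nhds
    obtain ⟨x, hx, h1⟩ := (hc.and (Ioo_mem_nhdsGT one_pos)).exists
    exact ⟨x, h1, hx⟩

theorem flux_eq_zero {E : ℝ} {v : ℝ → ℂ} (h : Sol ε μ E (fun _ => (0 : ℂ)) v) (x : ℝ) :
    v x = 0 := by
  obtain ⟨F⟩ := nonempty_fundamentalSystem hM.tame_eps hM.tame_mu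
  have h0 := F.repr hM.tame_eps hM.tame_mu h
  obtain ⟨y, -, hy⟩ := F.exists_ψ₂_ne_zero hM E
  have h1 := (h0 y).1
  have hv : v 0 = 0 := by
    have : v 0 * (F.ψ₂ E y : ℂ) = 0 := by simpa using h1.symm
    exact (mul_eq_zero.1 this).resolve_right (by exact_mod_cast hy)
  rw [(h0 x).2, hv]; simp

/-- A Bloch mode is required to be quasi-periodic only in `ψ`. The flux inherits this because
`v(x+1) - e^{ik} v(x)` is the flux of the zero solution. -/
theorem _root_.Photonic.IsBlochMode.exists_sol {k E : ℝ} {ψ : ℝ → ℂ}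
    (h : IsBlochMode ε μ k E ψ) : ∃ v, Sol ε μ E ψ v ∧
      ∀ x, v (x + 1) = Complex.exp (Complex.I * k) * v x := by
  obtain ⟨h0, ⟨v, hv⟩, hb⟩ := h
  have hs := (isSolution_iff_sol hM.tame_eps hM.tame_mu).1 hv
  refine ⟨v, hs, fun x => ?_⟩
  have hd := (hs.shift hM.eps_per hM.mu_per).add (hs.const_mul (-Complex.exp (Complex.I * k)))
  have e : (fun x => ψ (x + 1) + -Complex.exp (Complex.I * k) * ψ x) = fun _ => (0 : ℂ) := by
    funext y; rw [hb y]; ring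
  rw [e] at hd
  linear_combination flux_eq_zero hM hd x

include hS

/-- Bloch modes correspond to eigenvectors of the monodromy matrix with eigenvalue `e^{ik}`; this
lemma and `isBlochMode_comb` are the two directions. -/
theorem _root_.Photonic.IsBlochMode.eq_comb {k E : ℝ} {ψ : ℝ → ℂ}
    (h : IsBlochMode ε μ k E ψ) : ∃ X Y : ℂ, (X ≠ 0 ∨ Y ≠ 0) ∧ ψ = F.comb E X Y ∧
      F.a E * X + F.b E * Y = Complex.exp (Complex.I * k) * X ∧
      F.c E * X + F.a E * Y = Complex.exp (Complex.I * k) * Y := by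
  obtain ⟨v, hs, hv⟩ := h.exists_sol hM
  have hr := F.repr hM.tame_eps hM.tame_mu hs
  have h1 := hr 1
  have hb := h.2.2 0
  have hv0 := hv 0
  rw [zero_add] at hb hv0
  rw [hb, hv0, F.v₂_one hM hS] at h1
  refine ⟨ψ 0, v 0, ?_, funext fun x => (hr x).1, ?_, ?_⟩
  · by_contra! h0
    refine h.1 (funext fun x => ?_)
    rw [(hr x).1, h0.1, h0.2]; simp
  · rw [h1.1, a, b]; simp only [RCLike.ofReal_eq_complex_ofReal]; ring
  · rw [h1.2, c]; simp only [RCLike.ofReal_eq_complex_ofReal]; ring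

theorem isBlochMode_comb {k E : ℝ} {X Y : ℂ} (h : X ≠ 0 ∨ Y ≠ 0)
    (h1 : F.a E * X + F.b E * Y = Complex.exp (Complex.I * k) * X)
    (h2 : F.c E * X + F.a E * Y = Complex.exp (Complex.I * k) * Y) :
    IsBlochMode ε μ k E (F.comb E X Y) := by
  refine ⟨fun h0 => ?_, ⟨_, (isSolution_iff_sol hM.tame_eps hM.tame_mu).2 (F.sol_comb E X Y)⟩,
    fun x => ?_⟩
  · obtain ⟨x, -, hx⟩ := F.exists_comb_ne_zero hM (E := E) h
    exact hx (congrFun h0 x)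
  · simp only [comb]
    rw [F.shift₁ hM, F.shift₂ hM hS]
    push_cast
    linear_combination (F.ψ₁ E x : ℂ) * h1 + (F.ψ₂ E x : ℂ) * h2

theorem _root_.Photonic.IsBlochMode.a_eq_cos {k E : ℝ} {ψ : ℝ → ℂ}
    (h : IsBlochMode ε μ k E ψ) : F.a E = Real.cos k := by
  obtain ⟨X, Y, h0, -, h1, h2⟩ := h.eq_comb F hM hS
  set z := Complex.exp (Complex.I * k) with hz
  have hd : (F.a E : ℂ) ^ 2 - F.b E * F.c E = 1 := by exact_mod_cast F.det hM hS E
  have e1 : (1 - 2 * (F.a E : ℂ) * z + z ^ 2) * X = 0 := by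
    linear_combination (F.a E - z : ℂ) * h1 - F.b E * h2 - X * hd
  have e2 : (1 - 2 * (F.a E : ℂ) * z + z ^ 2) * Y = 0 := by
    linear_combination (F.a E - z : ℂ) * h2 - F.c E * h1 - Y * hd
  refine Complex.cos_eq_of_exp_sq ?_
  rcases h0 with h | h
  · exact (mul_eq_zero.1 e1).resolve_right h
  · exact (mul_eq_zero.1 e2).resolve_right h

omit hS in
-- For negative energy `(ψ v)' = μ v² - E ε ψ²` is nonnegative and has positive integral.
theorem mul_flux_pos {E : ℝ} (hE : E < 0) {ψ v : ℝ → ℝ} (h : Sol ε μ E ψ v)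
    (hpos : 0 < ∫ x in (0 : ℝ)..1, ε x • (ψ x * ψ x)) (h0 : ψ 0 * v 0 = 0) : 0 < ψ 1 * v 1 := by
  have hε := hM.tame_eps
  have hμ := hM.tame_mu
  have i1 := hμ.intervalIntegrable_smul (g := fun x => v x * v x)
    (h.cont_flux.mul h.cont_flux) 0 1
  have i2 := hε.intervalIntegrable_smul (g := fun x => ψ x * ψ x) (h.cont.mul h.cont) 0 1
  have key : ∫ x in (0 : ℝ)..1, (μ x • (v x * v x) + (-E) * ε x • (ψ x * ψ x)) =
      ψ 1 * v 1 - ψ 0 * v 0 := by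
    refine integral_eq_of_hasDerivAt_off_countable (fun x => ψ x * v x) _
      (hε.countable.union hμ.countable) (h.cont.mul h.cont_flux).continuousOn (fun x hx => ?_)
      (i1.add (i2.const_mul _))
    have hx2 := hx.2
    simp only [Set.mem_union, Set.mem_ofPred_eq, not_or, not_not] at hx2
    refine ((h.deriv x hx2.2).mul (h.deriv_flux x hx2.1)).congr_deriv ?_
    simp only [smul_eq_mul]; ring
  rw [intervalIntegral.integral_add i1 (i2.const_mul _), intervalIntegral.integral_const_mul, h0,
    sub_zero] at key
  rw [← key]
  have hn : 0 ≤ ∫ x in (0 : ℝ)..1, μ x • (v x * v x) :=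
    intervalIntegral.integral_nonneg zero_le_one fun x _ =>
      mul_nonneg (hM.mu_pos x).le (mul_self_nonneg _)
  have := mul_pos (neg_pos.2 hE) hpos
  linarith

/-- For `E < 0` both `a c` and `a b` are positive, so `b c > 0`; but a Bloch mode has `b c = cos² k
- 1 ≤ 0`. -/
theorem _root_.Photonic.IsBlochMode.energy_nonneg {k E : ℝ} {ψ : ℝ → ℂ}
    (h : IsBlochMode ε μ k E ψ) : 0 ≤ E := by
  obtain ⟨F⟩ := nonempty_fundamentalSystem hM.tame_eps hM.tame_mu
  by_contra hE
  have h1 := mul_flux_pos hM (not_le.1 hE) (F.sol₁ E) (F.A_pos hM E) (by simp [F.v₁_zero])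
  have h2 := mul_flux_pos hM (not_le.1 hE) (F.sol₂ E) (F.B_pos hM E) (by simp [F.ψ₂_zero])
  rw [F.v₂_one hM hS] at h2
  change 0 < F.a E * F.c E at h1
  change 0 < F.b E * F.a E at h2
  have hd := F.det hM hS E
  have ha := h.a_eq_cos F hM hS
  have hc := Real.cos_sq_le_one k
  rw [← ha] at hc
  have := mul_pos h1 h2
  have hbc : F.b E * F.c E ≤ 0 := by linarith
  nlinarith [mul_nonneg (sq_nonneg (F.a E)) (neg_nonneg.2 hbc)]

omit hS in
-- In Green's identity against the conjugate mode the boundary terms at `0` and `1` cancel, since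
-- the multiplier has modulus one.
theorem _root_.Photonic.IsBlochMode.inner_eq_zero {k E E' : ℝ} {ψ φ : ℝ → ℂ}
    (h : IsBlochMode ε μ k E ψ) (h' : IsBlochMode ε μ k E' φ) (hE : E ≠ E') :
    innerX ε ψ φ = 0 := by
  obtain ⟨v, hs, hv⟩ := h.exists_sol hM
  obtain ⟨w, hs', hw⟩ := h'.exists_sol hM
  have hg := hs.green hM.tame_eps hM.tame_mu hs'.conj 0 1
  have h1 := h.2.2 0
  have h2 := h'.2.2 0
  have h3 := hv 0
  have h4 := hw 0
  rw [zero_add] at h1 h2 h3 h4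
  have hz : Complex.exp (Complex.I * k) * starRingEnd ℂ (Complex.exp (Complex.I * k)) = 1 := by
    rw [← Complex.exp_conj, ← Complex.exp_add]; simp
  have hl : ψ 1 * starRingEnd ℂ (w 1) - v 1 * starRingEnd ℂ (φ 1) -
      (ψ 0 * starRingEnd ℂ (w 0) - v 0 * starRingEnd ℂ (φ 0)) = 0 := by
    rw [h1, h2, h3, h4, map_mul, map_mul]
    linear_combination (ψ 0 * starRingEnd ℂ (w 0) - v 0 * starRingEnd ℂ (φ 0)) * hz
  rw [hl] at hg
  have := (smul_eq_zero.1 hg.symm).resolve_left (sub_ne_zero.2 hE)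
  rw [innerX, ← this]
  simp only [Complex.real_smul, mul_assoc]

omit hS in
theorem _root_.Photonic.IsBlochMode.inner_self_ne_zero {k E : ℝ} {ψ : ℝ → ℂ}
    (h : IsBlochMode ε μ k E ψ) : innerX ε ψ ψ ≠ 0 := by
  obtain ⟨F⟩ := nonempty_fundamentalSystem hM.tame_eps hM.tame_mu
  obtain ⟨v, hs, -⟩ := h.exists_sol hM
  have hr := F.repr hM.tame_eps hM.tame_mu hs
  obtain ⟨x, hx, hx0⟩ := F.exists_comb_ne_zero hM (E := E) (X := ψ 0) (Y := v 0) (by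
    by_contra! h0
    refine h.1 (funext fun x => ?_)
    rw [(hr x).1, h0.1, h0.2]; simp)
  have hx1 : ψ x ≠ 0 := by rw [(hr x).1]; exact hx0
  have hpos := integral_sq_pos hM (ψ := fun x => ‖ψ x‖) hs.cont.norm hx (norm_ne_zero_iff.2 hx1)
  have e : innerX ε ψ ψ = ((∫ x in (0 : ℝ)..1, ε x • (‖ψ x‖ * ‖ψ x‖) : ℝ) : ℂ) := by
    rw [innerX, ← intervalIntegral.integral_ofReal]
    refine intervalIntegral.integral_congr fun y _ => ?_
    simp only [smul_eq_mul]
    rw [mul_assoc, Complex.mul_conj, Complex.normSq_eq_norm_sq]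
    push_cast; ring
  rw [e]
  exact_mod_cast hpos.ne'

omit hS in
theorem linearIndependent_of_orthogonal {k : ℝ} {n : ℕ} {f : Fin n → ℝ → ℂ} {e : Fin n → ℝ}
    (hf : ∀ i, IsBlochMode ε μ k (e i) (f i))
    (ho : ∀ i j, i ≠ j → innerX ε (f i) (f j) = 0) : LinearIndependent ℂ f := by
  rw [Fintype.linearIndependent_iff]
  intro g hg j
  choose v hs hv using fun i => (hf i).exists_sol hM
  have hint : ∀ i, IntervalIntegrable
      (fun x => (ε x : ℂ) * (g i * f i x) * starRingEnd ℂ (f j x)) volume 0 1 := fun i => by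
    have := hM.tame_eps.intervalIntegrable_smul
      (g := fun x => (g i * f i x) * starRingEnd ℂ (f j x))
      (((hs i).cont.const_mul (g i)).mul (hs j).conj.cont) 0 1
    simpa only [Complex.real_smul, mul_assoc] using this
  have h0 : innerX ε (∑ i, g i • f i) (f j) = 0 := by rw [hg]; simp [innerX]
  have h1 : innerX ε (∑ i, g i • f i) (f j) = ∑ i, g i * innerX ε (f i) (f j) := by
    have e1 : innerX ε (∑ i, g i • f i) (f j) =
        ∫ x in (0 : ℝ)..1, ∑ i, (ε x : ℂ) * (g i * f i x) * starRingEnd ℂ (f j x) := by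
      refine intervalIntegral.integral_congr fun x _ => ?_
      simp only [Finset.sum_apply, Pi.smul_apply, smul_eq_mul, Finset.mul_sum, Finset.sum_mul]
    rw [e1, intervalIntegral.integral_finsetSum fun i _ => hint i]
    refine Finset.sum_congr rfl fun i _ => ?_
    rw [innerX, ← intervalIntegral.integral_const_mul]
    refine intervalIntegral.integral_congr fun x _ => ?_
    ring
  rw [h1, Finset.sum_eq_single j (fun i _ hi => by rw [ho i j hi, mul_zero]) (by simp)] at h0
  exact (mul_eq_zero.1 h0).resolve_right ((hf j).inner_self_ne_zero hM)

end FundamentalSystem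

namespace FundamentalSystem

variable {ε μ : ℝ → ℝ} (F : FundamentalSystem ε μ)

/-- A Bloch mode at `(k, E)`. At a double eigenvalue it is `ψ_{E,1}` if `E = q` and `ψ_{E,2}`
otherwise. -/
def bandMode (q k E : ℝ) : ℝ → ℂ :=
  if F.b E = 0 then if F.c E = 0 ∧ E = q then F.comb E 1 0 else F.comb E 0 1
  else F.comb E (F.b E) (Complex.exp (Complex.I * k) - F.a E)

variable (hM : IsPeriodicMedium ε μ) (hS : IsInversionSymmetric ε μ)
include hM hS

theorem exp_sub_sq {k E : ℝ} (h : F.a E = Real.cos k) :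
    (Complex.exp (Complex.I * k) - F.a E) ^ 2 = F.b E * F.c E := by
  have h1 : (F.a E : ℂ) ^ 2 - F.b E * F.c E = 1 := by exact_mod_cast F.det hM hS E
  have h2 : (Real.sin k : ℂ) ^ 2 + (Real.cos k : ℂ) ^ 2 = 1 := by
    exact_mod_cast Real.sin_sq_add_cos_sq k
  rw [exp_I_mul_eq, h] at *
  linear_combination (Real.sin k : ℂ) ^ 2 * Complex.I_sq + h1 - h2

theorem exp_eq_of_mul_eq_zero {k E : ℝ} (h : F.a E = Real.cos k) (h0 : F.b E * F.c E = 0) :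
    Complex.exp (Complex.I * k) = F.a E := by
  have h1 := F.exp_sub_sq hM hS h
  rw [← Complex.ofReal_mul, h0, Complex.ofReal_zero] at h1
  exact sub_eq_zero.1 (pow_eq_zero_iff two_ne_zero |>.1 h1)

theorem isBlochMode_bandMode (q : ℝ) {k E : ℝ} (h : F.a E = Real.cos k) :
    IsBlochMode ε μ k E (F.bandMode q k E) := by
  unfold bandMode
  by_cases hb : F.b E = 0
  · have hz := F.exp_eq_of_mul_eq_zero hM hS h (by rw [hb, zero_mul])
    rw [if_pos hb]
    by_cases hc : F.c E = 0 ∧ E = q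
    · rw [if_pos hc]
      exact F.isBlochMode_comb hM hS (Or.inl one_ne_zero) (by rw [hz]; ring)
        (by rw [hc.1]; simp)
    · rw [if_neg hc]
      exact F.isBlochMode_comb hM hS (Or.inr one_ne_zero) (by rw [hb]; simp) (by rw [hz]; ring)
  · rw [if_neg hb]
    refine F.isBlochMode_comb hM hS (Or.inl (by exact_mod_cast hb)) (by ring) ?_
    linear_combination -(F.exp_sub_sq hM hS h)

theorem mem_span_of_simple (q : ℝ) {k E : ℝ} {ψ : ℝ → ℂ} (h : IsBlochMode ε μ k E ψ)
    (h0 : ¬ (F.b E = 0 ∧ F.c E = 0)) : ψ ∈ Submodule.span ℂ {F.bandMode q k E} := by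
  have ha := h.a_eq_cos F hM hS
  obtain ⟨X, Y, -, rfl, h1, h2⟩ := h.eq_comb F hM hS
  rw [Submodule.mem_span_singleton]
  unfold bandMode
  by_cases hb : F.b E = 0
  · have hc : F.c E ≠ 0 := fun hc => h0 ⟨hb, hc⟩
    rw [if_pos hb, if_neg fun h => hc h.1]
    rw [F.exp_eq_of_mul_eq_zero hM hS ha (by rw [hb, zero_mul])] at h2
    have hX : X = 0 := by
      have : (F.c E : ℂ) * X = 0 := by linear_combination h2
      exact (mul_eq_zero.1 this).resolve_left (by exact_mod_cast hc)
    refine ⟨Y, funext fun x => ?_⟩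
    simp [comb, hX]
  · rw [if_neg hb]
    have hb' : (F.b E : ℂ) ≠ 0 := by exact_mod_cast hb
    refine ⟨X / F.b E, funext fun x => ?_⟩
    have : X / F.b E * (Complex.exp (Complex.I * k) - F.a E) = Y := by
      field_simp
      linear_combination -h1
    simp only [comb, Pi.smul_apply, smul_eq_mul]
    rw [mul_add, ← mul_assoc, ← mul_assoc, this, div_mul_cancel₀ _ hb']

theorem mem_span_of_double {k E : ℝ} {ψ : ℝ → ℂ} (h : IsBlochMode ε μ k E ψ) {S : Set (ℝ → ℂ)}
    (h1 : F.comb E 1 0 ∈ S) (h2 : F.comb E 0 1 ∈ S) : ψ ∈ Submodule.span ℂ S := by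
  obtain ⟨X, Y, -, rfl, -, -⟩ := h.eq_comb F hM hS
  have : F.comb E X Y = X • F.comb E 1 0 + Y • F.comb E 0 1 := by
    funext x; simp [comb]
  rw [this]
  exact Submodule.add_mem _ (Submodule.smul_mem _ _ (Submodule.subset_span h1))
    (Submodule.smul_mem _ _ (Submodule.subset_span h2))

/-- With equal energies orthogonality is not automatic; here it comes from `2 a G = b A + c B = 0`.
-/
theorem inner_comb_double {E : ℝ} (hb : F.b E = 0) (hc : F.c E = 0) :
    innerX ε (F.comb E 1 0) (F.comb E 0 1) = 0 := by
  have hG : F.G E = 0 := by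
    have h1 := F.two_mul_a_mul_G hM hS E
    have h2 := F.det hM hS E
    rw [hb, hc] at *
    have : (2 * F.a E) * F.G E = 0 := by linarith
    refine (mul_eq_zero.1 this).resolve_left fun h => ?_
    have : F.a E = 0 := by linarith
    rw [this] at h2; norm_num at h2
  have : innerX ε (F.comb E 1 0) (F.comb E 0 1) = ((F.G E : ℝ) : ℂ) := by
    rw [innerX, G, ← intervalIntegral.integral_ofReal]
    refine intervalIntegral.integral_congr fun x _ => ?_
    simp [comb, mul_assoc]
  rw [this, hG, Complex.ofReal_zero]

variable {N : ℕ} {p q : ℕ → ℝ} (P : BandEdges F.a N p q)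

omit hM hS in
theorem _root_.Photonic.BandEdges.abs_lt_or_edge {a : ℝ → ℝ} (P : BandEdges a N p q) {n : ℕ}
    (hn : n < N) {E : ℝ} (hE : E ∈ Set.Icc (p n) (q n)) : |a E| < 1 ∨ E = p n ∨ E = q n := by
  by_cases h1 : E = p n
  · exact Or.inr (Or.inl h1)
  · by_cases h2 : E = q n
    · exact Or.inr (Or.inr h2)
    · exact Or.inl (P.band n hn E ⟨lt_of_le_of_ne hE.1 (Ne.symm h1), lt_of_le_of_ne hE.2 h2⟩)

include P

/-- Double eigenvalues at the lower edge of a band are the upper edge of the preceding band. -/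
theorem exists_pred_of_double {n : ℕ} (hn : n < N) (hb : F.b (p n) = 0) (hc : F.c (p n) = 0) :
    ∃ l, n = l + 1 ∧ q l = p (l + 1) := by
  rcases n with _ | l
  · rw [P.zero] at hb
    exact absurd hb (F.at_zero hM).2.2.ne'
  · refine ⟨l, rfl, ?_⟩
    by_contra hne
    rcases (F.hillSystem hM hS).gap_sign P hn (lt_of_le_of_ne (P.le l hn) hne) with h | h
    · exact h.2.2.2.1 hc
    · exact h.2.2.2.1 hb

/-- At a touching of bands the two modes `ψ₁`, `ψ₂` are shared between the lower and the upper band,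
so both must be among the first `J`. The hypothesis `hq` secures the upper partner when the energy
is the top of band `i`. -/
theorem mem_span_bandMode {k : ℝ} {e : ℕ → ℝ}
    (he : ∀ n < N, e n ∈ Set.Icc (p n) (q n) ∧ F.a (e n) = Real.cos k) {J i : ℕ} (hJ : J ≤ N)
    (hi : i < J) {ψ : ℝ → ℂ} (h : IsBlochMode ε μ k (e i) ψ)
    (hq : F.b (e i) = 0 → F.c (e i) = 0 → e i = q i → i + 1 < J) :
    ψ ∈ Submodule.span ℂ
      ((fun n => F.bandMode (q n) k (e n)) '' Set.Iio J) := by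
  have H := F.hillSystem hM hS
  have hmem : ∀ n < J, F.bandMode (q n) k (e n) ∈
      ((fun n => F.bandMode (q n) k (e n)) '' Set.Iio J) := fun n hn =>
    ⟨n, hn, rfl⟩
  by_cases h0 : F.b (e i) = 0 ∧ F.c (e i) = 0
  · have pair : ∀ l, l + 1 < J → q l = p (l + 1) → e i = q l →
        ψ ∈ Submodule.span ℂ
          ((fun n => F.bandMode (q n) k (e n)) '' Set.Iio J) := by
      intro l hl hcl hel
      have hl' : l < N := by lia
      have hl1 : l + 1 < N := by lia
      have e1 : e l = e i := by
        refine H.injOn P hl' (he l hl').1 ?_ ((he l hl').2.trans (he i (by lia)).2.symm)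
        rw [hel]; exact ⟨(P.lt l hl').le, le_rfl⟩
      have e2 : e (l + 1) = e i := by
        refine H.injOn P hl1 (he _ hl1).1 ?_ ((he _ hl1).2.trans (he i (by lia)).2.symm)
        rw [hel, hcl]; exact ⟨le_rfl, (P.lt _ hl1).le⟩
      have m1 := hmem l (by lia)
      have m2 := hmem (l + 1) hl
      rw [bandMode, e1, if_pos h0.1, if_pos ⟨h0.2, hel⟩] at m1
      rw [bandMode, e2, if_pos h0.1, if_neg (fun h => ?_)] at m2
      · exact F.mem_span_of_double hM hS h m1 m2
      · have := P.lt _ hl1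
        rw [← hcl, ← hel] at this
        exact this.ne h.2
    have habs : ¬ |F.a (e i)| < 1 := fun hlt => by
      have := H.mul_neg hlt
      rw [h0.1, zero_mul] at this
      exact lt_irrefl _ this
    rcases (P.abs_lt_or_edge (by lia) (he i (by lia)).1).resolve_left habs with h1 | h1
    · obtain ⟨l, rfl, hl⟩ := F.exists_pred_of_double hM hS P (n := i) (by lia)
        (h1 ▸ h0.1) (h1 ▸ h0.2)
      exact pair l hi hl (h1.trans hl.symm)
    · have hi1 := hq h0.1 h0.2 h1
      exact pair i hi1 ((H.closed_iff P (by lia)).2 (h1 ▸ h0)) h1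
  · refine Submodule.span_mono ?_ (F.mem_span_of_simple hM hS (q i) h h0)
    exact Set.singleton_subset_iff.2 (hmem i hi)

theorem inner_bandMode_eq_zero {k : ℝ} {e : ℕ → ℝ}
    (he : ∀ n < N, e n ∈ Set.Icc (p n) (q n) ∧ F.a (e n) = Real.cos k) {i j : ℕ} (hij : i < j)
    (hj : j < N) : innerX ε (F.bandMode (q i) k (e i)) (F.bandMode (q j) k (e j)) = 0 := by
  have H := F.hillSystem hM hS
  have hi : i < N := hij.trans hj
  by_cases hne : e i = e j
  · have h1 := (he i hi).1.2
    have h2 := (he j hj).1.1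
    have h3 := P.q_le_p hij hj
    have e1 : e i = q i := by linarith
    have e2 : e j = p j := by linarith
    -- Equal energies in different bands occur only where consecutive bands touch, because each band
    -- has positive length.
    have hj1 : j = i + 1 := by
      by_contra hne'
      have := P.p_lt_p (i := i + 1) (j := j) (by lia) hj
      have := P.le i (by lia)
      linarith
    subst hj1
    have hcl : q i = p (i + 1) := by linarith
    have h0 := (H.closed_iff P hj).1 hcl
    rw [← e1] at h0
    have hlt := P.lt _ hj
    rw [bandMode, if_pos h0.1, if_pos ⟨h0.2, e1⟩, bandMode, ← hne, if_pos h0.1,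
      if_neg fun h => by rw [hne, e2] at h; exact hlt.ne h.2]
    exact F.inner_comb_double hM hS h0.1 h0.2
  · exact (F.isBlochMode_bandMode hM hS (q i) (he i hi).2).inner_eq_zero hM
      (F.isBlochMode_bandMode hM hS (q j) (he j hj).2) hne

theorem exists_roots (k : ℝ) : ∃ e : ℕ → ℝ, ∀ n < N,
    e n ∈ Set.Icc (p n) (q n) ∧ F.a (e n) = Real.cos k := by
  have : ∀ n, ∃ E, n < N → E ∈ Set.Icc (p n) (q n) ∧ F.a E = Real.cos k := by
    intro n
    by_cases hn : n < N
    · have hiv := intermediate_value_uIcc (a := p n) (b := q n)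
        ((F.hillSystem hM hS).continuous_a.continuousOn)
      have hmem : Real.cos k ∈ Set.uIcc (F.a (p n)) (F.a (q n)) := by
        rw [P.a_p n hn, P.a_q n hn, pow_succ, Set.mem_uIcc]
        have h1 := Real.neg_one_le_cos k
        have h2 := Real.cos_le_one k
        rcases neg_one_pow_eq_or ℝ n with h | h <;> rw [h]
        · right; constructor <;> linarith
        · left; constructor <;> linarith
      obtain ⟨E, hE, hEk⟩ := hiv hmem
      rw [Set.uIcc_of_le (P.lt n hn).le] at hE
      exact ⟨E, fun _ => ⟨hE, hEk⟩⟩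
    · exact ⟨0, fun h => absurd h hn⟩
  choose e he using this
  exact ⟨e, he⟩

omit P hM hS in
theorem card_le_of_mem_span {n J : ℕ} {f : Fin n → ℝ → ℂ} (hf : LinearIndependent ℂ f)
    {g : ℕ → ℝ → ℂ} (hg : ∀ i, f i ∈ Submodule.span ℂ
      (g '' Set.Iio J)) : n ≤ J := by
  have hfin : (Set.Iio J).Finite := Set.finite_Iio J
  let _ := (hfin.image g).fintype
  have h1 := linearIndependent_le_span_aux' f hf (g '' Set.Iio J) (by
    rintro _ ⟨i, rfl⟩; exact hg i)
  rw [Fintype.card_fin, ← Nat.card_eq_fintype_card, Nat.card_coe_set_eq] at h1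
  exact h1.trans ((Set.ncard_image_le hfin).trans (by simp [Set.ncard_eq_toFinset_card']))

/-- The dispersion relation: on the `n`-th band (numbered from `0`), `a (E_{n+1}(k)) = cos k`. -/
theorem bandE_spec {n : ℕ} (hn : n < N) (k : ℝ) :
    bandE ε μ (n + 1) k ∈ Set.Icc (p n) (q n) ∧ F.a (bandE ε μ (n + 1) k) = Real.cos k := by
  have H := F.hillSystem hM hS
  obtain ⟨e, he⟩ := F.exists_roots hM hS P k
  have hmono : ∀ i ≤ n, e i ≤ e n := fun i hi => by
    rcases hi.eq_or_lt with rfl | hlt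
    · exact le_rfl
    · exact (he i (by lia)).1.2.trans ((P.q_le_p hlt hn).trans (he n hn).1.1)
  -- The first `n + 1` band modes are orthogonal, which gives membership. Below `e n` every Bloch
  -- mode lies in the span of the first `n` band modes, which gives minimality.
  have hleast : IsLeast (eigenvalueSet ε μ (n + 1) k) (e n) := by
    constructor
    · have hb : ∀ i : Fin (n + 1), IsBlochMode ε μ k (e i) (F.bandMode (q i) k (e i)) :=
        fun i => F.isBlochMode_bandMode hM hS _ (he i (by lia)).2
      refine ⟨fun i => F.bandMode (q i) k (e i), linearIndependent_of_orthogonal hM hb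
        fun i j hij => ?_, fun i => ⟨e i, hmono i (by lia), hb i⟩⟩
      rcases lt_or_gt_of_ne hij with h | h
      · exact F.inner_bandMode_eq_zero hM hS P he h (by lia)
      · have h1 := F.inner_bandMode_eq_zero hM hS P he (i := j) (j := i) h (by lia)
        have h2 : innerX ε (F.bandMode (q i) k (e i)) (F.bandMode (q j) k (e j)) =
            starRingEnd ℂ (innerX ε (F.bandMode (q j) k (e j)) (F.bandMode (q i) k (e i))) := by
          rw [innerX, innerX, ← intervalIntegral.intervalIntegral_conj]
          refine intervalIntegral.integral_congr fun x _ => ?_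
          simp only [map_mul, Complex.conj_ofReal, Complex.conj_conj]
          ring
        rw [h2, h1, map_zero]
    · rintro E ⟨f, hf, hE⟩
      by_contra hlt
      rw [not_le] at hlt
      refine absurd (card_le_of_mem_span (J := n) hf
        (g := fun i => F.bandMode (q i) k (e i)) fun i => ?_) (by lia)
      obtain ⟨E', hE', hb⟩ := hE i
      have ha := hb.a_eq_cos F hM hS
      obtain ⟨j, hj, hj'⟩ := P.exists_band hn (hb.energy_nonneg hM hS)
        ((hE'.trans hlt.le).trans (he n hn).1.2) (by rw [ha]; exact Real.abs_cos_le_one k)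
      have hej : e j = E' := H.injOn P (by lia) (he j (by lia)).1 hj'
        ((he j (by lia)).2.trans ha.symm)
      subst hej
      have hjn : j < n := lt_of_le_of_ne hj fun h => by subst h; linarith
      -- A double eigenvalue whose upper partner is band `n` would have energy `e n` itself,
      -- contrary to lying strictly below it.
      refine F.mem_span_bandMode hM hS P he hn.le hjn hb fun hb0 hc0 hq => ?_
      by_contra hjn'
      obtain rfl : n = j + 1 := by lia
      have hcl := (H.closed_iff P hn).2 (hq ▸ ⟨hb0, hc0⟩)
      have hap : F.a (p (j + 1)) = Real.cos k := by rw [← hcl, ← hq]; exact ha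
      have := H.injOn P hn (he _ hn).1 ⟨le_rfl, (P.lt _ hn).le⟩ ((he _ hn).2.trans hap.symm)
      linarith
  have : bandE ε μ (n + 1) k = e n := hleast.csInf_eq
  rw [this]
  exact he n hn

end FundamentalSystem

/-! ### Existence of the bands and continuity of the dispersion relation -/

/-- The wavenumber, `0` or `π`, at which `cos k = (-1) ^ n`. -/
def edgeWavenumber (n : ℕ) : ℝ := if Even n then 0 else Real.pi

theorem cos_edgeWavenumber (n : ℕ) : Real.cos (edgeWavenumber n) = (-1) ^ n := by
  unfold edgeWavenumber
  split_ifs with h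
  · simp [h.neg_one_pow]
  · simp [(Nat.not_even_iff_odd.1 h).neg_one_pow]

theorem edgeWavenumber_mem (n : ℕ) : edgeWavenumber n ∈ Set.Icc 0 Real.pi := by
  unfold edgeWavenumber
  split_ifs
  · exact ⟨le_rfl, Real.pi_pos.le⟩
  · exact ⟨Real.pi_pos.le, le_rfl⟩

theorem edgeWavenumber_mem' (n : ℕ) : edgeWavenumber n ∈ Set.Icc (-Real.pi) Real.pi :=
  ⟨by linarith [(edgeWavenumber_mem n).1, Real.pi_pos], (edgeWavenumber_mem n).2⟩

theorem eigenvalueSet_nonempty_of_le {ε μ : ℝ → ℝ} {i j : ℕ} (hij : i ≤ j) {k : ℝ}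
    (h : (eigenvalueSet ε μ j k).Nonempty) : (eigenvalueSet ε μ i k).Nonempty := by
  obtain ⟨E, f, hf, hE⟩ := h
  exact ⟨E, f ∘ Fin.castLE hij, hf.comp _ (Fin.castLE_injective hij), fun x => hE _⟩

namespace FundamentalSystem

variable {ε μ : ℝ → ℝ} (F : FundamentalSystem ε μ)
variable (hM : IsPeriodicMedium ε μ) (hS : IsInversionSymmetric ε μ)
include hM hS

/-- At the wavenumber of the far edge of band `N`, `N + 1` independent Bloch modes cannot all lie in
the span of the `N` known band modes. One of them has energy beyond the known bands, and
`exists_bandEdges_succ` then yields another band. -/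
theorem exists_bandEdges {M : ℕ}
    (h : ∀ k ∈ Set.Icc (-Real.pi) Real.pi, (eigenvalueSet ε μ M k).Nonempty) :
    ∃ p q, BandEdges F.a M p q := by
  have H := F.hillSystem hM hS
  obtain ⟨ha0, hc0, hb0⟩ := F.at_zero hM
  suffices ∀ N ≤ M, ∃ p q, BandEdges F.a N p q from this M le_rfl
  intro N
  induction N with
  | zero =>
    exact fun _ => ⟨fun _ => 0, fun _ => 0, rfl, by simp, by simp, by simp, by simp, by simp,
      by simp⟩
  | succ N ih =>
    intro hN
    obtain ⟨p, q, P⟩ := ih (by lia)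
    set k := edgeWavenumber (N + 1) with hk
    have hcos := cos_edgeWavenumber (N + 1)
    obtain ⟨E, f, hf, hE⟩ := eigenvalueSet_nonempty_of_le hN (h k (edgeWavenumber_mem' _))
    obtain ⟨e, he⟩ := F.exists_roots hM hS P k
    by_cases hspan : ∀ i, f i ∈ Submodule.span ℂ
        ((fun n => F.bandMode (q n) k (e n)) '' Set.Iio N)
    · exact absurd (card_le_of_mem_span hf hspan) (by lia)
    push Not at hspan
    obtain ⟨i, hi⟩ := hspan
    obtain ⟨E', -, hb⟩ := hE i
    have ha := hb.a_eq_cos F hM hS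
    refine H.exists_bandEdges_succ ha0 hc0 hb0 P (hb.energy_nonneg hM hS) (fun n hn => ?_)
      (ha.trans hcos)
    by_contra hle
    obtain ⟨j, hj, hj'⟩ := P.exists_band hn (hb.energy_nonneg hM hS) (not_lt.1 hle)
      (by rw [ha]; exact Real.abs_cos_le_one k)
    have hjN : j < N := by lia
    have hej : e j = E' := H.injOn P hjN (he j hjN).1 hj' ((he j hjN).2.trans ha.symm)
    subst hej
    refine hi (F.mem_span_bandMode hM hS P he le_rfl hjN hb fun _ _ hq => ?_)
    by_contra hjn'
    obtain rfl : N = j + 1 := by lia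
    rw [hq, P.a_q j hjN, hk, hcos, pow_succ _ (j + 1)] at ha
    -- The top of the last known band has the opposite value of `a`, so at this wavenumber no double
    -- eigenvalue lacks its upper partner.
    rcases neg_one_pow_eq_or ℝ (j + 1) with h' | h' <;> rw [h'] at ha <;> norm_num at ha

omit F in
-- An empty set would have `sInf` equal to `0`, making the lower edge of band `m + 1` at most `0`.
-- The upper edge of band `m` is nonnegative, so there would be no gap. Hence the gap hypothesis
-- alone guarantees enough eigenvalues.
theorem eigenvalueSet_nonempty_of_gap {m : ℕ}
    (hgap : bandMax ε μ m < bandMin ε μ (m + 1)) :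
    ∀ k ∈ Set.Icc (-Real.pi) Real.pi, (eigenvalueSet ε μ (m + 1) k).Nonempty := by
  have hnn : ∀ j k, 0 ≤ bandE ε μ (j + 1) k := fun j k => by
    refine Real.sInf_nonneg ?_
    rintro E ⟨f, -, hE⟩
    obtain ⟨E', hE', hb⟩ := hE 0
    exact (hb.energy_nonneg hM hS).trans hE'
  have h0 : 0 ≤ bandMax ε μ m := by
    rcases m with _ | m
    · refine Real.sSup_nonneg ?_
      rintro _ ⟨k, -, rfl⟩
      have : eigenvalueSet ε μ 0 k = Set.univ := Set.eq_univ_of_forall fun E =>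
        ⟨Fin.elim0, linearIndependent_empty_type, fun i => i.elim0⟩
      change 0 ≤ sInf (eigenvalueSet ε μ 0 k)
      rw [this, Real.sInf_univ]
    · refine Real.sSup_nonneg ?_
      rintro _ ⟨k, -, rfl⟩
      exact hnn m k
  intro k hk
  by_contra hne
  have hE : bandE ε μ (m + 1) k = 0 := by
    change sInf (eigenvalueSet ε μ (m + 1) k) = 0
    rw [Set.not_nonempty_iff_eq_empty.1 hne, Real.sInf_empty]
  have : bandMin ε μ (m + 1) ≤ bandE ε μ (m + 1) k :=
    csInf_le ⟨0, by rintro _ ⟨k, -, rfl⟩; exact hnn m k⟩ ⟨k, hk, rfl⟩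
  linarith

variable {N : ℕ} {p q : ℕ → ℝ} (P : BandEdges F.a N p q)
include P

theorem bandE_edge_p {n : ℕ} (hn : n < N) {k : ℝ} (hk : Real.cos k = (-1) ^ n) :
    bandE ε μ (n + 1) k = p n := by
  obtain ⟨h1, h2⟩ := F.bandE_spec hM hS P hn k
  exact (F.hillSystem hM hS).injOn P hn h1 ⟨le_rfl, (P.lt n hn).le⟩
    (by rw [h2, hk, P.a_p n hn])

theorem bandE_edge_q {n : ℕ} (hn : n < N) {k : ℝ} (hk : Real.cos k = (-1) ^ (n + 1)) :
    bandE ε μ (n + 1) k = q n := by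
  obtain ⟨h1, h2⟩ := F.bandE_spec hM hS P hn k
  exact (F.hillSystem hM hS).injOn P hn h1 ⟨(P.lt n hn).le, le_rfl⟩
    (by rw [h2, hk, P.a_q n hn])

theorem bandMin_eq {n : ℕ} (hn : n < N) : bandMin ε μ (n + 1) = p n := by
  have : IsLeast (bandE ε μ (n + 1) '' Set.Icc (-Real.pi) Real.pi) (p n) :=
    ⟨⟨_, edgeWavenumber_mem' n, F.bandE_edge_p hM hS P hn (cos_edgeWavenumber n)⟩, by
      rintro _ ⟨k, -, rfl⟩; exact (F.bandE_spec hM hS P hn k).1.1⟩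
  exact this.csInf_eq

theorem bandMax_eq {n : ℕ} (hn : n < N) : bandMax ε μ (n + 1) = q n := by
  have : IsGreatest (bandE ε μ (n + 1) '' Set.Icc (-Real.pi) Real.pi) (q n) :=
    ⟨⟨_, edgeWavenumber_mem' (n + 1), F.bandE_edge_q hM hS P hn (cos_edgeWavenumber _)⟩, by
      rintro _ ⟨k, -, rfl⟩; exact (F.bandE_spec hM hS P hn k).1.2⟩
  exact this.csSup_eq

/-- On the compact interval `[p n, q n]` the injective map `a` is a closed embedding, and its
composition with the band function is `cos`. -/
theorem continuous_bandE {n : ℕ} (hn : n < N) : Continuous (bandE ε μ (n + 1)) := by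
  have H := F.hillSystem hM hS
  have hemb : Topology.IsClosedEmbedding fun x : Set.Icc (p n) (q n) => F.a x :=
    (H.continuous_a.comp continuous_subtype_val).isClosedEmbedding fun x y h =>
      Subtype.ext (H.injOn P hn x.2 y.2 h)
  have h1 : Continuous fun k : ℝ =>
      (⟨bandE ε μ (n + 1) k, (F.bandE_spec hM hS P hn k).1⟩ : Set.Icc (p n) (q n)) := by
    rw [hemb.isInducing.continuous_iff]
    refine Real.continuous_cos.congr fun k => ?_
    exact (F.bandE_spec hM hS P hn k).2.symm
  exact continuous_subtype_val.comp h1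

theorem bandE_mem_Ioo {n : ℕ} (hn : n < N) {k : ℝ} (hk : Real.sin k ≠ 0) :
    bandE ε μ (n + 1) k ∈ Set.Ioo (p n) (q n) := by
  obtain ⟨h1, h2⟩ := F.bandE_spec hM hS P hn k
  have h3 := Real.sin_sq_add_cos_sq k
  have h4 : 0 < Real.sin k ^ 2 := by positivity
  have key : ∀ s : ℝ, s ^ 2 = 1 → F.a (bandE ε μ (n + 1) k) ≠ s := fun s hs h => by
    rw [← h2, h, hs] at h3; linarith
  refine ⟨lt_of_le_of_ne h1.1 fun h => key ((-1) ^ n) ?_ ?_,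
    lt_of_le_of_ne h1.2 fun h => key ((-1) ^ (n + 1)) ?_ ?_⟩
  · rw [sq, neg_one_pow_mul_self_eq]
  · rw [← h, P.a_p n hn]
  · rw [sq, neg_one_pow_mul_self_eq]
  · rw [h, P.a_q n hn]

end FundamentalSystem

/-! ### Normalized Bloch modes, their limits at band edges, and the Zak phase -/

namespace FundamentalSystem

variable {ε μ : ℝ → ℝ} (F : FundamentalSystem ε μ)

/-- The weight of `ψ_{E,1}` in the normalized Bloch modes. -/
def weight₁ (E : ℝ) : ℝ := Real.sqrt (|F.b E| / (|F.b E| * F.A E + |F.c E| * F.B E))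
/-- The weight of `ψ_{E,2}` in the normalized Bloch modes. -/
def weight₂ (E : ℝ) : ℝ := Real.sqrt (|F.c E| / (|F.b E| * F.A E + |F.c E| * F.B E))

variable (hM : IsPeriodicMedium ε μ) (hS : IsInversionSymmetric ε μ)
include hM

theorem inner_comb (E : ℝ) (X Y X' Y' : ℂ) :
    innerX ε (F.comb E X Y) (F.comb E X' Y') =
      X * starRingEnd ℂ X' * F.A E + Y * starRingEnd ℂ Y' * F.B E +
        (X * starRingEnd ℂ Y' + Y * starRingEnd ℂ X') * F.G E := by
  have hi : ∀ f g : ℝ → ℝ, Continuous f → Continuous g → ∀ z : ℂ,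
      IntervalIntegrable (fun x => z * ((ε x • (f x * g x) : ℝ) : ℂ)) volume 0 1 :=
    fun f g hf hg z => by
      have := hM.tame_eps.intervalIntegrable_smul (g := fun x => z * ((f x * g x : ℝ) : ℂ))
        (continuous_const.mul (Complex.continuous_ofReal.comp (hf.mul hg))) 0 1
      refine this.congr (fun x _ => ?_)
      simp only [Complex.real_smul, smul_eq_mul]; push_cast; ring
  have c1 := (F.sol₁ E).cont
  have c2 := (F.sol₂ E).cont
  simp only [A, B, G, ← intervalIntegral.integral_ofReal]
  rw [← intervalIntegral.integral_const_mul, ← intervalIntegral.integral_const_mul,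
    ← intervalIntegral.integral_const_mul,
    ← intervalIntegral.integral_add (hi _ _ c1 c1 _) (hi _ _ c2 c2 _),
    ← intervalIntegral.integral_add ((hi _ _ c1 c1 _).add (hi _ _ c2 c2 _)) (hi _ _ c1 c2 _),
    innerX]
  refine intervalIntegral.integral_congr fun x _ => ?_
  simp only [comb, map_add, map_mul, Complex.conj_ofReal, smul_eq_mul]
  push_cast; ring

theorem norm_comb (E X Y : ℝ) :
    normX ε (F.comb E X (Complex.I * Y)) = Real.sqrt (X ^ 2 * F.A E + Y ^ 2 * F.B E) := by
  have c1 := (F.sol₁ E).cont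
  have c2 := (F.sol₂ E).cont
  have i1 := hM.tame_eps.intervalIntegrable_smul (g := fun x => F.ψ₁ E x * F.ψ₁ E x)
    (c1.mul c1) 0 1
  have i2 := hM.tame_eps.intervalIntegrable_smul (g := fun x => F.ψ₂ E x * F.ψ₂ E x)
    (c2.mul c2) 0 1
  rw [normX, A, B, ← intervalIntegral.integral_const_mul, ← intervalIntegral.integral_const_mul,
    ← intervalIntegral.integral_add (i1.const_mul _) (i2.const_mul _)]
  congr 1
  refine intervalIntegral.integral_congr fun x _ => ?_
  have : ‖F.comb E X (Complex.I * Y) x‖ ^ 2 = (X * F.ψ₁ E x) ^ 2 + (Y * F.ψ₂ E x) ^ 2 := by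
    rw [← Complex.normSq_eq_norm_sq, comb, Complex.normSq_apply]
    simp
    ring
  simp only [this, smul_eq_mul]
  ring

theorem continuousAt_ψ {x : ℝ} (hx : x ∈ Set.Icc (0 : ℝ) 1) (E₀ : ℝ) :
    ContinuousAt (fun E => F.ψ₁ E x) E₀ ∧ ContinuousAt (fun E => F.ψ₂ E x) E₀ := by
  obtain ⟨C, -, hC⟩ := F.exists_lipschitz hM.tame_eps hM.tame_mu E₀
  have h0 : Tendsto (fun E => C * |E - E₀|) (𝓝 E₀) (𝓝 0) := by
    have : Continuous fun E => C * |E - E₀| := by fun_prop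
    simpa using this.tendsto E₀
  have hev : ∀ᶠ E in 𝓝 E₀, |E - E₀| ≤ 1 := Metric.closedBall_mem_nhds E₀ one_pos
  constructor
  · refine tendsto_iff_norm_sub_tendsto_zero.2 (squeeze_zero' (Eventually.of_forall fun _ =>
      norm_nonneg _) (hev.mono fun E hE => ?_) h0)
    exact (hC E x hE hx).2.2.1
  · refine tendsto_iff_norm_sub_tendsto_zero.2 (squeeze_zero' (Eventually.of_forall fun _ =>
      norm_nonneg _) (hev.mono fun E hE => ?_) h0)
    exact (hC E x hE hx).2.2.2

theorem continuousAt_A_B (E₀ : ℝ) : ContinuousAt F.A E₀ ∧ ContinuousAt F.B E₀ := by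
  obtain ⟨C, hC0, hC⟩ := F.exists_lipschitz hM.tame_eps hM.tame_mu E₀
  obtain ⟨L, hL⟩ := hM.tame_eps.bounded
  have h0 : Tendsto (fun E => L * C * (C * |E - E₀|) + L * C * (C * |E - E₀|)) (𝓝 E₀) (𝓝 0) := by
    have : Continuous fun E => L * C * (C * |E - E₀|) + L * C * (C * |E - E₀|) := by fun_prop
    simpa using this.tendsto E₀
  have hev : ∀ᶠ E in 𝓝 E₀, |E - E₀| ≤ 1 := Metric.closedBall_mem_nhds E₀ one_pos
  have key : ∀ f : ℝ → ℝ → ℝ, (∀ E, Continuous (f E)) →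
      (∀ E x, |E - E₀| ≤ 1 → x ∈ Set.Icc (0 : ℝ) 1 → |f E x| ≤ C) →
      (∀ E x, |E - E₀| ≤ 1 → x ∈ Set.Icc (0 : ℝ) 1 → |f E x - f E₀ x| ≤ C * |E - E₀|) →
      ContinuousAt (fun E => ∫ x in (0 : ℝ)..1, ε x • (f E x * f E x)) E₀ := by
    intro f hf h1 h2
    refine tendsto_iff_norm_sub_tendsto_zero.2 (squeeze_zero' (Eventually.of_forall fun _ =>
      norm_nonneg _) (hev.mono fun E hE => ?_) h0)
    have k1 := abs_integral_sub_le hM.tame_eps (hf E) (hf E) (hf E₀) (fun x hx => h1 E x hE hx)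
      (fun x hx => h2 E x hE hx) hL
    have k2 := abs_integral_sub_le hM.tame_eps (hf E₀) (hf E) (hf E₀)
      (fun x hx => h1 E₀ x (by simp) hx) (fun x hx => h2 E x hE hx) hL
    have e : ∫ x in (0 : ℝ)..1, ε x • (f E₀ x * f E x) =
        ∫ x in (0 : ℝ)..1, ε x • (f E x * f E₀ x) := by simp only [mul_comm]
    rw [e] at k2
    exact (norm_sub_le_norm_sub_add_norm_sub _ _ _).trans (add_le_add k1 k2)
  exact ⟨key F.ψ₁ (fun E => (F.sol₁ E).cont) (fun E x hE hx => (hC E x hE hx).1)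
    (fun E x hE hx => (hC E x hE hx).2.2.1), key F.ψ₂ (fun E => (F.sol₂ E).cont)
    (fun E x hE hx => (hC E x hE hx).2.1) (fun E x hE hx => (hC E x hE hx).2.2.2)⟩

include hS

/-- The limits of the weights at a band edge. -/
theorem exists_tendsto_weight {E₀ : ℝ} (h0 : F.b E₀ * F.c E₀ = 0) :
    ∃ β γ : ℝ, Tendsto F.weight₁ (𝓝[≠] E₀) (𝓝 β) ∧ Tendsto F.weight₂ (𝓝[≠] E₀) (𝓝 γ) ∧
      β * γ * F.G E₀ = 0 ∧
      (F.b E₀ = 0 → F.c E₀ ≠ 0 → β ^ 2 * F.A E₀ - γ ^ 2 * F.B E₀ < 0) ∧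
      (F.b E₀ ≠ 0 → 0 < β ^ 2 * F.A E₀ - γ ^ 2 * F.B E₀) ∧
      (F.b E₀ = 0 → F.c E₀ = 0 → β ^ 2 * F.A E₀ - γ ^ 2 * F.B E₀ = 0) := by
  have H := F.hillSystem hM hS
  have hA := F.A_pos hM E₀
  have hB := F.B_pos hM E₀
  obtain ⟨cA, cB⟩ := F.continuousAt_A_B hM E₀
  have cb := H.continuous_b.continuousAt (x := E₀)
  have cc := H.continuous_c.continuousAt (x := E₀)
  have cD : ContinuousAt (fun E => |F.b E| * F.A E + |F.c E| * F.B E) E₀ :=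
    (cb.abs.mul cA).add (cc.abs.mul cB)
  -- At a double eigenvalue numerator and denominator of the weights both vanish to first order;
  -- dividing by `|E - E₀|` turns them into slopes with nonzero limits. At a simple edge the weights
  -- are continuous.
  by_cases hd : F.b E₀ = 0 ∧ F.c E₀ = 0
  · obtain ⟨hb, hc⟩ := hd
    have ha : |F.a E₀| = 1 := by
      have := F.det hM hS E₀
      rw [hb, zero_mul, sub_zero] at this
      simpa using (sq_eq_sq_iff_abs_eq_abs (F.a E₀) 1).1 (by simpa using this)
    have sb := (hasDerivAt_iff_tendsto_slope.1 (H.deriv_b E₀)).abs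
    have sc := (hasDerivAt_iff_tendsto_slope.1 (H.deriv_c E₀)).abs
    rw [hb, zero_mul, sub_zero, abs_mul, ha, one_mul, abs_of_pos hB] at sb
    rw [hc, zero_mul, zero_sub, abs_neg, abs_mul, ha, one_mul, abs_of_pos hA] at sc
    have tA : Tendsto F.A (𝓝[≠] E₀) (𝓝 (F.A E₀)) := cA.mono_left nhdsWithin_le_nhds
    have tB : Tendsto F.B (𝓝[≠] E₀) (𝓝 (F.B E₀)) := cB.mono_left nhdsWithin_le_nhds
    have hDpos : 0 < F.B E₀ * F.A E₀ + F.A E₀ * F.B E₀ := by positivity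
    have sD := (sb.mul tA).add (sc.mul tB)
    have eD : ∀ E ∈ ({E₀}ᶜ : Set ℝ), ∀ f : ℝ → ℝ, f E₀ = 0 →
        |slope f E₀ E| / (|slope F.b E₀ E| * F.A E + |slope F.c E₀ E| * F.B E) =
          |f E| / (|F.b E| * F.A E + |F.c E| * F.B E) := fun E hE f hf => by
      have hne : |E - E₀| ≠ 0 := abs_ne_zero.2 (sub_ne_zero.2 hE)
      rw [slope_def_field, slope_def_field, slope_def_field, hf, hb, hc, sub_zero, sub_zero,
        sub_zero, abs_div, abs_div, abs_div]
      rw [div_mul_eq_mul_div, div_mul_eq_mul_div, ← add_div, div_div_div_cancel_right₀ hne]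
    refine ⟨_, _, ((sb.div sD hDpos.ne').sqrt).congr' ?_, ((sc.div sD hDpos.ne').sqrt).congr' ?_,
      ?_, fun _ h => absurd hc h, fun h => absurd hb h, fun _ _ => ?_⟩
    · filter_upwards [self_mem_nhdsWithin] with E hE
      exact congrArg Real.sqrt (eD E hE F.b hb)
    · filter_upwards [self_mem_nhdsWithin] with E hE
      exact congrArg Real.sqrt (eD E hE F.c hc)
    · have h1 := F.two_mul_a_mul_G hM hS E₀
      rw [hb, hc, zero_mul, zero_mul, add_zero] at h1
      have ha0 : 2 * F.a E₀ ≠ 0 := by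
        refine mul_ne_zero two_ne_zero fun h => ?_
        rw [h, abs_zero] at ha; exact zero_ne_one ha
      rw [(mul_eq_zero.1 h1).resolve_left ha0, mul_zero]
    · rw [Real.sq_sqrt (by positivity), Real.sq_sqrt (by positivity)]
      ring
  · have hDpos : 0 < |F.b E₀| * F.A E₀ + |F.c E₀| * F.B E₀ := by
      by_cases hb : F.b E₀ = 0
      · have hc : F.c E₀ ≠ 0 := fun hc => hd ⟨hb, hc⟩
        have := mul_pos (abs_pos.2 hc) hB
        have := mul_nonneg (abs_nonneg (F.b E₀)) hA.le
        linarith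
      · have := mul_pos (abs_pos.2 hb) hA
        have := mul_nonneg (abs_nonneg (F.c E₀)) hB.le
        linarith
    refine ⟨F.weight₁ E₀, F.weight₂ E₀,
      ((cb.abs.div cD hDpos.ne').sqrt).mono_left nhdsWithin_le_nhds,
      ((cc.abs.div cD hDpos.ne').sqrt).mono_left nhdsWithin_le_nhds, ?_, fun hb hc => ?_,
      fun hb => ?_, fun hb hc => absurd ⟨hb, hc⟩ hd⟩
    · unfold weight₁ weight₂
      rcases mul_eq_zero.1 h0 with h | h <;> simp [h]
    · unfold weight₁ weight₂
      rw [Real.sq_sqrt (by positivity), Real.sq_sqrt (by positivity), hb]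
      have := mul_pos (div_pos (abs_pos.2 hc) (hb ▸ hDpos)) hB
      simp only [abs_zero, zero_div, zero_mul] at this ⊢
      linarith
    · have hc : F.c E₀ = 0 := (mul_eq_zero.1 h0).resolve_left hb
      unfold weight₁ weight₂
      rw [Real.sq_sqrt (by positivity), Real.sq_sqrt (by positivity), hc]
      have := mul_pos (div_pos (abs_pos.2 hb) (hc ▸ hDpos)) hA
      simp only [abs_zero, zero_div, zero_mul] at this ⊢
      linarith

omit hS in
theorem phi_eq (j : ℕ) (k x : ℝ) : phi ε μ j k x =
    F.comb (bandE ε μ j k) (F.b (bandE ε μ j k))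
      (Complex.exp (Complex.I * k) - F.a (bandE ε μ j k)) x := by
  rw [phi, F.psi1_eq hM.tame_eps hM.tame_mu, F.psi2_eq hM.tame_eps hM.tame_mu]
  rfl

theorem comb_neg (E : ℝ) (X Y : ℂ) (x : ℝ) : F.comb E X Y (-x) = F.comb E X (-Y) x := by
  rw [comb, comb, (F.reflect₁ hM hS E x).1, (F.reflect₂ hM hS E x).1]
  push_cast; ring

variable {N : ℕ} {p q : ℕ → ℝ} (P : BandEdges F.a N p q)
include P

theorem phi_shift {n : ℕ} (hn : n < N) {k : ℝ} (hk : k ∈ Set.Ioo 0 Real.pi) (x : ℝ) :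
    phi ε μ (n + 1) k (x + 1) = Complex.exp (Complex.I * k) * phi ε μ (n + 1) k x := by
  have hs : Real.sin k ≠ 0 := (Real.sin_pos_of_pos_of_lt_pi hk.1 hk.2).ne'
  have hE := F.bandE_mem_Ioo hM hS P hn hs
  have hb : F.b (bandE ε μ (n + 1) k) ≠ 0 := fun h => by
    have := ((F.hillSystem hM hS).band_sign P hn hE).1
    rw [h, mul_zero] at this; exact lt_irrefl _ this
  have := F.isBlochMode_bandMode hM hS 0 (F.bandE_spec hM hS P hn k).2
  rw [bandMode, if_neg hb] at this
  rw [F.phi_eq hM, F.phi_eq hM]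
  exact this.2.2 x

/-- On the band `b` has sign `(-1)^n` and `e^{ik} - a = i sin k` with `sin k = √|b| √|c|`. The
common factor `√|b|` cancels in the normalization, leaving a form whose limits at the edges exist
even where `b` vanishes. -/
theorem blochMode_eq {n : ℕ} (hn : n < N) {k : ℝ} (hk : k ∈ Set.Ioo 0 Real.pi) (x : ℝ) :
    blochMode ε μ (n + 1) k x = F.comb (bandE ε μ (n + 1) k)
      ((((-1) ^ n * F.weight₁ (bandE ε μ (n + 1) k) : ℝ)) : ℂ)
      (Complex.I * F.weight₂ (bandE ε μ (n + 1) k)) x := by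
  have hs := Real.sin_pos_of_pos_of_lt_pi hk.1 hk.2
  have hE := F.bandE_mem_Ioo hM hS P hn hs.ne'
  have hφ := F.phi_eq hM (n + 1) k
  have ha := (F.bandE_spec hM hS P hn k).2
  have hsgn := (F.hillSystem hM hS).band_sign P hn hE
  have hneg := (F.hillSystem hM hS).mul_neg (P.band n hn _ hE)
  have hdet := F.det hM hS (bandE ε μ (n + 1) k)
  set E := bandE ε μ (n + 1) k
  have hA := F.A_pos hM E
  have hB := F.B_pos hM E
  have hb0 : F.b E ≠ 0 := fun h => by rw [h, zero_mul] at hneg; exact lt_irrefl _ hneg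
  have hbabs : F.b E = (-1) ^ n * |F.b E| := by
    rcases neg_one_pow_eq_or ℝ n with h | h <;> rw [h] at hsgn ⊢
    · rw [abs_of_pos (by linarith)]; ring
    · rw [abs_of_neg (by linarith)]; ring
  have hsin : Real.sin k = Real.sqrt |F.b E| * Real.sqrt |F.c E| := by
    rw [← Real.sqrt_mul (abs_nonneg _), ← abs_mul, abs_of_neg hneg, Real.sin_eq_sqrt_one_sub_cos_sq
      hk.1.le hk.2.le, ← ha]
    congr 1; linarith
  have hz : Complex.exp (Complex.I * k) - F.a E = Complex.I * (Real.sin k : ℝ) := by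
    rw [exp_I_mul_eq, ha]; ring
  have hsb : 0 < Real.sqrt |F.b E| := Real.sqrt_pos.2 (abs_pos.2 hb0)
  have hD : 0 < |F.b E| * F.A E + |F.c E| * F.B E := by
    have := mul_pos (abs_pos.2 hb0) hA
    have := mul_nonneg (abs_nonneg (F.c E)) hB.le
    linarith
  have hnorm : normX ε (phi ε μ (n + 1) k) =
      Real.sqrt |F.b E| * Real.sqrt (|F.b E| * F.A E + |F.c E| * F.B E) := by
    rw [show phi ε μ (n + 1) k = F.comb E (F.b E : ℝ) (Complex.I * (Real.sin k : ℝ)) from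
      funext fun y => by rw [hφ, hz], F.norm_comb hM, ← Real.sqrt_mul (abs_nonneg _), hsin, mul_pow,
      Real.sq_sqrt (abs_nonneg _), Real.sq_sqrt (abs_nonneg _), ← sq_abs (F.b E)]
    congr 1; ring
  have hS' : 0 < Real.sqrt (|F.b E| * F.A E + |F.c E| * F.B E) := Real.sqrt_pos.2 hD
  have e1 : F.b E / (Real.sqrt |F.b E| * Real.sqrt (|F.b E| * F.A E + |F.c E| * F.B E)) =
      (-1) ^ n * F.weight₁ E := by
    rw [weight₁, Real.sqrt_div (abs_nonneg _)]
    nth_rewrite 1 [hbabs]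
    nth_rewrite 1 [← Real.mul_self_sqrt (abs_nonneg (F.b E))]
    field_simp
  have e2 : Real.sin k / (Real.sqrt |F.b E| * Real.sqrt (|F.b E| * F.A E + |F.c E| * F.B E)) =
      F.weight₂ E := by
    rw [weight₂, Real.sqrt_div (abs_nonneg _), hsin]
    field_simp
  rw [blochMode, if_pos hk.1, hnorm, hφ, hz, ← e1, ← e2]
  simp only [comb]
  push_cast
  ring

end FundamentalSystem

/-- `-1` at a simple band edge with an odd mode, and `1` otherwise. -/
def edgeSign (b c : ℝ → ℝ) (E : ℝ) : ℝ := if b E = 0 ∧ c E ≠ 0 then -1 else 1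

theorem blochMode_neg (ε μ : ℝ → ℝ) (j : ℕ) {k : ℝ} (hk : 0 < k) (x : ℝ) :
    blochMode ε μ j (-k) x = blochMode ε μ j k (-x) := by
  unfold blochMode
  rw [if_neg (by linarith), if_pos hk, neg_neg]

theorem periodicPart_neg (ε μ : ℝ → ℝ) (j : ℕ) {k : ℝ} (hk : 0 < k) (x : ℝ) :
    periodicPart ε μ j (-k) x = periodicPart ε μ j k (-x) := by
  unfold periodicPart
  rw [blochMode_neg ε μ j hk]
  congr 2
  push_cast; ring

theorem log_im_of_pos {r : ℝ} (h : 0 < r) : (Complex.log (r : ℂ)).im = 0 := by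
  rw [Complex.log_im, Complex.arg_ofReal_of_nonneg h.le]

theorem log_im_of_neg {r : ℝ} (h : r < 0) : (Complex.log (r : ℂ)).im = Real.pi := by
  rw [Complex.log_im, Complex.arg_ofReal_of_neg h]

namespace FundamentalSystem

variable {ε μ : ℝ → ℝ} (F : FundamentalSystem ε μ)
variable (hM : IsPeriodicMedium ε μ) (hS : IsInversionSymmetric ε μ)
variable {N : ℕ} {p q : ℕ → ℝ} (P : BandEdges F.a N p q)
include hM hS P

theorem periodicPart_shift {n : ℕ} (hn : n < N) {k : ℝ} (hk : k ∈ Set.Ioo 0 Real.pi) (x : ℝ) :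
    periodicPart ε μ (n + 1) k (x + 1) = periodicPart ε μ (n + 1) k x := by
  simp only [periodicPart, blochMode, if_pos hk.1]
  rw [F.phi_shift hM hS P hn hk]
  have : Complex.exp (Complex.I * k) * Complex.exp (-(Complex.I * k * ((x + 1 : ℝ) : ℂ))) =
      Complex.exp (-(Complex.I * k * x)) := by
    rw [← Complex.exp_add]; congr 1; push_cast; ring
  rw [← this]; ring

/-- The mode at `-k` is the mirror image of the mode at `k`, so the derivative in `k` changes sign;
evenness of `ε` and periodicity move the integral back to `[0, 1]`. No differentiability or
integrability is needed for these identities. -/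
theorem berry_neg {n : ℕ} (hn : n < N) {k : ℝ} (hk : k ∈ Set.Ioo 0 Real.pi) :
    berry ε μ (n + 1) (-k) = -berry ε μ (n + 1) k := by
  set u : ℝ → ℂ := periodicPart ε μ (n + 1) k with hu
  set u' : ℝ → ℂ := fun x => deriv (fun κ => periodicPart ε μ (n + 1) κ x) k with hu'
  have hd : ∀ x, deriv (fun κ => periodicPart ε μ (n + 1) κ x) (-k) = -u' (-x) := fun x => by
    have hev : (fun κ => periodicPart ε μ (n + 1) κ x) =ᶠ[𝓝 (-k)]
        fun κ => (fun κ' => periodicPart ε μ (n + 1) κ' (-x)) (-κ) := by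
      filter_upwards [Iio_mem_nhds (neg_lt_zero.2 hk.1)] with κ hκ
      have := periodicPart_neg ε μ (n + 1) (neg_pos.2 hκ) x
      rwa [neg_neg] at this
    rw [hev.deriv_eq, deriv_comp_neg (fun κ' => periodicPart ε μ (n + 1) κ' (-x)), neg_neg]
  have hper : Function.Periodic (fun x => (ε x : ℂ) * u' x * starRingEnd ℂ (u x)) 1 := fun x => by
    have h1 : u' (x + 1) = u' x := by
      refine Filter.EventuallyEq.deriv_eq ?_
      filter_upwards [Ioo_mem_nhds hk.1 hk.2] with κ hκ
      exact F.periodicPart_shift hM hS P hn hκ x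
    simp only [hM.eps_per, h1, hu, F.periodicPart_shift hM hS P hn hk x]
  have hint := hper.intervalIntegral_add_eq (-1) 0
  rw [neg_add_cancel, zero_add] at hint
  calc berry ε μ (n + 1) (-k)
      = ∫ x in (0 : ℝ)..1, -((ε (-x) : ℂ) * u' (-x) * starRingEnd ℂ (u (-x))) := by
        unfold berry innerX
        refine intervalIntegral.integral_congr fun x _ => ?_
        simp only [hd, periodicPart_neg ε μ (n + 1) hk.1, hS.1, hu]
        ring
    _ = -∫ x in (-1 : ℝ)..0, (ε x : ℂ) * u' x * starRingEnd ℂ (u x) := by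
        rw [intervalIntegral.integral_neg, intervalIntegral.integral_comp_neg
          (fun x => (ε x : ℂ) * u' x * starRingEnd ℂ (u x)), neg_zero]
    _ = -berry ε μ (n + 1) k := by rw [hint]; rfl

theorem integral_berry {n : ℕ} (hn : n < N) :
    ∫ k in (-Real.pi)..0, berry ε μ (n + 1) k = -∫ k in (0 : ℝ)..Real.pi, berry ε μ (n + 1) k := by
  have h1 := intervalIntegral.integral_comp_neg (a := 0) (b := Real.pi)
    (fun k => berry ε μ (n + 1) k)
  rw [neg_zero] at h1
  rw [← h1, ← intervalIntegral.integral_neg]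
  exact intervalIntegral.integral_congr_Ioo_of_le Real.pi_pos.le fun k hk =>
    F.berry_neg hM hS P hn hk

/-- The overlaps of the limiting Bloch mode at a band edge with its mirror image. -/
theorem overlap {n : ℕ} (hn : n < N) {k₀ : ℝ} {l l' : Filter ℝ} [l.NeBot] [l'.NeBot]
    (hl : l ≤ 𝓝 k₀) (hl0 : ∀ᶠ k in l, k ∈ Set.Ioo 0 Real.pi) (hl' : Tendsto (fun k => -k) l' l)
    (hk₀ : Real.sin k₀ = 0) :
    ∃ r : ℝ, innerX ε (blochModeLim ε μ (n + 1) l) (blochModeLim ε μ (n + 1) l') = r ∧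
      innerX ε (blochModeLim ε μ (n + 1) l') (blochModeLim ε μ (n + 1) l) = r ∧
      (Complex.log (r : ℂ)).im =
        if edgeSign F.b F.c (bandE ε μ (n + 1) k₀) = -1 then Real.pi else 0 := by
  have hspec := F.bandE_spec hM hS P hn
  set E := bandE ε μ (n + 1) with hE
  set E₀ := E k₀ with hE₀
  have h0 : F.b E₀ * F.c E₀ = 0 := by
    have h1 := F.det hM hS E₀
    have h2 := Real.sin_sq_add_cos_sq k₀
    rw [(hspec k₀).2] at h1
    rw [hk₀] at h2
    linarith
  obtain ⟨β, γ, tβ, tγ, hG, hodd, heven, hdouble⟩ := F.exists_tendsto_weight hM hS h0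
  have tE : Tendsto E l (𝓝[≠] E₀) := by
    refine tendsto_nhdsWithin_iff.2 ⟨((F.continuous_bandE hM hS P hn).tendsto k₀).mono_left hl, ?_⟩
    filter_upwards [hl0] with k hk heq
    have h1 := F.bandE_mem_Ioo hM hS P hn (Real.sin_pos_of_pos_of_lt_pi hk.1 hk.2).ne'
    have h2 := (F.hillSystem hM hS).mul_neg (P.band n hn _ h1)
    have heq' : bandE ε μ (n + 1) k = E₀ := heq
    rw [heq', h0] at h2
    exact lt_irrefl _ h2
  set σ : ℝ := (-1) ^ n
  -- The parameter `s = ±1` treats the mode and its mirror image together. Limits on `[0, 1]`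
  -- suffice for the inner product.
  have lim : ∀ x ∈ Set.Icc (0 : ℝ) 1, ∀ s : ℂ, Tendsto (fun k => F.comb (E k)
      ((σ * F.weight₁ (E k) : ℝ) : ℂ) (s * (Complex.I * F.weight₂ (E k))) x) l
      (𝓝 (F.comb E₀ ((σ * β : ℝ) : ℂ) (s * (Complex.I * γ)) x)) := by
    intro x hx s
    obtain ⟨c1, c2⟩ := F.continuousAt_ψ hM hx E₀
    have t1 := (Complex.continuous_ofReal.tendsto _).comp
      ((c1.tendsto.mono_left nhdsWithin_le_nhds).comp tE)
    have t2 := (Complex.continuous_ofReal.tendsto _).comp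
      ((c2.tendsto.mono_left nhdsWithin_le_nhds).comp tE)
    have t3 := (Complex.continuous_ofReal.tendsto _).comp ((tβ.comp tE).const_mul σ)
    have t4 := (Complex.continuous_ofReal.tendsto _).comp (tγ.comp tE)
    exact (t3.mul t1).add (((t4.const_mul Complex.I).const_mul s).mul t2)
  have e1 : ∀ x ∈ Set.Icc (0 : ℝ) 1, blochModeLim ε μ (n + 1) l x =
      F.comb E₀ ((σ * β : ℝ) : ℂ) (Complex.I * γ) x := fun x hx => by
    refine Tendsto.limUnder_eq ?_
    have := lim x hx 1
    simp only [one_mul] at this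
    refine this.congr' ?_
    filter_upwards [hl0] with k hk
    exact (F.blochMode_eq hM hS P hn hk x).symm
  have e2 : ∀ x ∈ Set.Icc (0 : ℝ) 1, blochModeLim ε μ (n + 1) l' x =
      F.comb E₀ ((σ * β : ℝ) : ℂ) (-(Complex.I * γ)) x := fun x hx => by
    refine Tendsto.limUnder_eq ?_
    have := (lim x hx (-1)).comp hl'
    simp only [neg_one_mul] at this
    refine this.congr' ?_
    filter_upwards [hl'.eventually hl0] with k hk
    have h1 := blochMode_neg ε μ (n + 1) hk.1 x
    rw [neg_neg] at h1
    rw [h1, F.blochMode_eq hM hS P hn hk, F.comb_neg hM hS]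
    rfl
  have hI : ∀ u u' w w' : ℝ → ℂ, (∀ x ∈ Set.Icc (0 : ℝ) 1, u x = u' x) →
      (∀ x ∈ Set.Icc (0 : ℝ) 1, w x = w' x) → innerX ε u w = innerX ε u' w' := by
    intro u u' w w' h1 h2
    refine intervalIntegral.integral_congr fun x hx => ?_
    rw [Set.uIcc_of_le zero_le_one] at hx
    simp only [h1 x hx, h2 x hx]
  have hσ : (σ : ℂ) * σ = 1 := by
    rw [← Complex.ofReal_mul, neg_one_pow_mul_self_eq, Complex.ofReal_one]
  have hGc : (β : ℂ) * γ * F.G E₀ = 0 := by exact_mod_cast hG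
  -- This is the overlap of `(σ β, i γ)` with `(σ β, -i γ)`; the mixed terms drop out since `β γ G =
  -- 0`. It is positive for an even edge mode, negative for an odd one, and zero at a double
  -- eigenvalue, where `Complex.log 0 = 0` applies.
  refine ⟨β ^ 2 * F.A E₀ - γ ^ 2 * F.B E₀, ?_, ?_, ?_⟩
  · rw [hI _ _ _ _ e1 e2, F.inner_comb hM]
    simp only [map_mul, map_neg, Complex.conj_ofReal, Complex.conj_I]
    push_cast
    linear_combination (β ^ 2 * F.A E₀ : ℂ) * hσ + γ ^ 2 * F.B E₀ * Complex.I_sq +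
      2 * Complex.I * σ * hGc
  · rw [hI _ _ _ _ e2 e1, F.inner_comb hM]
    simp only [map_mul, Complex.conj_ofReal, Complex.conj_I]
    push_cast
    linear_combination (β ^ 2 * F.A E₀ : ℂ) * hσ + γ ^ 2 * F.B E₀ * Complex.I_sq -
      2 * Complex.I * σ * hGc
  · unfold edgeSign
    by_cases hb : F.b E₀ = 0
    · by_cases hc : F.c E₀ = 0
      · rw [hdouble hb hc]; simp [hc]; norm_num
      · rw [log_im_of_neg (hodd hb hc)]; simp [hb, hc]
    · rw [log_im_of_pos (heven hb)]; simp [hb]; norm_num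

/-- The Berry integrals cancel, and each jump is `0` or `π` according to the parity of an edge mode.
-/
theorem exp_zakPhase {n : ℕ} (hn : n < N) : Complex.exp (Complex.I * zakPhase ε μ (n + 1)) =
    edgeSign F.b F.c (p n) * edgeSign F.b F.c (q n) := by
  have hpi := Real.pi_pos
  have n1 : Tendsto (fun k : ℝ => -k) (𝓝[<] 0) (𝓝[>] 0) := by
    simpa using tendsto_neg_nhdsLT (a := (0 : ℝ))
  have n2 : Tendsto (fun k : ℝ => -k) (𝓝[>] (-Real.pi)) (𝓝[<] Real.pi) := by
    simpa using tendsto_neg_nhdsGT (a := -Real.pi)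
  obtain ⟨r, hr, -, hr0⟩ := F.overlap hM hS P hn (k₀ := 0) (l := 𝓝[>] 0) (l' := 𝓝[<] 0)
    nhdsWithin_le_nhds (Ioo_mem_nhdsGT hpi) n1 Real.sin_zero
  obtain ⟨s, -, hs, hs0⟩ := F.overlap hM hS P hn (k₀ := Real.pi) (l := 𝓝[<] Real.pi)
    (l' := 𝓝[>] (-Real.pi)) nhdsWithin_le_nhds (Ioo_mem_nhdsLT hpi) n2 Real.sin_pi
  have hexp : ∀ E, Complex.exp (-(Complex.I *
      ((if edgeSign F.b F.c E = -1 then Real.pi else 0 : ℝ) : ℂ))) = edgeSign F.b F.c E := by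
    intro E
    unfold edgeSign
    split_ifs with h h1 h1
    · rw [mul_comm, Complex.exp_neg, Complex.exp_pi_mul_I]; push_cast; norm_num
    · exact absurd rfl h1
    · norm_num at h1
    · simp
  have hz : Complex.I * zakPhase ε μ (n + 1) =
      -(Complex.I * ((Complex.log (r : ℂ)).im : ℂ)) + -(Complex.I * ((Complex.log (s : ℂ)).im : ℂ)) := by
    rw [zakPhase, hr, hs, F.integral_berry hM hS P hn]; ring
  rw [hz, Complex.exp_add, hr0, hs0, hexp, hexp]
  -- For even `n` the lower edge sits at `k = 0` and the upper at `k = π`; for odd `n` they are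
  -- exchanged.
  rcases Nat.even_or_odd n with h | h
  · rw [F.bandE_edge_p hM hS P hn (k := 0) (by simp [h.neg_one_pow]),
      F.bandE_edge_q hM hS P hn (k := Real.pi) (by simp [pow_succ, h.neg_one_pow])]
  · rw [F.bandE_edge_q hM hS P hn (k := 0) (by simp [pow_succ, h.neg_one_pow]),
      F.bandE_edge_p hM hS P hn (k := Real.pi) (by simp [h.neg_one_pow]), mul_comm]

end FundamentalSystem

/-! ### Dirac points and evaluation of the bulk index -/

theorem abs_sin_sub_le {t : ℝ} (ht : |t| ≤ 1) : |(|Real.sin t| - |t|)| ≤ t ^ 2 := by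
  have h1 := Real.sin_bound ht
  refine (abs_abs_sub_abs_le _ _).trans ?_
  have h2 : |Real.sin t - t| ≤ |Real.sin t - (t - t ^ 3 / 6)| + |t ^ 3 / 6| := by
    have : Real.sin t - t = (Real.sin t - (t - t ^ 3 / 6)) + -(t ^ 3 / 6) := by ring
    rw [this]
    refine (abs_add_le _ _).trans ?_
    rw [abs_neg]
  have h3 : |t ^ 3 / 6| = |t| ^ 3 / 6 := by rw [abs_div, abs_pow]; norm_num
  have h4 : |t| ^ 3 ≤ |t| ^ 2 := pow_le_pow_of_le_one (abs_nonneg _) ht (by norm_num)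
  have h5 : |t| ^ 4 ≤ |t| ^ 2 := pow_le_pow_of_le_one (abs_nonneg _) ht (by norm_num)
  rw [← sq_abs t]
  nlinarith [sq_nonneg |t|]

theorem abs_sin_add_of_sin_eq_zero {k₀ : ℝ} (h : Real.sin k₀ = 0) (κ : ℝ) :
    |Real.sin κ| = |Real.sin (κ - k₀)| := by
  have h1 := Real.sin_sq_add_cos_sq k₀
  rw [h] at h1
  have hc : |Real.cos k₀| = 1 := by
    simpa using (sq_eq_sq_iff_abs_eq_abs (Real.cos k₀) 1).1 (by linarith)
  rw [Real.sin_sub, h, mul_zero, sub_zero, abs_mul, hc, mul_one]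

/-- Comparison of `h ≥ 0` and `s ≥ 0` with `s² = w² h² + O(h³)`. -/
theorem abs_sub_div_le {s h w C : ℝ} (hs : 0 ≤ s) (hh : 0 ≤ h) (hw : 0 < w) (hC : 0 ≤ C)
    (key : |s ^ 2 - w ^ 2 * h ^ 2| ≤ C * h ^ 3) (hsmall : 2 * C * h ≤ w ^ 2) :
    |h - s / w| ≤ 4 * C / w ^ 4 * s ^ 2 := by
  have h1 : |s - w * h| * w ≤ C * h ^ 2 := by
    rcases hh.eq_or_lt with rfl | hpos
    · have : s ^ 2 ≤ 0 := by simpa using key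
      have : s = 0 := pow_eq_zero_iff two_ne_zero |>.1 (le_antisymm this (sq_nonneg _))
      simp [this]
    · have e : |s ^ 2 - w ^ 2 * h ^ 2| = |s - w * h| * (s + w * h) := by
        rw [← abs_of_nonneg (a := s + w * h) (by positivity), ← abs_mul]
        congr 1; ring
      have h2 : |s - w * h| * (w * h) ≤ C * h ^ 2 * h := by
        calc |s - w * h| * (w * h) ≤ |s - w * h| * (s + w * h) :=
              mul_le_mul_of_nonneg_left (by linarith) (abs_nonneg _)
          _ ≤ C * h ^ 3 := e ▸ key
          _ = _ := by ring
      rw [← mul_assoc] at h2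
      exact le_of_mul_le_mul_right h2 hpos
  have h2 : w * h ≤ 2 * s := by
    have h3 : |s - w * h| * w ≤ (w * h / 2) * w := by nlinarith
    have h4 := le_of_mul_le_mul_right h3 hw
    linarith [(abs_le.1 h4).1]
  have h3 : |h - s / w| = |s - w * h| / w := by
    rw [← abs_of_pos hw, ← abs_div, abs_of_pos hw, abs_sub_comm]
    congr 1; field_simp
  rw [h3, div_le_iff₀ hw, ← mul_le_mul_iff_left₀ hw]
  refine h1.trans ?_
  have h4 : (w * h) ^ 2 ≤ (2 * s) ^ 2 := pow_le_pow_left₀ (by positivity) h2 2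
  have h5 : 4 * C / w ^ 4 * s ^ 2 * w * w = C * (2 * s) ^ 2 / w ^ 2 := by
    field_simp; ring
  rw [h5, le_div_iff₀ (by positivity)]
  nlinarith

namespace FundamentalSystem

variable {ε μ : ℝ → ℝ} (F : FundamentalSystem ε μ)
variable (hM : IsPeriodicMedium ε μ) (hS : IsInversionSymmetric ε μ)
include hM hS

/-- The conical shape of the dispersion relation at a double eigenvalue. -/
theorem cone_isBigO {E : ℝ → ℝ} {k₀ : ℝ} (hE : ContinuousAt E k₀)
    (ha : ∀ κ, F.a (E κ) = Real.cos κ) (hb : F.b (E k₀) = 0) (hc : F.c (E k₀) = 0) :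
    (fun κ => |E κ - E k₀| - (Real.sqrt (F.A (E k₀) * F.B (E k₀)))⁻¹ * |κ - k₀|) =O[𝓝 k₀]
      fun κ => (κ - k₀) ^ 2 := by
  set E₀ := E k₀ with hE₀
  obtain ⟨C, hC⟩ := F.exists_expansion hM hS E₀
  have hA := F.A_pos hM E₀
  have hB := F.B_pos hM E₀
  have hdet := F.det hM hS E₀
  rw [hb, zero_mul, sub_zero] at hdet
  have hsin : Real.sin k₀ = 0 := by
    have h1 := Real.sin_sq_add_cos_sq k₀
    rw [← ha k₀, ← hE₀, hdet] at h1
    exact pow_eq_zero_iff two_ne_zero |>.1 (by linarith)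
  set w := Real.sqrt (F.A E₀ * F.B E₀) with hw
  have hw0 : 0 < w := Real.sqrt_pos.2 (mul_pos hA hB)
  have hw2 : w ^ 2 = F.A E₀ * F.B E₀ := Real.sq_sqrt (mul_pos hA hB).le
  have hC0 : 0 ≤ C := by
    have := (hC (E₀ + 1) (by simp)).1
    simpa using (abs_nonneg _).trans this
  have ha1 : |F.a E₀| = 1 := by
    simpa using (sq_eq_sq_iff_abs_eq_abs (F.a E₀) 1).1 (by linarith)
  set D := C * (F.A E₀ + F.B E₀) + C ^ 2 with hD
  have hD0 : 0 ≤ D := by positivity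
  have hev : ∀ᶠ κ in 𝓝 k₀, |E κ - E₀| < min 1 (w ^ 2 / (2 * D + 1)) := by
    have h1 : Tendsto (fun κ => |E κ - E₀|) (𝓝 k₀) (𝓝 0) := by
      have h2 : ContinuousAt (fun κ => |E κ - E₀|) k₀ := (hE.sub continuousAt_const).abs
      have h3 := h2.tendsto
      rwa [← hE₀, sub_self, abs_zero] at h3
    exact h1.eventually_lt_const (lt_min one_pos (by positivity))
  have hev2 : ∀ᶠ κ in 𝓝 k₀, |κ - k₀| ≤ 1 := Metric.closedBall_mem_nhds k₀ one_pos
  refine IsBigO.of_bound (4 * D / w ^ 4 + w⁻¹) ?_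
  filter_upwards [hev, hev2] with κ h1 h2
  obtain ⟨e1, e2, -, -⟩ := hC (E κ) (h1.le.trans (min_le_left _ _))
  rw [hb, zero_mul, sub_zero, sub_zero] at e1
  rw [hc, zero_mul, zero_sub, sub_zero] at e2
  -- Inserting the first order expansions of `b` and `c` gives `sin² κ = A B h² + O(|h|³)`, whose
  -- square root is the cone of slope `1 / √(A B)`.
  have hs2 : Real.sin κ ^ 2 = -(F.b (E κ) * F.c (E κ)) := by
    have := F.det hM hS (E κ)
    rw [ha κ] at this
    linarith [Real.sin_sq_add_cos_sq κ]
  set h := E κ - E₀ with hh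
  set r₁ := F.b (E κ) - h * (F.a E₀ * F.B E₀) with hr₁
  set r₂ := F.c (E κ) - h * -(F.a E₀ * F.A E₀) with hr₂
  have key : |Real.sin κ ^ 2 - w ^ 2 * h ^ 2| ≤ D * |h| ^ 3 := by
    have e : Real.sin κ ^ 2 - w ^ 2 * h ^ 2 =
        h * F.a E₀ * (F.A E₀ * r₁ - F.B E₀ * r₂) - r₁ * r₂ := by
      rw [hs2, hw2, hr₁, hr₂]
      linear_combination (h ^ 2 * F.A E₀ * F.B E₀) * hdet
    rw [e]
    have hh1 : |h| ≤ 1 := h1.le.trans (min_le_left _ _)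
    have t1 : |h * F.a E₀ * (F.A E₀ * r₁ - F.B E₀ * r₂)| ≤
        |h| * (F.A E₀ * (C * h ^ 2) + F.B E₀ * (C * h ^ 2)) := by
      rw [abs_mul, abs_mul, ha1, mul_one]
      refine mul_le_mul_of_nonneg_left ((abs_sub _ _).trans ?_) (abs_nonneg _)
      rw [abs_mul, abs_mul, abs_of_pos hA, abs_of_pos hB]
      gcongr
    have t2 : |r₁ * r₂| ≤ C * h ^ 2 * (C * h ^ 2) := by
      rw [abs_mul]
      exact mul_le_mul e1 e2 (abs_nonneg _) (by positivity)
    refine (abs_sub _ _).trans ((add_le_add t1 t2).trans ?_)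
    rw [← sq_abs h, hD]
    have : |h| ^ 4 ≤ |h| ^ 3 := pow_le_pow_of_le_one (abs_nonneg _) hh1 (by norm_num)
    nlinarith [mul_le_mul_of_nonneg_left this (sq_nonneg C)]
  have hsmall : 2 * D * |h| ≤ w ^ 2 := by
    have h3 := h1.le.trans (min_le_right _ _)
    rw [le_div_iff₀ (by positivity)] at h3
    nlinarith [abs_nonneg h]
  rw [← sq_abs (Real.sin κ), ← sq_abs h] at key
  have main := abs_sub_div_le (abs_nonneg _) (abs_nonneg h) hw0 hD0 key hsmall
  rw [abs_sin_add_of_sin_eq_zero hsin] at main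
  have hs := abs_sin_sub_le h2
  have hle : |Real.sin (κ - k₀)| ^ 2 ≤ (κ - k₀) ^ 2 := by
    rw [← sq_abs (κ - k₀)]
    exact pow_le_pow_left₀ (abs_nonneg _) Real.abs_sin_le_abs 2
  rw [Real.norm_eq_abs, Real.norm_eq_abs, abs_of_nonneg (sq_nonneg (κ - k₀))]
  have e : |h| - w⁻¹ * |κ - k₀| = (|h| - |Real.sin (κ - k₀)| / w) +
      w⁻¹ * (|Real.sin (κ - k₀)| - |κ - k₀|) := by
    field_simp; ring
  rw [e, add_mul]
  refine (abs_add_le _ _).trans (add_le_add (main.trans ?_) ?_)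
  · exact mul_le_mul_of_nonneg_left hle (by positivity)
  · rw [abs_mul, abs_of_pos (inv_pos.2 hw0)]
    exact mul_le_mul_of_nonneg_left hs (inv_pos.2 hw0).le

/-- Double eigenvalues have a two-dimensional space of Bloch modes, and conversely. -/
theorem finrank_span_eq_two {k E : ℝ} (hb : F.b E = 0) (hc : F.c E = 0)
    (ha : F.a E = Real.cos k) :
    Module.finrank ℂ (Submodule.span ℂ {ψ : ℝ → ℂ | IsBlochMode ε μ k E ψ}) = 2 := by
  have hz := F.exp_eq_of_mul_eq_zero hM hS ha (by rw [hb, zero_mul])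
  have hbl : ∀ X Y : ℂ, X ≠ 0 ∨ Y ≠ 0 → IsBlochMode ε μ k E (F.comb E X Y) := fun X Y h =>
    F.isBlochMode_comb hM hS h (by rw [hz, hb]; simp) (by rw [hz, hc]; simp)
  have hspan : Submodule.span ℂ {ψ : ℝ → ℂ | IsBlochMode ε μ k E ψ} =
      Submodule.span ℂ (Set.range ![F.comb E 1 0, F.comb E 0 1]) := by
    refine le_antisymm (Submodule.span_le.2 fun ψ hψ => ?_) (Submodule.span_mono ?_)
    · exact F.mem_span_of_double hM hS hψ ⟨0, rfl⟩ ⟨1, rfl⟩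
    · rintro _ ⟨i, rfl⟩
      fin_cases i
      · exact hbl 1 0 (Or.inl one_ne_zero)
      · exact hbl 0 1 (Or.inr one_ne_zero)
  have hli : LinearIndependent ℂ ![F.comb E 1 0, F.comb E 0 1] := by
    rw [LinearIndependent.pair_iff]
    intro s t hst
    by_contra hne
    have hor : s ≠ 0 ∨ t ≠ 0 := by
      by_contra! h
      exact hne h
    refine (hbl s t hor).1 ?_
    rw [← hst]
    funext x; simp [comb]
  rw [hspan, finrank_span_eq_card hli]
  simp

theorem double_of_finrank {k E : ℝ}
    (h : Module.finrank ℂ (Submodule.span ℂ {ψ : ℝ → ℂ | IsBlochMode ε μ k E ψ}) = 2) :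
    F.b E = 0 ∧ F.c E = 0 ∧ F.a E = Real.cos k ∧ 0 ≤ E := by
  have hne : ∃ ψ, IsBlochMode ε μ k E ψ := by
    by_contra! hn
    have : {ψ : ℝ → ℂ | IsBlochMode ε μ k E ψ} = ∅ := Set.eq_empty_of_forall_notMem hn
    rw [this, Submodule.span_empty, finrank_bot] at h
    exact absurd h (by norm_num)
  obtain ⟨ψ, hψ⟩ := hne
  have hd : F.b E = 0 ∧ F.c E = 0 := by
    by_contra h0
    have hle : Submodule.span ℂ {ψ : ℝ → ℂ | IsBlochMode ε μ k E ψ} ≤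
        Submodule.span ℂ {F.bandMode 0 k E} :=
      Submodule.span_le.2 fun φ hφ => F.mem_span_of_simple hM hS 0 hφ h0
    have h1 := Submodule.finrank_mono hle
    have h2 := (finrank_span_le_card (R := ℂ) ({F.bandMode 0 k E} : Set (ℝ → ℂ)))
    simp only [Set.toFinset_singleton, Finset.card_singleton] at h2
    lia
  exact ⟨hd.1, hd.2, hψ.a_eq_cos F hM hS, hψ.energy_nonneg hM hS⟩

variable {N : ℕ} {p q : ℕ → ℝ} (P : BandEdges F.a N p q)
include P

theorem isDiracPoint_of_closed {n : ℕ} (hn : n + 1 < N) (hcl : q n = p (n + 1)) :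
    IsDiracPoint ε μ (edgeWavenumber (n + 1)) (p (n + 1)) := by
  have hn' : n < N := (Nat.lt_succ_self n).trans hn
  obtain ⟨hb, hc⟩ := ((F.hillSystem hM hS).closed_iff P hn).1 hcl
  have hcos := cos_edgeWavenumber (n + 1)
  have e1 := F.bandE_edge_q hM hS P hn' hcos
  have e2 := F.bandE_edge_p hM hS P hn hcos
  rw [hcl] at e1 hb hc
  have hAB := mul_pos (F.A_pos hM (p (n + 1))) (F.B_pos hM (p (n + 1)))
  have s1 := F.bandE_spec hM hS P hn'
  have s2 := F.bandE_spec hM hS P hn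
  have c1 := F.cone_isBigO hM hS (F.continuous_bandE hM hS P hn').continuousAt
    (fun κ => (s1 κ).2) (by rw [e1]; exact hb) (by rw [e1]; exact hc)
  have c2 := F.cone_isBigO hM hS (F.continuous_bandE hM hS P hn).continuousAt
    (fun κ => (s2 κ).2) (by rw [e2]; exact hb) (by rw [e2]; exact hc)
  rw [e1] at c1
  rw [e2] at c2
  refine ⟨⟨n + 1, by lia, e1, e2, _, inv_pos.2 (Real.sqrt_pos.2 hAB), ?_, ?_⟩,
    F.finrank_span_eq_two hM hS hb hc (by rw [P.a_p _ hn, hcos])⟩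
  · refine c1.neg_left.congr_left fun κ => ?_
    have := (s1 κ).1.2
    rw [hcl] at this
    rw [abs_of_nonpos (by linarith)]
    ring
  · refine c2.congr_left fun κ => ?_
    have := (s2 κ).1.1
    rw [abs_of_nonneg (by linarith)]
    ring

-- A two-dimensional eigenspace forces `b = c = 0`, which happens only where consecutive bands
-- touch. Conversely every touching is conical. The energy and `cos k` determine the wavenumber in
-- `[0, π]`, so touchings are counted once.
open Classical in
theorem diracCount_eq {M : ℕ} (hMN : M < N) :
    diracCount ε μ (M + 1) = ((Finset.range M).filter fun n => q n = p (n + 1)).card := by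
  have H := F.hillSystem hM hS
  have himg : {x : ℝ × ℝ | x.1 ∈ Set.Icc 0 Real.pi ∧ IsDiracPoint ε μ x.1 x.2 ∧
      x.2 ≤ bandMin ε μ (M + 1)} = (fun n => (edgeWavenumber (n + 1), p (n + 1))) ''
        (((Finset.range M).filter fun n => q n = p (n + 1) : Finset ℕ) : Set ℕ) := by
    rw [F.bandMin_eq hM hS P hMN]
    ext ⟨k, E⟩
    simp only [Set.mem_ofPred_eq, Finset.coe_filter, Finset.mem_range, Set.mem_image, Prod.mk.injEq]
    constructor
    · rintro ⟨hk, hD, hE⟩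
      obtain ⟨hb, hc, ha, h0⟩ := F.double_of_finrank hM hS hD.2
      obtain ⟨i, hi, hmem⟩ := P.exists_band hMN h0 (hE.trans (P.lt M hMN).le)
        (by rw [ha]; exact Real.abs_cos_le_one k)
      have habs : ¬ |F.a E| < 1 := fun hlt => by
        have := H.mul_neg hlt
        rw [hb, zero_mul] at this
        exact lt_irrefl _ this
      have hex : ∃ n < M, q n = p (n + 1) ∧ E = p (n + 1) := by
        rcases (P.abs_lt_or_edge (by lia) hmem).resolve_left habs with h | h
        · obtain ⟨l, rfl, hl⟩ := F.exists_pred_of_double hM hS P (n := i) (by lia)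
            (h ▸ hb) (h ▸ hc)
          exact ⟨l, hi, hl, h⟩
        -- The top of band `M` lies strictly above the bound `p M` on the energy of the Dirac
        -- points.
        · have hiM : i < M := lt_of_le_of_ne hi fun h' => by
            subst h'
            have := P.lt i hMN
            linarith
          have hcl := (H.closed_iff P (by lia)).2 ⟨h ▸ hb, h ▸ hc⟩
          exact ⟨i, hiM, hcl, h.trans hcl⟩
      obtain ⟨n, hn, hcl, hEn⟩ := hex
      refine ⟨n, ⟨hn, hcl⟩, ?_, hEn.symm⟩
      refine Real.injOn_cos (edgeWavenumber_mem _) hk ?_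
      rw [cos_edgeWavenumber, ← ha, hEn, P.a_p _ (by lia)]
    · rintro ⟨n, ⟨hn, hcl⟩, rfl, rfl⟩
      refine ⟨edgeWavenumber_mem _, F.isDiracPoint_of_closed hM hS P (by lia) hcl, ?_⟩
      rcases (Nat.succ_le_of_lt hn).eq_or_lt with h | h
      · exact (congrArg p h).le
      · exact (P.p_lt_p h hMN).le
  rw [diracCount, himg, Set.InjOn.ncard_image, Set.ncard_coe_finset]
  intro i hi j hj hij
  simp only [Finset.coe_filter, Finset.mem_range, Set.mem_ofPred_eq] at hi hj
  have h2 := (Prod.mk.inj hij).2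
  by_contra hne
  rcases lt_or_gt_of_ne hne with h | h
  · exact (P.p_lt_p (i := i + 1) (j := j + 1) (by lia) (by lia)).ne h2
  · exact (P.p_lt_p (i := j + 1) (j := i + 1) (by lia) (by lia)).ne h2.symm

/-- The parities are regrouped by gaps instead of bands. The bottom of the spectrum is even and
contributes `1`, so only the topmost edge remains unpaired. -/
theorem exp_sum_zakPhase {M : ℕ} (hMN : M < N) :
    Complex.exp (Complex.I * ∑ m ∈ Finset.Icc 1 (M + 1), zakPhase ε μ m) =
      (∏ n ∈ Finset.range M, (edgeSign F.b F.c (q n) * edgeSign F.b F.c (p (n + 1)) : ℂ)) *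
        edgeSign F.b F.c (q M) := by
  induction M with
  | zero =>
    have h := F.exp_zakPhase hM hS P hMN
    have h0 : edgeSign F.b F.c (p 0) = 1 := by
      rw [P.zero, edgeSign, if_neg fun h => (F.at_zero hM).2.2.ne' h.1]
    rw [h0] at h
    simpa using h
  | succ M ih =>
    rw [Finset.sum_Icc_succ_top (by lia), mul_add, Complex.exp_add, ih (by lia),
      F.exp_zakPhase hM hS P hMN, Finset.prod_range_succ]
    ring

/-- The bulk index is the parity of the mode at the upper edge of the band. -/
theorem bulkIndex_eq {M : ℕ} (hMN : M < N) :
    bulkIndex ε μ (M + 1) = edgeSign F.b F.c (q M) := by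
  classical
  have H := F.hillSystem hM hS
  -- Each of the `M` gaps below brings a factor `-1`, a second one if it is closed, and the parities
  -- of its edges. An open gap has opposite parities; at a closed one both signs are `1`. The total
  -- is always `1`.
  have hprod : ∀ n ∈ Finset.range M,
      (-1 : ℂ) * (if q n = p (n + 1) then -1 else 1) *
        (edgeSign F.b F.c (q n) * edgeSign F.b F.c (p (n + 1))) = 1 := by
    intro n hn
    have hn' : n + 1 < N := by have := Finset.mem_range.1 hn; lia
    by_cases hcl : q n = p (n + 1)
    · obtain ⟨-, hc⟩ := (H.closed_iff P hn').1 hcl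
      rw [if_pos hcl, ← hcl, edgeSign, if_neg fun h => h.2 hc]
      norm_num
    · rw [if_neg hcl]
      rcases H.gap_sign P hn' (lt_of_le_of_ne (P.le n hn') hcl) with ⟨h1, h2, h3, h4, -⟩ |
        ⟨h1, h2, h3, h4, -⟩
      · rw [edgeSign, if_neg fun h => h2 h.1, edgeSign, if_pos ⟨h3, h4⟩]; norm_num
      · rw [edgeSign, if_pos ⟨h1, h2⟩, edgeSign, if_neg fun h => h4 h.1]; norm_num
  have hpow : (-1 : ℂ) ^ (M + diracCount ε μ (M + 1)) =
      ∏ n ∈ Finset.range M, ((-1 : ℂ) * (if q n = p (n + 1) then -1 else 1)) := by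
    rw [F.diracCount_eq hM hS P hMN, pow_add, Finset.prod_mul_distrib, Finset.prod_const,
      Finset.card_range, Finset.prod_ite, Finset.prod_const, Finset.prod_const_one, mul_one]
  rw [bulkIndex, F.exp_sum_zakPhase hM hS P hMN,
    show M + 1 + diracCount ε μ (M + 1) - 1 = M + diracCount ε μ (M + 1) by lia, hpow, ← mul_assoc,
    ← Finset.prod_mul_distrib, Finset.prod_congr rfl hprod, Finset.prod_const_one, one_mul]

end FundamentalSystem

/-! ### Gluing solutions across the layer, and square integrability -/

section

variable {𝕜 : Type*} [RCLike 𝕜]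

theorem continuousAt_of_comp_sub {f : ℝ → ℝ} {d x : ℝ}
    (h : ContinuousAt (fun y => f (y - d)) x) : ContinuousAt f (x - d) := by
  have h1 : ContinuousAt (fun y => f (y - d)) (x - d + d) := by simpa using h
  have h2 : ContinuousAt (fun y => f (y + d - d)) (x - d) :=
    ContinuousAt.comp' (f := fun y : ℝ => y + d) (g := fun y => f (y - d)) h1 (by fun_prop)
  simpa using h2

theorem Tame.translate {f : ℝ → ℝ} (h : Tame f) (d : ℝ) : Tame fun x => f (x - d) := by
  obtain ⟨K, hK⟩ := h.bounded
  refine ⟨(h.countable.preimage (sub_left_injective (b := d))).mono fun x hx => ?_, K,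
    fun x => hK _⟩
  intro hc
  exact hx (ContinuousAt.comp' (f := fun y : ℝ => y - d) hc (by fun_prop))

theorem Sol.translate {ε μ : ℝ → ℝ} {E : ℝ} {ψ v : ℝ → 𝕜} (h : Sol ε μ E ψ v) (d : ℝ) :
    Sol (fun x => ε (x - d)) (fun x => μ (x - d)) E (fun x => ψ (x - d)) fun x => v (x - d) where
  cont := h.cont.comp (by fun_prop)
  cont_flux := h.cont_flux.comp (by fun_prop)
  deriv x hx := (h.deriv (x - d) (continuousAt_of_comp_sub hx)).comp_sub_const x d
  deriv_flux x hx := (h.deriv_flux (x - d) (continuousAt_of_comp_sub hx)).comp_sub_const x d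

/-- The function equal to `f` on `(-∞, d₁)`, to `g` on `[d₁, d₂]` and to `h` on `(d₂, ∞)`. -/
def glue {α : Type*} (d₁ d₂ : ℝ) (f g h : ℝ → α) (x : ℝ) : α :=
  if x < d₁ then f x else if x ≤ d₂ then g x else h x

section glue

variable {α : Type*} {d₁ d₂ : ℝ} {f g h : ℝ → α}

theorem glue_eventuallyEq_left {x : ℝ} (hx : x < d₁) : glue d₁ d₂ f g h =ᶠ[𝓝 x] f := by
  filter_upwards [Iio_mem_nhds hx] with y hy
  exact if_pos hy

theorem glue_eventuallyEq_mid {x : ℝ} (h₁ : d₁ < x) (h₂ : x < d₂) :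
    glue d₁ d₂ f g h =ᶠ[𝓝 x] g := by
  filter_upwards [Ioo_mem_nhds h₁ h₂] with y hy
  rw [glue, if_neg hy.1.le.not_gt, if_pos hy.2.le]

theorem glue_eventuallyEq_right (hd : d₁ ≤ d₂) {x : ℝ} (hx : d₂ < x) :
    glue d₁ d₂ f g h =ᶠ[𝓝 x] h := by
  filter_upwards [Ioi_mem_nhds hx] with y hy
  rw [glue, if_neg (hd.trans (le_of_lt hy)).not_gt, if_neg (not_le.2 hy)]

theorem continuous_glue [TopologicalSpace α] (hd : d₁ ≤ d₂) (hf : Continuous f)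
    (hg : Continuous g) (hh : Continuous h) (h₁ : f d₁ = g d₁) (h₂ : g d₂ = h d₂) :
    Continuous (glue d₁ d₂ f g h) := by
  have c1 : Continuous fun x => if x ≤ d₂ then g x else h x :=
    hg.if_le hh continuous_id continuous_const (fun x hx => by rw [hx]; exact h₂)
  have c2 : Continuous fun x => if d₁ ≤ x then (if x ≤ d₂ then g x else h x) else f x :=
    c1.if_le hf continuous_const continuous_id (fun x hx => by
      subst hx; rw [if_pos hd, h₁])
  refine c2.congr fun x => ?_
  unfold glue
  by_cases hx : x < d₁
  · rw [if_pos hx, if_neg (not_le.2 hx)]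
  · rw [if_neg hx, if_pos (not_lt.1 hx)]

theorem Tame.glue {f g h : ℝ → ℝ} (hd : d₁ ≤ d₂) (hf : Tame f) (hg : Tame g) (hh : Tame h) :
    Tame (glue d₁ d₂ f g h) := by
  obtain ⟨K₁, h₁⟩ := hf.bounded
  obtain ⟨K₂, h₂⟩ := hg.bounded
  obtain ⟨K₃, h₃⟩ := hh.bounded
  refine ⟨(((hf.countable.union hg.countable).union hh.countable).union
    (Set.countable_singleton d₁ |>.union (Set.countable_singleton d₂))).mono fun x hx => ?_,
    max K₁ (max K₂ K₃), fun x => ?_⟩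
  · by_contra hn
    simp only [Set.mem_union, Set.mem_ofPred_eq, Set.mem_singleton_iff, not_or, not_not] at hn
    obtain ⟨⟨⟨cf, cg⟩, ch⟩, n1, n2⟩ := hn
    refine hx ?_
    rcases lt_or_gt_of_ne n1 with h1 | h1
    · exact cf.congr (glue_eventuallyEq_left h1).symm
    · rcases lt_or_gt_of_ne n2 with h2 | h2
      · exact cg.congr (glue_eventuallyEq_mid h1 h2).symm
      · exact ch.congr (glue_eventuallyEq_right hd h2).symm
  · unfold Photonic.glue
    split_ifs
    · exact (h₁ x).trans (le_max_left _ _)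
    · exact (h₂ x).trans ((le_max_left _ _).trans (le_max_right _ _))
    · exact (h₃ x).trans ((le_max_right _ _).trans (le_max_right _ _))

end glue

theorem tame_const (c : ℝ) : Tame fun _ => c :=
  ⟨by simp [continuousAt_const], |c|, fun _ => le_rfl⟩

theorem isSolution_of_countable {ε μ : ℝ → ℝ} (hε : Tame ε) (hμ : Tame μ) {E : ℝ} {ψ v : ℝ → ℂ}
    (hψ : Continuous ψ) (hv : Continuous v) {S : Set ℝ} (hS : S.Countable)
    (hd : ∀ x ∉ S, HasDerivAt ψ (μ x • v x) x ∧ HasDerivAt v (-((E * ε x) • ψ x)) x) :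
    IsSolution ε μ E ψ v := by
  refine ⟨hψ, hv, fun x => ?_, fun x => ?_⟩
  · have := integral_eq_of_hasDerivAt_off_countable ψ _ hS hψ.continuousOn
      (fun y hy => (hd y hy.2).1) (hμ.intervalIntegrable_smul hv 0 x)
    simp only [Complex.real_smul] at this
    rw [this]; ring
  · have := integral_eq_of_hasDerivAt_off_countable v _ hS hv.continuousOn
      (fun y hy => (hd y hy.2).2)
      (((hε.const_mul E).intervalIntegrable_smul hψ 0 x).neg)
    rw [intervalIntegral.integral_neg] at this
    simp only [Complex.real_smul] at this
    linear_combination -this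

/-- Solutions in the three parts of a layered structure that match at the interfaces form a
solution. -/
theorem isSolution_glue {d₁ d₂ E : ℝ} (hd : d₁ ≤ d₂) {ε₁ ε₂ ε₃ μ₁ μ₂ μ₃ : ℝ → ℝ}
    (hε₁ : Tame ε₁) (hε₂ : Tame ε₂) (hε₃ : Tame ε₃) (hμ₁ : Tame μ₁) (hμ₂ : Tame μ₂)
    (hμ₃ : Tame μ₃) {ψ₁ ψ₂ ψ₃ v₁ v₂ v₃ : ℝ → ℂ} (s₁ : Sol ε₁ μ₁ E ψ₁ v₁)
    (s₂ : Sol ε₂ μ₂ E ψ₂ v₂) (s₃ : Sol ε₃ μ₃ E ψ₃ v₃) (m₁ : ψ₁ d₁ = ψ₂ d₁) (n₁ : v₁ d₁ = v₂ d₁)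
    (m₂ : ψ₂ d₂ = ψ₃ d₂) (n₂ : v₂ d₂ = v₃ d₂) :
    IsSolution (glue d₁ d₂ ε₁ ε₂ ε₃) (glue d₁ d₂ μ₁ μ₂ μ₃) E (glue d₁ d₂ ψ₁ ψ₂ ψ₃)
      (glue d₁ d₂ v₁ v₂ v₃) := by
  have hε := hε₁.glue hd hε₂ hε₃
  have hμ := hμ₁.glue hd hμ₂ hμ₃
  refine isSolution_of_countable hε hμ (continuous_glue hd s₁.cont s₂.cont s₃.cont m₁ m₂)
    (continuous_glue hd s₁.cont_flux s₂.cont_flux s₃.cont_flux n₁ n₂)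
    ((hε.countable.union hμ.countable).union
    (Set.countable_singleton d₁ |>.union (Set.countable_singleton d₂))) fun x hx => ?_
  simp only [Set.mem_union, Set.mem_ofPred_eq, Set.mem_singleton_iff, not_or, not_not] at hx
  obtain ⟨⟨cε, cμ⟩, n1, n2⟩ := hx
  rcases lt_or_gt_of_ne n1 with h1 | h1
  · have eε := glue_eventuallyEq_left (d₂ := d₂) (f := ε₁) (g := ε₂) (h := ε₃) h1
    have eμ := glue_eventuallyEq_left (d₂ := d₂) (f := μ₁) (g := μ₂) (h := μ₃) h1
    have eψ := glue_eventuallyEq_left (d₂ := d₂) (f := ψ₁) (g := ψ₂) (h := ψ₃) h1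
    have ev := glue_eventuallyEq_left (d₂ := d₂) (f := v₁) (g := v₂) (h := v₃) h1
    rw [eε.eq_of_nhds, eμ.eq_of_nhds, eψ.eq_of_nhds, ev.eq_of_nhds]
    exact ⟨(s₁.deriv x (cμ.congr eμ)).congr_of_eventuallyEq eψ,
      (s₁.deriv_flux x (cε.congr eε)).congr_of_eventuallyEq ev⟩
  · rcases lt_or_gt_of_ne n2 with h2 | h2
    · have eε := glue_eventuallyEq_mid (f := ε₁) (g := ε₂) (h := ε₃) h1 h2
      have eμ := glue_eventuallyEq_mid (f := μ₁) (g := μ₂) (h := μ₃) h1 h2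
      have eψ := glue_eventuallyEq_mid (f := ψ₁) (g := ψ₂) (h := ψ₃) h1 h2
      have ev := glue_eventuallyEq_mid (f := v₁) (g := v₂) (h := v₃) h1 h2
      rw [eε.eq_of_nhds, eμ.eq_of_nhds, eψ.eq_of_nhds, ev.eq_of_nhds]
      exact ⟨(s₂.deriv x (cμ.congr eμ)).congr_of_eventuallyEq eψ,
        (s₂.deriv_flux x (cε.congr eε)).congr_of_eventuallyEq ev⟩
    · have eε := glue_eventuallyEq_right (f := ε₁) (g := ε₂) (h := ε₃) hd h2
      have eμ := glue_eventuallyEq_right (f := μ₁) (g := μ₂) (h := μ₃) hd h2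
      have eψ := glue_eventuallyEq_right (f := ψ₁) (g := ψ₂) (h := ψ₃) hd h2
      have ev := glue_eventuallyEq_right (f := v₁) (g := v₂) (h := v₃) hd h2
      rw [eε.eq_of_nhds, eμ.eq_of_nhds, eψ.eq_of_nhds, ev.eq_of_nhds]
      exact ⟨(s₃.deriv x (cμ.congr eμ)).congr_of_eventuallyEq eψ,
        (s₃.deriv_flux x (cε.congr eε)).congr_of_eventuallyEq ev⟩

theorem integrableOn_sq_of_shift {Ψ : ℝ → ℂ} (hc : Continuous Ψ) {l : ℂ} (hl : ‖l‖ < 1)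
    (hs : ∀ x, Ψ (x + 1) = l * Ψ x) : IntegrableOn (fun x => ‖Ψ x‖ ^ 2) (Set.Ici 0) := by
  -- A rate strictly between `‖l‖` and `1` is positive even if `l = 0`, so that `log r` serves as
  -- the rate of an exponential majorant.
  obtain ⟨r, hr1, hr2⟩ : ∃ r : ℝ, ‖l‖ < r ∧ r < 1 := exists_between hl
  have hr0 : 0 < r := (norm_nonneg _).trans_lt hr1
  obtain ⟨K, hK⟩ := (isCompact_Icc (a := (0 : ℝ)) (b := 1)).exists_bound_of_continuousOn
    hc.continuousOn
  have hK0 : 0 ≤ K := (norm_nonneg _).trans (hK 0 ⟨le_rfl, zero_le_one⟩)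
  have hn : ∀ (n : ℕ) (y : ℝ), Ψ (y + n) = l ^ n * Ψ y := by
    intro n y
    induction n with
    | zero => simp
    | succ n ih => rw [Nat.cast_succ, ← add_assoc, hs, ih, pow_succ]; ring
  have hbd : ∀ x, 0 ≤ x → ‖Ψ x‖ ≤ K / r * Real.exp (Real.log r * x) := by
    intro x hx
    have h1 := Nat.floor_le hx
    have h2 := Nat.lt_floor_add_one x
    have h3 := hn ⌊x⌋₊ (x - ⌊x⌋₊)
    rw [sub_add_cancel] at h3
    have h4 : ‖Ψ (x - ⌊x⌋₊)‖ ≤ K := hK _ ⟨by linarith, by linarith⟩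
    have hlog : Real.log r < 0 := Real.log_neg hr0 hr2
    have h5 : r ^ ⌊x⌋₊ ≤ r⁻¹ * Real.exp (Real.log r * x) := by
      have e1 : r ^ ⌊x⌋₊ = Real.exp (Real.log r * ⌊x⌋₊) := by
        rw [mul_comm, Real.exp_nat_mul, Real.exp_log hr0]
      have e2 : r⁻¹ = Real.exp (-Real.log r) := by rw [Real.exp_neg, Real.exp_log hr0]
      rw [e1, e2, ← Real.exp_add]
      exact Real.exp_le_exp.2 (by nlinarith)
    rw [h3, norm_mul, norm_pow]
    calc ‖l‖ ^ ⌊x⌋₊ * ‖Ψ (x - ⌊x⌋₊)‖ ≤ r ^ ⌊x⌋₊ * K :=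
          mul_le_mul (pow_le_pow_left₀ (norm_nonneg _) hr1.le _) h4 (norm_nonneg _) (by positivity)
      _ ≤ (r⁻¹ * Real.exp (Real.log r * x)) * K := mul_le_mul_of_nonneg_right h5 hK0
      _ = _ := by ring
  have hint : IntegrableOn (fun x => (K / r) ^ 2 * Real.exp (2 * Real.log r * x)) (Set.Ici 0) := by
    rw [integrableOn_Ici_iff_integrableOn_Ioi]
    have := Real.log_neg hr0 hr2
    exact (integrableOn_exp_mul_Ioi (by linarith) 0).const_mul _
  refine Integrable.mono' hint (hc.norm.pow 2).aestronglyMeasurable ?_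
  filter_upwards [ae_restrict_mem measurableSet_Ici] with x hx
  rw [norm_pow, norm_norm]
  refine (pow_le_pow_left₀ (norm_nonneg _) (hbd x hx) 2).trans_eq ?_
  rw [mul_pow, ← Real.exp_nat_mul]
  congr 2; push_cast; ring

theorem memLp_glue {d₁ d₂ : ℝ} {f g h : ℝ → ℂ} (hc : Continuous (glue d₁ d₂ f g h))
    (hd : d₁ ≤ d₂) (hf : IntegrableOn (fun x => ‖f (-x)‖ ^ 2) (Set.Ici (-d₁)))
    (hh : IntegrableOn (fun x => ‖h x‖ ^ 2) (Set.Ici d₂)) :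
    MemLp (glue d₁ d₂ f g h) 2 volume := by
  rw [memLp_two_iff_integrable_sq_norm hc.aestronglyMeasurable, ← integrableOn_univ]
  have hf' : IntegrableOn (fun x => ‖f x‖ ^ 2) (Set.Iic d₁) := by
    have := (Measure.measurePreserving_neg (volume : Measure ℝ)).integrableOn_comp_preimage
      (MeasurableEquiv.neg ℝ).measurableEmbedding (f := fun x => ‖f (-x)‖ ^ 2) (s := Set.Ici (-d₁))
    have h2 := this.2 hf
    have e : (fun x : ℝ => -x) ⁻¹' Set.Ici (-d₁) = Set.Iic d₁ := by
      ext x; simp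
    change IntegrableOn _ ((fun x : ℝ => -x) ⁻¹' Set.Ici (-d₁)) at h2
    rw [e] at h2
    refine h2.congr_fun (fun x _ => ?_) measurableSet_Iic
    simp
  have hu : (Set.univ : Set ℝ) = (Set.Iio d₁ ∪ Set.Icc d₁ d₂) ∪ Set.Ioi d₂ := by
    ext x
    simp only [Set.mem_univ, Set.mem_union, Set.mem_Iio, Set.mem_Icc, Set.mem_Ioi, true_iff]
    by_cases h1 : x < d₁
    · exact Or.inl (Or.inl h1)
    · by_cases h2 : x ≤ d₂
      · exact Or.inl (Or.inr ⟨not_lt.1 h1, h2⟩)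
      · exact Or.inr (not_le.1 h2)
  rw [hu]
  refine ((IntegrableOn.congr_fun (hf'.mono_set Set.Iio_subset_Iic_self) (fun x hx => ?_)
    measurableSet_Iio).union (ContinuousOn.integrableOn_Icc (f := fun x => ‖glue d₁ d₂ f g h x‖ ^ 2)
      (hc.norm.pow 2).continuousOn)).union
    (IntegrableOn.congr_fun (hh.mono_set Set.Ioi_subset_Ici_self) (fun x hx => ?_)
    measurableSet_Ioi)
  · simp only [glue, if_pos (Set.mem_Iio.1 hx)]
  · have hx' : d₂ < x := hx
    simp only [glue, if_neg (hd.trans hx'.le).not_gt, if_neg (not_le.2 hx')]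

end

/-! ### Decaying solutions in a gap and the matching condition -/

namespace FundamentalSystem

variable {ε μ : ℝ → ℝ} (F : FundamentalSystem ε μ)

/-- The solution that decays at `+∞` for an energy in a gap with edge sign `s`. -/
def decaying (s E : ℝ) : ℝ → ℂ :=
  F.comb E (Real.sqrt |F.b E| : ℝ) (s * Real.sqrt |F.c E| : ℝ)

/-- The polar angle of the data of the decaying solution, with `κ` as unit of admittance. -/
def gapAngle (κ E : ℝ) : ℝ := Complex.arg ⟨Real.sqrt |F.c E|, κ * Real.sqrt |F.b E|⟩

theorem exists_polar {κ E : ℝ} (hκ : 0 < κ) (h : F.b E ≠ 0 ∨ F.c E ≠ 0) :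
    ∃ ρ : ℝ, 0 < ρ ∧ Real.sqrt |F.b E| = ρ * (Real.sin (F.gapAngle κ E) / κ) ∧
      Real.sqrt |F.c E| = ρ * Real.cos (F.gapAngle κ E) := by
  refine ⟨‖(⟨Real.sqrt |F.c E|, κ * Real.sqrt |F.b E|⟩ : ℂ)‖, norm_pos_iff.2 fun h0 => ?_, ?_, ?_⟩
  · rw [Complex.ext_iff] at h0
    simp only [Complex.zero_re, Complex.zero_im, mul_eq_zero, hκ.ne', false_or,
      Real.sqrt_eq_zero (abs_nonneg _), abs_eq_zero] at h0
    exact h.elim (fun h => h h0.2) fun h => h h0.1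
  · rw [mul_div_assoc', gapAngle, Complex.norm_mul_sin_arg]
    field_simp
  · rw [gapAngle, Complex.norm_mul_cos_arg]

theorem gapAngle_of_c_eq_zero {κ E : ℝ} (hκ : 0 < κ) (hb : F.b E ≠ 0) (hc : F.c E = 0) :
    F.gapAngle κ E = Real.pi / 2 := by
  rw [gapAngle, Complex.arg_eq_pi_div_two_iff]
  exact ⟨by simp [hc], mul_pos hκ (Real.sqrt_pos.2 (abs_pos.2 hb))⟩

theorem gapAngle_of_b_eq_zero {κ E : ℝ} (hb : F.b E = 0) : F.gapAngle κ E = 0 := by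
  rw [gapAngle, Complex.arg_eq_zero_iff]
  simp [hb]

variable (hM : IsPeriodicMedium ε μ) (hS : IsInversionSymmetric ε μ)

include hM hS

/-- The point stays in the closed first quadrant without the origin, where `Complex.arg` is
continuous. This includes the gap edges, at which only one entry vanishes. -/
theorem continuousAt_gapAngle {κ : ℝ → ℝ} (hκ : Continuous κ) {E : ℝ} (h0 : 0 < κ E)
    (h : F.b E ≠ 0 ∨ F.c E ≠ 0) : ContinuousAt (fun E => F.gapAngle (κ E) E) E := by
  have hb := (F.hillSystem hM hS).continuous_b
  have hc := (F.hillSystem hM hS).continuous_c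
  have hz : Continuous fun E => (⟨Real.sqrt |F.c E|, κ E * Real.sqrt |F.b E|⟩ : ℂ) := by
    have : Continuous fun E =>
        ((Real.sqrt |F.c E| : ℝ) : ℂ) + ((κ E * Real.sqrt |F.b E| : ℝ) : ℂ) * Complex.I := by
      fun_prop
    refine this.congr fun E => ?_
    rw [Complex.mk_eq_add_mul_I]
  refine ContinuousAt.comp (g := Complex.arg) (Complex.continuousAt_arg ?_) hz.continuousAt
  rw [Complex.mem_slitPlane_iff]
  by_cases hc0 : F.c E = 0
  · exact Or.inr (mul_pos h0 (Real.sqrt_pos.2 (abs_pos.2 (h.resolve_right (not_not.2 hc0))))).ne'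
  · exact Or.inl (Real.sqrt_pos.2 (abs_pos.2 hc0))

variable {N : ℕ} {p q : ℕ → ℝ} (P : BandEdges F.a N p q)

include P

theorem edgeSign_cases {n : ℕ} (hn : n + 1 < N) (hlt : q n < p (n + 1)) :
    (edgeSign F.b F.c (q n) = 1 ∧ (F.b (q n) ≠ 0 ∧ F.c (q n) = 0) ∧
        F.b (p (n + 1)) = 0 ∧ F.c (p (n + 1)) ≠ 0) ∨
      (edgeSign F.b F.c (q n) = -1 ∧ (F.b (q n) = 0 ∧ F.c (q n) ≠ 0) ∧
        F.b (p (n + 1)) ≠ 0 ∧ F.c (p (n + 1)) = 0) := by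
  rcases (F.hillSystem hM hS).gap_sign P hn hlt with ⟨h1, h2, h3, h4, -⟩ | ⟨h1, h2, h3, h4, -⟩
  · exact Or.inl ⟨if_neg fun h => h2 h.1, ⟨h2, h1⟩, h3, h4⟩
  · exact Or.inr ⟨if_pos ⟨h1, h2⟩, ⟨h1, h2⟩, h4, h3⟩

theorem sign_of_mem_gap {n : ℕ} (hn : n + 1 < N) (hlt : q n < p (n + 1)) {E : ℝ}
    (hE : E ∈ Set.Ioo (q n) (p (n + 1))) : F.b E ≠ 0 ∧
      F.b E = -((-1) ^ (n + 1) * edgeSign F.b F.c (q n)) * |F.b E| ∧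
      F.c E = -((-1) ^ (n + 1) * edgeSign F.b F.c (q n)) * |F.c E| := by
  have hσ := neg_one_pow_mul_self_eq (n + 1)
  have hσ' : |(-1 : ℝ) ^ (n + 1)| = 1 := by simp
  have hn1 : ∀ x : ℝ, (-1) ^ (n + 1) * x < 0 →
      x ≠ 0 ∧ x = -((-1) ^ (n + 1) * 1) * |x| := by
    intro x hx
    have h1 : |x| = -((-1) ^ (n + 1) * x) := by
      rw [← abs_of_neg hx, abs_mul, hσ', one_mul]
    refine ⟨fun h => by simp [h] at hx, ?_⟩
    rw [h1]; linear_combination (-x) * hσ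
  have hp1 : ∀ x : ℝ, 0 < (-1) ^ (n + 1) * x →
      x ≠ 0 ∧ x = -((-1) ^ (n + 1) * -1) * |x| := by
    intro x hx
    have h1 : |x| = (-1) ^ (n + 1) * x := by
      rw [← abs_of_pos hx, abs_mul, hσ', one_mul]
    refine ⟨fun h => by simp [h] at hx, ?_⟩
    rw [h1]; linear_combination (-x) * hσ
  rcases (F.hillSystem hM hS).gap_sign P hn hlt with ⟨h1, h2, -, -, h⟩ | ⟨h1, h2, -, -, h⟩
  · rw [show edgeSign F.b F.c (q n) = 1 from if_neg fun h => h2 h.1]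
    exact ⟨(hn1 _ (h E hE).1).1, (hn1 _ (h E hE).1).2, (hn1 _ (h E hE).2).2⟩
  · rw [show edgeSign F.b F.c (q n) = -1 from if_pos ⟨h1, h2⟩]
    exact ⟨(hp1 _ (h E hE).1).1, (hp1 _ (h E hE).1).2, (hp1 _ (h E hE).2).2⟩

/-- With `σ = (-1)^(n+1)`, `y = √|b|`, `z = √|c|`, the signs of `b` and `c` make `(y, s z)` an
eigenvector for `a - σ y z`. Multiplied by `σ` this is the inverse of `σ a + y z > 1`, so its
modulus is below `1`. -/
theorem exists_multiplier {n : ℕ} (hn : n + 1 < N) (hlt : q n < p (n + 1)) {E : ℝ}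
    (hE : E ∈ Set.Ioo (q n) (p (n + 1))) : ∃ l : ℂ, ‖l‖ < 1 ∧
      ∀ x, F.decaying (edgeSign F.b F.c (q n)) E (x + 1) =
        l * F.decaying (edgeSign F.b F.c (q n)) E x := by
  obtain ⟨-, hb, hc⟩ := F.sign_of_mem_gap hM hS P hn hlt hE
  have hs : edgeSign F.b F.c (q n) * edgeSign F.b F.c (q n) = 1 := by
    rcases F.edgeSign_cases hM hS P hn hlt with h | h <;> rw [h.1] <;> norm_num
  have hσ := neg_one_pow_mul_self_eq (n + 1)
  have ha := P.gap n hn E hE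
  have hdet := F.det hM hS E
  have hsb := Real.mul_self_sqrt (abs_nonneg (F.b E))
  have hsc := Real.mul_self_sqrt (abs_nonneg (F.c E))
  have hb0 := Real.sqrt_nonneg |F.b E|
  have hc0 := Real.sqrt_nonneg |F.c E|
  rw [← hsb] at hb
  rw [← hsc] at hc
  set s := edgeSign F.b F.c (q n)
  set σ : ℝ := (-1) ^ (n + 1)
  have e₁ : ∀ x, F.decaying s E x = ((Real.sqrt |F.b E| * F.ψ₁ E x +
      s * Real.sqrt |F.c E| * F.ψ₂ E x : ℝ) : ℂ) := by
    intro x; simp only [decaying, comb]; push_cast; ring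
  set y := Real.sqrt |F.b E|
  set z := Real.sqrt |F.c E|
  have ht : 0 ≤ y * z := mul_nonneg hb0 hc0
  have hprod : (σ * F.a E - y * z) * (σ * F.a E + y * z) = 1 := by
    have : F.b E * F.c E = (y * z) ^ 2 := by
      rw [hb, hc]; linear_combination (y * z) ^ 2 * (s * s * hσ + hs)
    linear_combination F.a E ^ 2 * hσ + hdet + this
  refine ⟨((F.a E - σ * (y * z) : ℝ) : ℂ), ?_, fun x => ?_⟩
  · rw [Complex.norm_real, Real.norm_eq_abs]
    have hσ' : |σ| = 1 := by simp [σ]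
    have : |F.a E - σ * (y * z)| = |σ * F.a E - y * z| := by
      rw [← one_mul |F.a E - _|, ← hσ', ← abs_mul]
      congr 1; linear_combination -(y * z) * hσ
    rw [this, abs_lt]
    constructor <;> nlinarith
  · rw [e₁, e₁, ← Complex.ofReal_mul, F.shift₁ hM E x, F.shift₂ hM hS E x]
    congr 1
    rw [hb, hc]
    linear_combination (-σ * y * y * z * F.ψ₁ E x) * hs

end FundamentalSystem

/-- The total phase rises from `-π/2 + θ(L)` to `π/2 + θ(U)`. If `θ(L) < θ(U)` the rise exceeds `π`,
so some multiple of `π` lies strictly between; without a layer `0` does. Strictness keeps the energy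
off the gap edges. -/
theorem exists_int_mul_pi_eq {L U s : ℝ} (hLU : L < U) {α β θ : ℝ → ℝ}
    (hα : ContinuousOn α (Set.Icc L U)) (hβ : ContinuousOn β (Set.Icc L U))
    (hθ : ContinuousOn θ (Set.Icc L U)) (hL : s * (α L - β L) = -(Real.pi / 2))
    (hU : s * (α U - β U) = Real.pi / 2) (h : θ L < θ U ∨ θ L = 0 ∧ θ U = 0) :
    ∃ E ∈ Set.Ioo L U, ∃ n : ℤ, s * (α E - β E) + θ E = n * Real.pi := by
  have hpi := Real.pi_pos
  obtain ⟨n, h1, h2⟩ : ∃ n : ℤ, -(Real.pi / 2) + θ L < n * Real.pi ∧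
      n * Real.pi < Real.pi / 2 + θ U := by
    rcases h with h | ⟨h, h'⟩
    · refine ⟨⌊(-(Real.pi / 2) + θ L) / Real.pi⌋ + 1, ?_, ?_⟩
      · have := Int.lt_floor_add_one ((-(Real.pi / 2) + θ L) / Real.pi)
        rw [div_lt_iff₀ hpi] at this
        exact_mod_cast this
      · have := Int.floor_le ((-(Real.pi / 2) + θ L) / Real.pi)
        rw [le_div_iff₀ hpi] at this
        push_cast
        linarith
    · exact ⟨0, by rw [h]; simp; linarith, by rw [h']; simp; linarith⟩
  have hc : ContinuousOn (fun E => s * (α E - β E) + θ E) (Set.Icc L U) :=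
    ((hα.sub hβ).const_mul s).add hθ
  obtain ⟨E, hE, he⟩ := intermediate_value_Ioo hLU.le hc (show (n * Real.pi : ℝ) ∈ _ from
    ⟨by simpa only [hL] using h1, by simpa only [hU] using h2⟩)
  exact ⟨E, hE, n, he⟩

theorem integrableOn_Ici_translate {g : ℝ → ℝ} (h : IntegrableOn g (Set.Ici 0)) (d : ℝ) :
    IntegrableOn (fun x => g (x - d)) (Set.Ici d) := by
  have h2 := ((measurePreserving_sub_right (volume : Measure ℝ) d).integrableOn_comp_preimage
    (measurableEmbedding_subRight d) (f := g) (s := Set.Ici 0)).2 h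
  have e : (fun x : ℝ => x - d) ⁻¹' Set.Ici 0 = Set.Ici d := by
    ext x; simp
  rwa [e] at h2

/-- In a homogeneous layer the pair `(κ ψ, v)` rotates at constant rate `ω`, which is why polar
angles, with `κ` as unit, are the right matching variable. -/
theorem sol_layer {E ε₀ μ₀ ω κ : ℝ} (h₁ : ω / κ = μ₀) (h₂ : ω = E * ε₀ / κ) (η d : ℝ) :
    Sol (fun _ => ε₀) (fun _ => μ₀) E
      (fun x => ((Real.sin (η + ω * (x - d)) / κ : ℝ) : ℂ))
      (fun x => ((Real.cos (η + ω * (x - d)) : ℝ) : ℂ)) := by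
  have hη : ∀ x, HasDerivAt (fun x => η + ω * (x - d)) ω x := fun x => by
    simpa using (((hasDerivAt_id x).sub_const d).const_mul ω).const_add η
  refine ⟨by fun_prop, by fun_prop, fun x _ => ?_, fun x _ => ?_⟩
  · refine ((hη x).sin.div_const κ).ofReal_comp.congr_deriv ?_
    rw [Complex.real_smul, ← Complex.ofReal_mul, ← h₁]
    congr 1; ring
  · refine (hη x).cos.ofReal_comp.congr_deriv ?_
    rw [Complex.real_smul, ← Complex.ofReal_mul, ← Complex.ofReal_neg]
    congr 1
    nth_rewrite 2 [h₂]; ring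

namespace FundamentalSystem

/-- Two half-lines whose decaying solutions have opposite edge signs support an interface mode at
every energy where their polar angles match through the layer, up to a multiple of `π`. -/
theorem exists_interfaceMode {ε₁ μ₁ ε₂ μ₂ : ℝ → ℝ} (F₁ : FundamentalSystem ε₁ μ₁)
    (F₂ : FundamentalSystem ε₂ μ₂) (hM₁ : IsPeriodicMedium ε₁ μ₁) (hM₂ : IsPeriodicMedium ε₂ μ₂)
    (hS₁ : IsInversionSymmetric ε₁ μ₁) {s E ε₀ μ₀ ω κ d₁ d₂ : ℝ} (hd : d₁ ≤ d₂)
    (hs : s = 1 ∨ s = -1) (hκ : 0 < κ) (hω₁ : ω / κ = μ₀) (hω₂ : ω = E * ε₀ / κ)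
    (hb₁ : F₁.b E ≠ 0) (hb₂ : F₂.b E ≠ 0) {l₁ l₂ : ℂ} (hl₁ : ‖l₁‖ < 1) (hl₂ : ‖l₂‖ < 1)
    (hd₁ : ∀ x, F₁.decaying (-s) E (x + 1) = l₁ * F₁.decaying (-s) E x)
    (hd₂ : ∀ x, F₂.decaying s E (x + 1) = l₂ * F₂.decaying s E x) {n : ℤ}
    (hn : s * (F₁.gapAngle κ E - F₂.gapAngle κ E) + ω * (d₂ - d₁) = n * Real.pi) :
    ∃ ψ : ℝ → ℂ, IsInterfaceMode (withLayer ε₁ ε₂ ε₀ d₁ d₂) (withLayer μ₁ μ₂ μ₀ d₁ d₂) E ψ := by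
  obtain ⟨ρ₁, hρ₁, hB₁, hC₁⟩ := F₁.exists_polar hκ (Or.inl hb₁)
  obtain ⟨ρ₂, hρ₂, hB₂, hC₂⟩ := F₂.exists_polar hκ (Or.inl hb₂)
  set β₁ := F₁.gapAngle κ E
  set β₂ := F₂.gapAngle κ E
  have hss : s * s = 1 := by rcases hs with h | h <;> rw [h] <;> norm_num
  have hsin : ∀ x, Real.sin (s * x) = s * Real.sin x := by
    intro x; rcases hs with h | h <;> simp [h]
  have hcos : ∀ x, Real.cos (s * x) = Real.cos x := by
    intro x; rcases hs with h | h <;> simp [h]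
  have hang : s * β₁ + ω * (d₂ - d₁) = s * β₂ + n * Real.pi := by linear_combination hn
  -- Reflection turns decay at `+∞` into decay at `-∞` and reverses the flux, so edge sign `-s`
  -- yields data of sign `s`. The factor `s / ρ₁` normalizes them to the angle `s β₁`; on the right,
  -- `(-1)^n` accounts for the half turns `n π`.
  set z₁ : ℂ := ((s / ρ₁ : ℝ) : ℂ)
  set z₂ : ℂ := (((-1) ^ n * (s / ρ₂) : ℝ) : ℂ)
  have S₁ := (((F₁.sol_comb E (Real.sqrt |F₁.b E| : ℝ)
    (-s * Real.sqrt |F₁.c E| : ℝ)).const_mul z₁).reflect hS₁.1 hS₁.2).translate d₁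
  have S₂ := sol_layer hω₁ hω₂ (s * β₁) d₁
  have S₃ := ((F₂.sol_comb E (Real.sqrt |F₂.b E| : ℝ)
    (s * Real.sqrt |F₂.c E| : ℝ)).const_mul z₂).translate d₂
  have c₁ : Continuous fun x => z₁ * F₁.decaying (-s) E x :=
    ((F₁.sol_comb E _ _).const_mul z₁).cont
  have c₂ : Continuous fun x => z₂ * F₂.decaying s E x :=
    ((F₂.sol_comb E _ _).const_mul z₂).cont
  have hsol := isSolution_glue hd (hM₁.tame_eps.translate d₁) (tame_const ε₀)
    (hM₂.tame_eps.translate d₂) (hM₁.tame_mu.translate d₁) (tame_const μ₀)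
    (hM₂.tame_mu.translate d₂) S₁ S₂ S₃ ?_ ?_ ?_ ?_
  · refine ⟨_, fun h0 => ?_, ?_, _, hsol⟩
    · obtain ⟨x, hx, hne⟩ := F₂.exists_comb_ne_zero hM₂ (E := E) (X := (Real.sqrt |F₂.b E| : ℝ))
        (Y := (s * Real.sqrt |F₂.c E| : ℝ))
        (Or.inl (Complex.ofReal_ne_zero.2 (Real.sqrt_pos.2 (abs_pos.2 hb₂)).ne'))
      have h1 := congrFun h0 (x + d₂)
      have hlt : d₂ < x + d₂ := by linarith [hx.1]
      rw [glue, if_neg (hd.trans hlt.le).not_gt, if_neg (not_le.2 hlt), add_sub_cancel_right,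
        Pi.zero_apply, mul_eq_zero] at h1
      refine h1.elim (fun h => ?_) hne
      refine (Complex.ofReal_ne_zero.2 ?_) h
      have : s ≠ 0 := fun h => by simp [h] at hss
      exact mul_ne_zero (zpow_ne_zero _ (by norm_num)) (div_ne_zero this hρ₂.ne')
    · refine memLp_glue hsol.cont hd ?_ ?_
      · have := integrableOn_Ici_translate (integrableOn_sq_of_shift c₁ hl₁ fun x => by
          rw [hd₁]; ring) (-d₁)
        refine this.congr_fun (fun x _ => ?_) measurableSet_Ici
        simp only [decaying, neg_sub, sub_neg_eq_add, add_comm]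
      · exact integrableOn_Ici_translate (integrableOn_sq_of_shift c₂ hl₂ fun x => by
          rw [hd₂]; ring) d₂
  · simp only [sub_self, neg_zero, comb_zero, mul_zero, add_zero, z₁, ← Complex.ofReal_mul]
    rw [hB₁, hsin]; congr 1; field_simp
  · simp only [sub_self, neg_zero, F₁.v₁_zero, F₁.v₂_zero, Complex.ofReal_zero, Complex.ofReal_one,
      mul_zero, mul_one, zero_add, add_zero, z₁, ← Complex.ofReal_mul, ← Complex.ofReal_neg]
    rw [hC₁, hcos]; congr 1; field_simp; linear_combination Real.cos β₁ * hss
  · simp only [sub_self, comb_zero, z₂, ← Complex.ofReal_mul]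
    rw [hB₂, hang, Real.sin_add_int_mul_pi, hsin]; congr 1; field_simp
  · simp only [sub_self, F₂.v₁_zero, F₂.v₂_zero, Complex.ofReal_zero, Complex.ofReal_one,
      mul_zero, mul_one, zero_add, z₂, ← Complex.ofReal_mul]
    rw [hC₂, hang, Real.cos_add_int_mul_pi, hcos]; congr 1; field_simp; linear_combination -Real.cos β₂ * hss

end FundamentalSystem

/-- The band structure below and at a gap. -/
theorem FundamentalSystem.exists_bandEdges_of_gap {ε μ : ℝ → ℝ} (F : FundamentalSystem ε μ)
    (hM : IsPeriodicMedium ε μ) (hS : IsInversionSymmetric ε μ) {m : ℕ}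
    (hgap : bandMax ε μ (m + 1) < bandMin ε μ (m + 1 + 1)) :
    ∃ p q, BandEdges F.a (m + 1 + 1) p q ∧ bandMax ε μ (m + 1) = q m ∧
      bandMin ε μ (m + 1 + 1) = p (m + 1) ∧ 0 < q m ∧
      bulkIndex ε μ (m + 1) = edgeSign F.b F.c (q m) := by
  obtain ⟨p, q, P⟩ := F.exists_bandEdges hM hS (FundamentalSystem.eigenvalueSet_nonempty_of_gap hM hS hgap)
  refine ⟨p, q, P, F.bandMax_eq hM hS P (by omega), F.bandMin_eq hM hS P (by omega), ?_,
    F.bulkIndex_eq hM hS P (by omega)⟩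
  have h0 : ∀ n < m + 1 + 1, 0 ≤ p n := by
    intro n hn
    induction n with
    | zero => exact P.zero.ge
    | succ n ih =>
      exact (ih (by omega)).trans ((P.lt n (by omega)).le.trans (P.le n hn))
  exact (h0 m (by omega)).trans_lt (P.lt m (by omega))

end Photonic

end

theorem mainTheorem8 (ε₁ μ₁ ε₂ μ₂ : ℝ → ℝ)
    (h₁ : Photonic.IsPeriodicMedium ε₁ μ₁) (h₂ : Photonic.IsPeriodicMedium ε₂ μ₂)
    (s₁ : Photonic.IsInversionSymmetric ε₁ μ₁) (s₂ : Photonic.IsInversionSymmetric ε₂ μ₂)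
    (m₁ m₂ : ℕ) (hm₁ : 1 ≤ m₁) (hm₂ : 1 ≤ m₂)
    (hgap : Photonic.bandMax ε₁ μ₁ m₁ < Photonic.bandMin ε₁ μ₁ (m₁ + 1))
    (hlower : Photonic.bandMax ε₁ μ₁ m₁ = Photonic.bandMax ε₂ μ₂ m₂)
    (hupper : Photonic.bandMin ε₁ μ₁ (m₁ + 1) = Photonic.bandMin ε₂ μ₂ (m₂ + 1))
    (hindex : Photonic.bulkIndex ε₁ μ₁ m₁ ≠ Photonic.bulkIndex ε₂ μ₂ m₂)
    (ε₀ μ₀ : ℝ) (hε₀ : 1 ≤ ε₀) (hμ₀ : 1 ≤ μ₀) (d₁ d₂ : ℝ) (hd : d₁ ≤ d₂) :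
    ∃ E ∈ Set.Ioo (Photonic.bandMax ε₁ μ₁ m₁) (Photonic.bandMin ε₁ μ₁ (m₁ + 1)),
      ∃ ψ : ℝ → ℂ, Photonic.IsInterfaceMode (Photonic.withLayer ε₁ ε₂ ε₀ d₁ d₂)
        (Photonic.withLayer μ₁ μ₂ μ₀ d₁ d₂) E ψ := by
  open Photonic in
  obtain ⟨M₁, rfl⟩ := Nat.exists_eq_add_of_le' hm₁
  obtain ⟨M₂, rfl⟩ := Nat.exists_eq_add_of_le' hm₂
  obtain ⟨F₁⟩ := nonempty_fundamentalSystem h₁.tame_eps h₁.tame_mu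
  obtain ⟨F₂⟩ := nonempty_fundamentalSystem h₂.tame_eps h₂.tame_mu
  obtain ⟨p₁, q₁, P₁, eL₁, eU₁, hpos, i₁⟩ := F₁.exists_bandEdges_of_gap h₁ s₁ hgap
  obtain ⟨p₂, q₂, P₂, eL₂, eU₂, -, i₂⟩ :=
    F₂.exists_bandEdges_of_gap h₂ s₂ (by rwa [hlower, hupper] at hgap)
  rw [i₁, i₂] at hindex
  have hL : q₂ M₂ = q₁ M₁ := by rw [← eL₂, ← hlower, eL₁]
  have hU : p₂ (M₂ + 1) = p₁ (M₁ + 1) := by rw [← eU₂, ← hupper, eU₁]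
  rw [eL₁, eU₁] at hgap ⊢
  have hgap₂ : q₂ M₂ < p₂ (M₂ + 1) := by rwa [hL, hU]
  have k₁ := F₁.edgeSign_cases h₁ s₁ P₁ (by omega) hgap
  have k₂ := F₂.edgeSign_cases h₂ s₂ P₂ (by omega) hgap₂
  have g₁ := fun E => F₁.sign_of_mem_gap h₁ s₁ P₁ (Nat.lt_succ_self _) hgap (E := E)
  have g₂ := fun E => F₂.sign_of_mem_gap h₂ s₂ P₂ (Nat.lt_succ_self _) hgap₂ (E := E)
  have r₁ := fun E => F₁.exists_multiplier h₁ s₁ P₁ (Nat.lt_succ_self _) hgap (E := E)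
  have r₂ := fun E => F₂.exists_multiplier h₂ s₂ P₂ (Nat.lt_succ_self _) hgap₂ (E := E)
  rw [hL, hU] at k₂
  rw [hL] at hindex
  simp only [hL, hU] at g₂ r₂
  set L := q₁ M₁
  set U := p₁ (M₁ + 1)
  set t₁ := edgeSign F₁.b F₁.c L
  set t₂ := edgeSign F₂.b F₂.c L
  have hne : t₁ ≠ t₂ := fun h => hindex (by rw [h])
  -- The indices take only the values `1` and `-1`, so different means opposite.
  have ht : t₁ = -t₂ := by
    rcases k₁ with ⟨a, -⟩ | ⟨a, -⟩ <;> rcases k₂ with ⟨b, -⟩ | ⟨b, -⟩ <;>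
      rw [a, b] at hne ⊢ <;> first | exact absurd rfl hne | norm_num
  have ht₂ : t₂ = 1 ∨ t₂ = -1 := k₂.imp And.left And.left
  have hμpos : 0 < μ₀ := by linarith
  have hεpos : 0 < ε₀ := by linarith
  -- The wavenumber in the layer; `ω / μ₀` is the admittance used as unit for the angles.
  set ω : ℝ → ℝ := fun E => Real.sqrt (E * ε₀ * μ₀)
  have hωpos : ∀ E, 0 < E → 0 < ω E := fun E hE => Real.sqrt_pos.2 (by positivity)
  have hωc : Continuous ω := by fun_prop
  have hκc : Continuous fun E => ω E / μ₀ := by fun_prop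
  have hκpos : ∀ E, 0 < E → 0 < ω E / μ₀ := fun E hE => div_pos (hωpos E hE) hμpos
  have hangle : ∀ {ε μ : ℝ → ℝ} (F : FundamentalSystem ε μ) (_ : IsPeriodicMedium ε μ)
      (_ : IsInversionSymmetric ε μ) (_ : F.b L ≠ 0 ∨ F.c L ≠ 0) (_ : F.b U ≠ 0 ∨ F.c U ≠ 0)
      (_ : ∀ E ∈ Set.Ioo L U, F.b E ≠ 0),
      ContinuousOn (fun E => F.gapAngle (ω E / μ₀) E) (Set.Icc L U) := by
    intro ε μ F hM hS hFL hFU hF E hE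
    refine (F.continuousAt_gapAngle hM hS hκc (hκpos E (hpos.trans_le hE.1)) ?_).continuousWithinAt
    rcases hE.1.eq_or_lt with rfl | h
    · exact hFL
    · rcases hE.2.eq_or_lt with rfl | h'
      · exact hFU
      · exact Or.inl (hF E ⟨h, h'⟩)
  have hUpos : 0 < U := hpos.trans hgap
  -- At an edge an even mode has angle `π/2` and an odd one `0`. The two media have opposite
  -- parities at `L`, and both parities switch at `U`, which reverses the sign of the difference.
  have hgL : t₂ * (F₁.gapAngle (ω L / μ₀) L - F₂.gapAngle (ω L / μ₀) L) = -(Real.pi / 2) := by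
    rcases k₂ with ⟨b, ⟨b1, b2⟩, -⟩ | ⟨b, ⟨b1, b2⟩, -⟩ <;>
      rcases k₁ with ⟨a, ⟨a1, a2⟩, -⟩ | ⟨a, ⟨a1, a2⟩, -⟩
    · exact absurd (a.trans b.symm) hne
    · rw [F₁.gapAngle_of_b_eq_zero a1, F₂.gapAngle_of_c_eq_zero (hκpos L hpos) b1 b2, b]; ring
    · rw [F₂.gapAngle_of_b_eq_zero b1, F₁.gapAngle_of_c_eq_zero (hκpos L hpos) a1 a2, b]; ring
    · exact absurd (a.trans b.symm) hne
  have hgU : t₂ * (F₁.gapAngle (ω U / μ₀) U - F₂.gapAngle (ω U / μ₀) U) = Real.pi / 2 := by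
    rcases k₂ with ⟨b, -, b1, b2⟩ | ⟨b, -, b1, b2⟩ <;>
      rcases k₁ with ⟨a, -, a1, a2⟩ | ⟨a, -, a1, a2⟩
    · exact absurd (a.trans b.symm) hne
    · rw [F₂.gapAngle_of_b_eq_zero b1, F₁.gapAngle_of_c_eq_zero (hκpos U hUpos) a1 a2, b]; ring
    · rw [F₁.gapAngle_of_b_eq_zero a1, F₂.gapAngle_of_c_eq_zero (hκpos U hUpos) b1 b2, b]; ring
    · exact absurd (a.trans b.symm) hne
  have hθ : ω L * (d₂ - d₁) < ω U * (d₂ - d₁) ∨ ω L * (d₂ - d₁) = 0 ∧ ω U * (d₂ - d₁) = 0 := by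
    rcases hd.eq_or_lt with h | h
    · exact Or.inr (by simp [h])
    · refine Or.inl (mul_lt_mul_of_pos_right (Real.sqrt_lt_sqrt (by positivity) ?_)
        (sub_pos.2 h))
      exact mul_lt_mul_of_pos_right (mul_lt_mul_of_pos_right hgap hεpos) hμpos
  obtain ⟨E, hE, n, hn⟩ := exists_int_mul_pi_eq (s := t₂) (θ := fun E => ω E * (d₂ - d₁)) hgap
    (hangle F₁ h₁ s₁ (by tauto) (by tauto) fun E hE => (g₁ E hE).1)
    (hangle F₂ h₂ s₂ (by tauto) (by tauto) fun E hE => (g₂ E hE).1)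
    (by fun_prop) hgL hgU hθ
  have hE0 : 0 < E := hpos.trans hE.1
  obtain ⟨l₁, hl₁, hd₁⟩ := r₁ E hE
  obtain ⟨l₂, hl₂, hd₂⟩ := r₂ E hE
  rw [ht] at hd₁
  have hω0 := hωpos E hE0
  refine ⟨E, hE, F₁.exists_interfaceMode F₂ h₁ h₂ s₁ hd ht₂ (hκpos E hE0) ?_ ?_ (g₁ E hE).1
    (g₂ E hE).1 hl₁ hl₂ hd₁ hd₂ hn⟩
  · field_simp
  · have := Real.mul_self_sqrt (show 0 ≤ E * ε₀ * μ₀ by positivity)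
    rw [div_div_eq_mul_div, eq_div_iff hω0.ne']
    exact this
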